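/- Let $\Bbbk$ be a commutative ring. A $\Bbbk$-linear tensor category is a symmetric monoidal $\Bbbk$-linear category with $\Bbbk$-bilinear tensor product; a tensor functor is a strong symmetric monoidal $\Bbbk$-linear functor; a groupoid is finite if it has finitely many objects and morphisms. Let $\mathrm{Sp}_\Bbbk$ be the $\Bbbk$-linear category whose objects are the finite groupoids, and where $\mathrm{Sp}_\Bbbk(H,G)=\Bbbk\otimes_{\mathbb Z}K_0$, with $K_0$ the Grothendieck group of the commutative monoid (under disjoint union of $S$) of isomorphism classes of spans of functors $H\xleftarrow{b}S\xrightarrow{a}G$ with $S$ a finite groupoid; two spans are isomorphic if there is an equivalence between their middle groupoids which is compatible with the legs up to natural isomorphism. Spans are composed by iso-comma squares. Let $\mathrm{Bi}_\Bbbk$ be the $\Bbbk$-linear category with the same objects and with $\mathrm{Bi}_\Bbbk(H,G)=\Bbbk\otimes_{\mathbb Z}K_0$ for the monoid (under disjoint union) of isomorphism classes of finite bisets $H^{\mathrm{op}}\times G\to\mathrm{set}$, composed by coends. The cartesian product of groupoids makes both of them $\Bbbk$-linear tensor categories, whose unit is the trivial group $1$. Let $F\colon\mathrm{Sp}_\Bbbk\to\mathrm{Bi}_\Bbbk$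 be the $\Bbbk$-linear tensor functor which is the identity on objects and sends the class of a span $(b,a)$ to the class of the biset $\int^{s\in S}G(as,-)\times H(-,bs)$. The category $\mathcal M$ of global Mackey functors, respectively $\mathcal F$ of biset functors, is the category of $\Bbbk$-linear functors from $\mathrm{Sp}_\Bbbk$, respectively $\mathrm{Bi}_\Bbbk$, to $\Bbbk$-modules, a $\Bbbk$-linear tensor category under Day convolution. Restriction along $F$ is a lax symmetric monoidal functor $F^*\colon\mathcal F\to\mathcal M$. Hence $A:=F^*(\mathbb 1)=\mathrm{Bi}_\Bbbk(1,F-)$, the restriction of the Burnside biset functor $\mathbb 1$, is a commutative monoid in $\mathcal M$ (the global Green functor $A$). Its category of modules $A\text{-}\mathrm{Mod}$ in $\mathcal M$ is a $\Bbbk$-linear tensor category with unit $A$, where $M\otimes_AM'$ is the coequalizer of the two action maps $M\otimes A\otimes M'\rightrightarrows M\otimes M'$; the forgetful functor $U\colon A\text{-}\mathrm{Mod}\to\mathcal M$ is lax symmetric monoidal through the projections $M\otimes M'\to M\otimes_AM'$ and the unit $\mathbb 1\to A$ of $A$. Let $E\colon\mathcal F\to A\text{-}\mathrm{Mod}$ be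 the canonical functor which sends $N$ to $F^*N$ with the action $A\otimes F^*N\to F^*(\mathbb 1\otimes N)\cong F^*N$, so that $U\circ E=F^*$. For a normal subgroup $N$ of a finite group $G$ and a global Mackey functor $M$, let $\mathrm{inf}^G_{G/N}\colon M(G/N)\to M(G)$ and $\mathrm{def}^G_{G/N}\colon M(G)\to M(G/N)$ be the values of $M$ at the spans $G/N\leftarrow G=G$ and $G=G\to G/N$. Let $\mathcal D\subseteq\mathcal M$ be the full subcategory of those $M$ such that $$\mathrm{def}^G_{G/N}\circ\mathrm{inf}^G_{G/N}=\mathrm{id}_{M(G/N)}\quad\text{for every finite group } G \text{ and every normal subgroup } N\trianglelefteq G .$$ Then: 1. The functor $E$ is an equivalence of $\Bbbk$-linear tensor categories: it is an equivalence, it is $\Bbbk$-linear, and it has a strong symmetric monoidal structure for which $U\circ E=F^*$ as lax symmetric monoidal functors. 2. The functors $F^*$ and $U$ are fully faithful, the essential image of each is $\mathcal D$, and their structure maps $F^*N\otimes F^*N'\to F^*(N\otimes N')$ and $UX\otimes UY\to U(X\otimes_AY)$ are isomorphisms for all $N,N'\in\mathcal F$ and $X,Y\in A\text{-}\mathrm{Mod}$.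 Thus both categories are identified with $\mathcal D$, compatibly with tensor products. 3. The subcategory $\mathcal D$ is reflective in $\mathcal M$ (its inclusion has a left adjoint), and it is a tensor ideal: if $M\in\mathcal M$ and $N\in\mathcal D$, then $M\otimes N\in\mathcal D$. -/

import Mathlib

open CategoryTheory MonoidalCategory Limits

universe u v w u₁

/-! ## Finite groupoids -/

/-- A finite groupoid: finitely many objects and finitely many morphisms. -/
structure FinGrpd : Type 1 where
  carrier : Type
  [grpd : Groupoid.{0} carrier]
  [finObj : Finite carrier]
  [finHom : ∀ x y : carrier, Finite (x ⟶ y)]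

namespace FinGrpd

instance : CoeSort FinGrpd (Type) := ⟨FinGrpd.carrier⟩

attribute [instance] FinGrpd.grpd FinGrpd.finObj FinGrpd.finHom

/-- The one-object groupoid of a finite group. -/
def ofGroup (G : Type) [Group G] [Finite G] : FinGrpd where
  carrier := SingleObj G
  finObj := inferInstanceAs (Finite Unit)
  finHom _ _ := inferInstanceAs (Finite G)

/-- The trivial group, as a groupoid. -/
def one : FinGrpd where
  carrier := Discrete PUnit.{1}
  finObj := Finite.of_injective (fun x : Discrete PUnit.{1} => x.as) (fun x y _ => by cases x; cases y; rfl)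
  finHom _ _ := inferInstance

/-- The empty groupoid. -/
def empty : FinGrpd where
  carrier := Discrete PEmpty.{1}
  finObj := Finite.of_injective (fun x : Discrete PEmpty.{1} => x.as) (fun x => x.as.elim)
  finHom _ _ := inferInstance

/-- The cartesian product of finite groupoids. -/
def prod (G H : FinGrpd) : FinGrpd where
  carrier := G.carrier × H.carrier
  finHom x y := inferInstanceAs (Finite ((x.1 ⟶ y.1) × (x.2 ⟶ y.2)))

/-- The disjoint union of finite groupoids. -/
def sum (G H : FinGrpd) : FinGrpd where
  carrier := G.carrier ⊕ H.carrier
  grpd :=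
    { inv := fun {x y} f => match x, y, f with
        | .inl _, .inl _, f => ⟨Groupoid.inv f.down⟩
        | .inr _, .inr _, f => ⟨Groupoid.inv f.down⟩
      inv_comp := by
        rintro (x | x) (y | y) f
        · exact congrArg ULift.up (Groupoid.inv_comp f.down)
        · exact (hom_inl_inr_false _ _ f).elim
        · exact (hom_inr_inl_false _ _ f).elim
        · exact congrArg ULift.up (Groupoid.inv_comp f.down)
      comp_inv := by
        rintro (x | x) (y | y) f
        · exact congrArg ULift.up (Groupoid.comp_inv f.down)
        · exact (hom_inl_inr_false _ _ f).elim
        · exact (hom_inr_inl_false _ _ f).elim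
        · exact congrArg ULift.up (Groupoid.comp_inv f.down) }
  finHom := by
    rintro (x | x) (y | y)
    · exact inferInstanceAs (Finite (ULift (x ⟶ y)))
    · exact inferInstanceAs (Finite PEmpty)
    · exact inferInstanceAs (Finite PEmpty)
    · exact inferInstanceAs (Finite (ULift (x ⟶ y)))

/-- The iso-comma groupoid `a / b` of a cospan of functors (all morphisms being invertible, it is
the comma category): objects are triples `(s, t, γ : a s ⟶ b t)`. -/
def isoComma {S T G : FinGrpd} (a : S.carrier ⥤ G.carrier) (b : T.carrier ⥤ G.carrier) :
    FinGrpd where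
  carrier := Comma a b
  grpd :=
    { inv := fun {x y} f =>
        { left := Groupoid.inv f.left
          right := Groupoid.inv f.right
          w := by
            have h := f.w
            simp only [Groupoid.inv_eq_inv, Functor.map_inv, IsIso.inv_comp_eq] at *
            rw [← Category.assoc, h]; simp }
      inv_comp := fun f => Comma.hom_ext _ _ (Groupoid.inv_comp f.left) (Groupoid.inv_comp f.right)
      comp_inv := fun f => Comma.hom_ext _ _ (Groupoid.comp_inv f.left) (Groupoid.comp_inv f.right) }
  finObj := Finite.of_injective
    (β := Σ p : S.carrier × T.carrier, (a.obj p.1 ⟶ b.obj p.2))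
    (fun x => ⟨(x.left, x.right), x.hom⟩) (by
      rintro ⟨l, r, h⟩ ⟨l', r', h'⟩ e
      simp only [Sigma.mk.injEq, Prod.mk.injEq] at e
      obtain ⟨⟨rfl, rfl⟩, e⟩ := e
      cases e; rfl)
  finHom x y := Finite.of_injective
    (β := (x.left ⟶ y.left) × (x.right ⟶ y.right)) (fun f => (f.left, f.right))
    (fun f g e => Comma.hom_ext f g (congrArg Prod.fst e) (congrArg Prod.snd e))

end FinGrpd

/-! ## Spans of finite groupoids -/

/-- A span `H ← S → G` of functors between finite groupoids, a 1-cell from `H` to `G`. -/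
structure GSpan (H G : FinGrpd) : Type 1 where
  apex : FinGrpd
  l : apex.carrier ⥤ H.carrier
  r : apex.carrier ⥤ G.carrier

namespace GSpan

variable {H G K L H' G' K' : FinGrpd}

/-- Isomorphism of 1-cells in the bicategory of spans. A 2-cell from `S` to `S'` is represented by
a functor `f` between the apices and natural isomorphisms filling the two triangles, and it is
invertible exactly when `f` is an equivalence. -/
def Rel (S S' : GSpan H G) : Prop :=
  ∃ f : S.apex.carrier ⥤ S'.apex.carrier,
    f.IsEquivalence ∧ Nonempty (f ⋙ S'.l ≅ S.l) ∧ Nonempty (f ⋙ S'.r ≅ S.r)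

theorem Rel.refl (S : GSpan H G) : Rel S S :=
  ⟨𝟭 _, inferInstance, ⟨Functor.leftUnitor _⟩, ⟨Functor.leftUnitor _⟩⟩

theorem Rel.symm {S S' : GSpan H G} : Rel S S' → Rel S' S := by
  rintro ⟨f, hf, ⟨α⟩, ⟨β⟩⟩
  refine ⟨f.inv, inferInstance, ⟨?_⟩, ⟨?_⟩⟩
  · exact Functor.isoWhiskerLeft f.inv α.symm ≪≫ (Functor.associator _ _ _).symm ≪≫
      Functor.isoWhiskerRight f.asEquivalence.counitIso S'.l ≪≫ Functor.leftUnitor _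
  · exact Functor.isoWhiskerLeft f.inv β.symm ≪≫ (Functor.associator _ _ _).symm ≪≫
      Functor.isoWhiskerRight f.asEquivalence.counitIso S'.r ≪≫ Functor.leftUnitor _

theorem Rel.trans {S S' S'' : GSpan H G} : Rel S S' → Rel S' S'' → Rel S S'' := by
  rintro ⟨f, hf, ⟨α⟩, ⟨β⟩⟩ ⟨g, hg, ⟨α'⟩, ⟨β'⟩⟩
  exact ⟨f ⋙ g, inferInstance,
    ⟨Functor.associator _ _ _ ≪≫ Functor.isoWhiskerLeft f α' ≪≫ α⟩,
    ⟨Functor.associator _ _ _ ≪≫ Functor.isoWhiskerLeft f β' ≪≫ β⟩⟩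

instance setoid (H G : FinGrpd) : Setoid (GSpan H G) :=
  ⟨Rel, Rel.refl, Rel.symm, Rel.trans⟩

/-- The span `G = G → H` of a functor. -/
def push (a : G.carrier ⥤ H.carrier) : GSpan G H := ⟨G, 𝟭 _, a⟩

/-- The span `H ← G = G` of a functor. -/
def pull (a : G.carrier ⥤ H.carrier) : GSpan H G := ⟨G, a, 𝟭 _⟩

/-- Horizontal composition of `S : K → H` and `T : H → G`, by the iso-comma square in the
middle. -/
def comp (S : GSpan K H) (T : GSpan H G) : GSpan K G where
  apex := FinGrpd.isoComma S.r T.l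
  l := Comma.fst S.r T.l ⋙ S.l
  r := Comma.snd S.r T.l ⋙ T.r

/-- The sum of two parallel spans, by disjoint union of the apices. -/
def add (S T : GSpan H G) : GSpan H G where
  apex := S.apex.sum T.apex
  l := S.l.sum' T.l
  r := S.r.sum' T.r

/-- The span with empty apex. -/
def zero (H G : FinGrpd) : GSpan H G where
  apex := FinGrpd.empty
  l := Discrete.functor PEmpty.elim
  r := Discrete.functor PEmpty.elim

/-- The product of two spans. -/
def tens (S : GSpan H G) (S' : GSpan H' G') : GSpan (H.prod H') (G.prod G') where
  apex := S.apex.prod S'.apex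
  l := S.l.prod S'.l
  r := S.r.prod S'.r

theorem rel_mk {S S' : GSpan H G} (f : S.apex.carrier ⥤ S'.apex.carrier)
    (h₁ : f.Faithful) (h₂ : f.Full) (h₃ : f.EssSurj)
    (α : f ⋙ S'.l ≅ S.l) (β : f ⋙ S'.r ≅ S.r) : Rel S S' :=
  ⟨f, { }, ⟨α⟩, ⟨β⟩⟩

theorem comp_congr {S S' : GSpan K H} {T T' : GSpan H G} :
    Rel S S' → Rel T T' → Rel (comp S T) (comp S' T') := by
  rintro ⟨f, hf, ⟨α⟩, ⟨β⟩⟩ ⟨g, hg, ⟨α'⟩, ⟨β'⟩⟩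
  let F : Comma S.r T.l ⥤ Comma S'.r T'.l :=
    Comma.map (F₁ := f) (F₂ := g) (F := 𝟭 H.carrier) (β.hom) (α'.inv)
  have : F.IsEquivalence := Comma.isEquivalenceMap _ _
  refine ⟨F, this, ⟨?_⟩, ⟨?_⟩⟩
  · exact Functor.isoWhiskerLeft (Comma.fst S.r T.l) α
  · exact Functor.isoWhiskerLeft (Comma.snd S.r T.l) β'

section

variable {A B C : Type} [Groupoid.{0} A] [Groupoid.{0} B] [Groupoid.{0} C]

theorem fst_faithful (a : A ⥤ B) : (Comma.fst a (𝟭 B)).Faithful where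
  map_injective {X Y} f g h := by
    refine Comma.hom_ext _ _ h ?_
    have hf := f.w
    have hg := g.w
    have h' : f.left = g.left := h
    rw [h', hg] at hf
    exact ((cancel_epi X.hom).1 hf).symm

theorem fst_full (a : A ⥤ B) : (Comma.fst a (𝟭 B)).Full where
  map_surjective {X Y} f := ⟨⟨f, inv X.hom ≫ a.map f ≫ Y.hom, by simp⟩, rfl⟩

theorem fst_essSurj (a : A ⥤ B) : (Comma.fst a (𝟭 B)).EssSurj where
  mem_essImage x := ⟨⟨x, a.obj x, 𝟙 _⟩, ⟨Iso.refl _⟩⟩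

/-- The natural isomorphism of an iso-comma square over an identity functor. -/
noncomputable def fstIso (a : A ⥤ B) : Comma.fst a (𝟭 B) ⋙ a ≅ Comma.snd a (𝟭 B) :=
  NatIso.ofComponents (fun X => asIso X.hom) (fun f => f.w)

theorem snd_faithful (d : A ≌ B) (b : C ⥤ B) : (Comma.snd d.functor b).Faithful where
  map_injective {X Y} f g h := by
    refine Comma.hom_ext _ _ ?_ h
    have hf := f.w
    have hg := g.w
    have h' : f.right = g.right := h
    rw [h', ← hg] at hf
    exact d.functor.map_injective ((cancel_mono _).1 hf)

theorem snd_full (d : A ≌ B) (b : C ⥤ B) : (Comma.snd d.functor b).Full where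
  map_surjective {X Y} f :=
    ⟨⟨d.functor.preimage (X.hom ≫ b.map f ≫ inv Y.hom), f, by simp⟩, rfl⟩

theorem snd_essSurj (d : A ≌ B) (b : C ⥤ B) : (Comma.snd d.functor b).EssSurj where
  mem_essImage x :=
    ⟨⟨d.inverse.obj (b.obj x), x, (d.counitIso.app _).hom⟩, ⟨Iso.refl _⟩⟩

/-- The natural isomorphism of an iso-comma square over an equivalence. -/
noncomputable def sndIso (d : A ≌ B) (b : C ⥤ B) :
    Comma.snd d.functor b ⋙ b ⋙ d.inverse ≅ Comma.fst d.functor b :=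
  Functor.isoWhiskerRight (NatIso.ofComponents (fun X => asIso X.hom)
      (fun f => f.w) : Comma.fst d.functor b ⋙ d.functor ≅ Comma.snd d.functor b ⋙ b).symm
    d.inverse ≪≫ Functor.isoWhiskerLeft (Comma.fst d.functor b) d.unitIso.symm

end

/-- Postcomposition with the span of a functor. -/
theorem comp_push (S : GSpan K H) (a : H.carrier ⥤ G.carrier) :
    Rel (comp S (push a)) ⟨S.apex, S.l, S.r ⋙ a⟩ :=
  rel_mk (Comma.fst S.r (𝟭 H.carrier)) (fst_faithful _) (fst_full _) (fst_essSurj _) (Iso.refl _)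
    (Functor.isoWhiskerRight (fstIso S.r) a)

/-- Precomposition with the span of an equivalence. -/
theorem push_comp (d : K.carrier ≌ H.carrier) (S : GSpan H G) :
    Rel (comp (push d.functor) S) ⟨S.apex, S.l ⋙ d.inverse, S.r⟩ :=
  rel_mk (Comma.snd d.functor S.l) (snd_faithful _ _) (snd_full _ _) (snd_essSurj _ _)
    (sndIso d S.l) (Iso.refl _)

theorem comp_assoc (S : GSpan K H) (T : GSpan H G) (U : GSpan G L) :
    Rel (comp (comp S T) U) (comp S (comp T U)) := by
  let F : Comma (Comma.snd S.r T.l ⋙ T.r) U.l ⥤ Comma S.r (Comma.fst T.r U.l ⋙ T.l) :=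
    { obj := fun X => ⟨X.left.left, ⟨X.left.right, X.right, X.hom⟩, X.left.hom⟩
      map := fun {X Y} f => ⟨f.left.left, ⟨f.left.right, f.right, f.w⟩, f.left.w⟩ }
  refine rel_mk F ⟨?_⟩ ⟨?_⟩ ⟨?_⟩ (Iso.refl _) (Iso.refl _)
  · intro X Y f g h
    have h1 := congrArg (fun t => t.left) h
    have h2 := congrArg (fun t => t.right.left) h
    have h3 := congrArg (fun t => t.right.right) h
    exact Comma.hom_ext _ _ (Comma.hom_ext _ _ h1 h2) h3
  · intro X Y f
    exact ⟨⟨⟨f.left, f.right.left, f.w⟩, f.right.right, f.right.w⟩, rfl⟩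
  · intro X
    exact ⟨⟨⟨X.left, X.right.left, X.hom⟩, X.right.right, X.right.hom⟩, ⟨Iso.refl _⟩⟩

theorem tens_congr {S S' : GSpan H G} {T T' : GSpan H' G'} :
    Rel S S' → Rel T T' → Rel (tens S T) (tens S' T') := by
  rintro ⟨f, hf, ⟨α⟩, ⟨β⟩⟩ ⟨g, hg, ⟨α'⟩, ⟨β'⟩⟩
  refine ⟨f.prod g, ?_, ⟨?_⟩, ⟨?_⟩⟩
  · exact inferInstanceAs (f.asEquivalence.prod g.asEquivalence).functor.IsEquivalence
  · exact NatIso.prod α α'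
  · exact NatIso.prod β β'

theorem tens_comp (S : GSpan K H) (T : GSpan H G) (S' : GSpan K' H') (T' : GSpan H' G') :
    Rel (comp (tens S S') (tens T T')) (tens (comp S T) (comp S' T')) := by
  let F : Comma (S.r.prod S'.r) (T.l.prod T'.l) ⥤ Comma S.r T.l × Comma S'.r T'.l :=
    { obj := fun X => (⟨X.left.1, X.right.1, X.hom.1⟩, ⟨X.left.2, X.right.2, X.hom.2⟩)
      map := fun {X Y} f => (⟨f.left.1, f.right.1, congrArg Prod.fst f.w⟩,
        ⟨f.left.2, f.right.2, congrArg Prod.snd f.w⟩) }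
  refine rel_mk F ⟨?_⟩ ⟨?_⟩ ⟨?_⟩ (Iso.refl _) (Iso.refl _)
  · intro X Y f g h
    have h1 := congrArg (fun t => t.1.left) h
    have h2 := congrArg (fun t => t.1.right) h
    have h3 := congrArg (fun t => t.2.left) h
    have h4 := congrArg (fun t => t.2.right) h
    exact Comma.hom_ext _ _ (Prod.ext h1 h3) (Prod.ext h2 h4)
  · intro X Y f
    exact ⟨⟨(f.1.left, f.2.left), (f.1.right, f.2.right), Prod.ext f.1.w f.2.w⟩, rfl⟩
  · intro X
    exact ⟨⟨(X.1.left, X.2.left), (X.1.right, X.2.right), (X.1.hom, X.2.hom)⟩, ⟨Iso.refl _⟩⟩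

section

variable {A B P Q : Type} [Category.{0} A] [Category.{0} B] [Category.{0} P] [Category.{0} Q]

/-- Functors out of a disjoint union, up to isomorphism. -/
def sumIso {F : A ⥤ P} {G : B ⥤ P} {H : P ⥤ Q} {F' : A ⥤ Q} {G' : B ⥤ Q}
    (α : F ⋙ H ≅ F') (β : G ⋙ H ≅ G') : F.sum' G ⋙ H ≅ F'.sum' G' :=
  Functor.sumIsoExt α β

theorem sum_faithful {F : A ⥤ P} {G : B ⥤ P} (hF : F.Faithful) (hG : G.Faithful) :
    (F.sum' G).Faithful where
  map_injective {X Y} f g h := by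
    rcases X with X | X <;> rcases Y with Y | Y
    · exact congrArg ULift.up (hF.map_injective h)
    · exact (hom_inl_inr_false _ _ f).elim
    · exact (hom_inr_inl_false _ _ f).elim
    · exact congrArg ULift.up (hG.map_injective h)

theorem sum_full {F : A ⥤ P} {G : B ⥤ P} (hF : F.Full) (hG : G.Full)
    (h : ∀ a b, (F.obj a ⟶ G.obj b) → False) (h' : ∀ a b, (G.obj b ⟶ F.obj a) → False) :
    (F.sum' G).Full where
  map_surjective {X Y} f := by
    rcases X with X | X <;> rcases Y with Y | Y
    · exact ⟨⟨F.preimage f⟩, F.map_preimage f⟩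
    · exact (h _ _ f).elim
    · exact (h' _ _ f).elim
    · exact ⟨⟨G.preimage f⟩, G.map_preimage f⟩

theorem sum_essSurj {F : A ⥤ P} {G : B ⥤ P}
    (h : ∀ p, (∃ a, Nonempty (F.obj a ≅ p)) ∨ (∃ b, Nonempty (G.obj b ≅ p))) :
    (F.sum' G).EssSurj where
  mem_essImage p := by
    rcases h p with ⟨a, ha⟩ | ⟨b, hb⟩
    · exact ⟨Sum.inl a, ha⟩
    · exact ⟨Sum.inr b, hb⟩

theorem inl_faithful {F : P ⥤ A} (hF : F.Faithful) : (F ⋙ Sum.inl_ A B).Faithful where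
  map_injective h := F.map_injective (congrArg ULift.down h)

theorem inr_faithful {F : P ⥤ B} (hF : F.Faithful) : (F ⋙ Sum.inr_ A B).Faithful where
  map_injective h := F.map_injective (congrArg ULift.down h)

theorem inl_full {F : P ⥤ A} (hF : F.Full) : (F ⋙ Sum.inl_ A B).Full where
  map_surjective f := ⟨F.preimage f.down, congrArg ULift.up (F.map_preimage f.down)⟩

theorem inr_full {F : P ⥤ B} (hF : F.Full) : (F ⋙ Sum.inr_ A B).Full where
  map_surjective f := ⟨F.preimage f.down, congrArg ULift.up (F.map_preimage f.down)⟩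

theorem id_faithful : (𝟭 A).Faithful := inferInstance

theorem id_full : (𝟭 A).Full := inferInstance

theorem empty_faithful (F : Discrete PEmpty.{1} ⥤ P) : F.Faithful where
  map_injective {X} := X.as.elim

theorem empty_full (F : Discrete PEmpty.{1} ⥤ P) : F.Full where
  map_surjective {X} := X.as.elim

end

theorem add_congr {S S' T T' : GSpan H G} :
    Rel S S' → Rel T T' → Rel (add S T) (add S' T') := by
  rintro ⟨f, hf, ⟨α⟩, ⟨β⟩⟩ ⟨g, hg, ⟨α'⟩, ⟨β'⟩⟩
  refine rel_mk ((f ⋙ Sum.inl_ _ _).sum' (g ⋙ Sum.inr_ _ _))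
    (sum_faithful (inl_faithful inferInstance) (inr_faithful inferInstance))
    (sum_full (inl_full inferInstance) (inr_full inferInstance)
      (fun _ _ => hom_inl_inr_false _ _) (fun _ _ => hom_inr_inl_false _ _))
    (sum_essSurj ?_) (sumIso α α') (sumIso β β')
  rintro (p | p)
  · exact Or.inl ⟨_, ⟨(Sum.inl_ _ _).mapIso (f.objObjPreimageIso p)⟩⟩
  · exact Or.inr ⟨_, ⟨(Sum.inr_ _ _).mapIso (g.objObjPreimageIso p)⟩⟩

theorem add_comm' (S T : GSpan H G) : Rel (add S T) (add T S) := by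
  refine rel_mk ((𝟭 _ ⋙ Sum.inr_ _ _).sum' (𝟭 _ ⋙ Sum.inl_ _ _))
    (sum_faithful (inr_faithful id_faithful) (inl_faithful id_faithful))
    (sum_full (inr_full id_full) (inl_full id_full)
      (fun _ _ => hom_inr_inl_false _ _) (fun _ _ => hom_inl_inr_false _ _))
    (sum_essSurj ?_) (sumIso (Iso.refl _) (Iso.refl _)) (sumIso (Iso.refl _) (Iso.refl _))
  rintro (p | p)
  · exact Or.inr ⟨_, ⟨Iso.refl _⟩⟩
  · exact Or.inl ⟨_, ⟨Iso.refl _⟩⟩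

theorem add_assoc' (S T U : GSpan H G) : Rel (add (add S T) U) (add S (add T U)) := by
  refine rel_mk (((𝟭 _ ⋙ Sum.inl_ _ _).sum' ((𝟭 _ ⋙ Sum.inl_ _ _) ⋙ Sum.inr_ _ _)).sum'
      ((𝟭 _ ⋙ Sum.inr_ _ _) ⋙ Sum.inr_ _ _))
    (sum_faithful (sum_faithful (inl_faithful id_faithful)
      (inr_faithful (inl_faithful id_faithful))) (inr_faithful (inr_faithful id_faithful)))
    (sum_full (sum_full (inl_full id_full) (inr_full (inl_full id_full))
      (fun _ _ => hom_inl_inr_false _ _) (fun _ _ => hom_inr_inl_false _ _))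
      (inr_full (inr_full id_full)) ?_ ?_)
    (sum_essSurj ?_)
    (sumIso (sumIso (Iso.refl _) (Iso.refl _)) (Iso.refl _))
    (sumIso (sumIso (Iso.refl _) (Iso.refl _)) (Iso.refl _))
  · rintro (a | a) b f
    · exact hom_inl_inr_false _ _ f
    · exact hom_inl_inr_false _ _ f.down
  · rintro (a | a) b f
    · exact hom_inr_inl_false _ _ f
    · exact hom_inr_inl_false _ _ f.down
  · rintro (p | p | p)
    · exact Or.inl ⟨Sum.inl p, ⟨Iso.refl _⟩⟩
    · exact Or.inl ⟨Sum.inr p, ⟨Iso.refl _⟩⟩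
    · exact Or.inr ⟨p, ⟨Iso.refl _⟩⟩

theorem zero_add' (S : GSpan H G) : Rel (add (zero H G) S) S := by
  refine rel_mk ((Discrete.functor PEmpty.elim).sum' (𝟭 _))
    (sum_faithful (empty_faithful _) id_faithful)
    (sum_full (empty_full _) id_full (fun a => a.as.elim) (fun a => a.as.elim))
    (sum_essSurj ?_) (sumIso (Discrete.natIso fun a => a.as.elim) (Iso.refl _))
    (sumIso (Discrete.natIso fun a => a.as.elim) (Iso.refl _))
  exact fun p => Or.inr ⟨p, ⟨Iso.refl _⟩⟩

theorem rel_zero (S : GSpan H G) (h : S.apex.carrier → False) : Rel S (zero H G) := by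
  refine Rel.symm (rel_mk (Discrete.functor PEmpty.elim) (empty_faithful _) (empty_full _)
    ⟨fun x => (h x).elim⟩ (Discrete.natIso fun a => a.as.elim) (Discrete.natIso fun a => a.as.elim))

section

variable {A A' B B' C : Type} [Groupoid.{0} A] [Groupoid.{0} A'] [Groupoid.{0} B] [Groupoid.{0} B']
  [Groupoid.{0} C]

/-- Inclusion of an iso-comma groupoid. -/
def commaInl (a : A ⥤ C) (b : B ⥤ C) (b' : B' ⥤ C) : Comma a b ⥤ Comma a (b.sum' b') where
  obj X := ⟨X.left, Sum.inl X.right, X.hom⟩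
  map f := ⟨f.left, ⟨f.right⟩, f.w⟩

/-- Inclusion of an iso-comma groupoid. -/
def commaInr (a : A ⥤ C) (b : B ⥤ C) (b' : B' ⥤ C) : Comma a b' ⥤ Comma a (b.sum' b') where
  obj X := ⟨X.left, Sum.inr X.right, X.hom⟩
  map f := ⟨f.left, ⟨f.right⟩, f.w⟩

/-- Inclusion of an iso-comma groupoid. -/
def inlComma (a : A ⥤ C) (a' : A' ⥤ C) (b : B ⥤ C) : Comma a b ⥤ Comma (a.sum' a') b where
  obj X := ⟨Sum.inl X.left, X.right, X.hom⟩
  map f := ⟨⟨f.left⟩, f.right, f.w⟩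

/-- Inclusion of an iso-comma groupoid. -/
def inrComma (a : A ⥤ C) (a' : A' ⥤ C) (b : B ⥤ C) : Comma a' b ⥤ Comma (a.sum' a') b where
  obj X := ⟨Sum.inr X.left, X.right, X.hom⟩
  map f := ⟨⟨f.left⟩, f.right, f.w⟩

end

theorem comp_add (S : GSpan K H) (T T' : GSpan H G) :
    Rel (comp S (add T T')) (add (comp S T) (comp S T')) := by
  refine Rel.symm (rel_mk ((commaInl S.r T.l T'.l).sum' (commaInr S.r T.l T'.l))
    (sum_faithful ⟨?_⟩ ⟨?_⟩) (sum_full ⟨?_⟩ ⟨?_⟩ ?_ ?_) (sum_essSurj ?_)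
    (sumIso (Iso.refl _) (Iso.refl _)) (sumIso (Iso.refl _) (Iso.refl _)))
  · exact fun {X Y} f g h => Comma.hom_ext _ _ (congrArg (fun t => t.left) h)
      (congrArg (fun t => t.right.down) h)
  · exact fun {X Y} f g h => Comma.hom_ext _ _ (congrArg (fun t => t.left) h)
      (congrArg (fun t => t.right.down) h)
  · exact fun {X Y} f => ⟨⟨f.left, f.right.down, f.w⟩, rfl⟩
  · exact fun {X Y} f => ⟨⟨f.left, f.right.down, f.w⟩, rfl⟩
  · exact fun a b f => hom_inl_inr_false _ _ f.right
  · exact fun a b f => hom_inr_inl_false _ _ f.right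
  · rintro ⟨x, y | y, h⟩
    · exact Or.inl ⟨⟨x, y, h⟩, ⟨Iso.refl _⟩⟩
    · exact Or.inr ⟨⟨x, y, h⟩, ⟨Iso.refl _⟩⟩

theorem add_comp (S S' : GSpan K H) (T : GSpan H G) :
    Rel (comp (add S S') T) (add (comp S T) (comp S' T)) := by
  refine Rel.symm (rel_mk ((inlComma S.r S'.r T.l).sum' (inrComma S.r S'.r T.l))
    (sum_faithful ⟨?_⟩ ⟨?_⟩) (sum_full ⟨?_⟩ ⟨?_⟩ ?_ ?_) (sum_essSurj ?_)
    (sumIso (Iso.refl _) (Iso.refl _)) (sumIso (Iso.refl _) (Iso.refl _)))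
  · exact fun {X Y} f g h => Comma.hom_ext _ _ (congrArg (fun t => t.left.down) h)
      (congrArg (fun t => t.right) h)
  · exact fun {X Y} f g h => Comma.hom_ext _ _ (congrArg (fun t => t.left.down) h)
      (congrArg (fun t => t.right) h)
  · exact fun {X Y} f => ⟨⟨f.left.down, f.right, f.w⟩, rfl⟩
  · exact fun {X Y} f => ⟨⟨f.left.down, f.right, f.w⟩, rfl⟩
  · exact fun a b f => hom_inl_inr_false _ _ f.left
  · exact fun a b f => hom_inr_inl_false _ _ f.left
  · rintro ⟨x | x, y, h⟩
    · exact Or.inl ⟨⟨x, y, h⟩, ⟨Iso.refl _⟩⟩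
    · exact Or.inr ⟨⟨x, y, h⟩, ⟨Iso.refl _⟩⟩

theorem tens_add (S : GSpan H G) (T T' : GSpan H' G') :
    Rel (tens S (add T T')) (add (tens S T) (tens S T')) := by
  refine Rel.symm (rel_mk (((𝟭 _).prod (Sum.inl_ _ _)).sum' ((𝟭 _).prod (Sum.inr_ _ _)))
    (sum_faithful ⟨?_⟩ ⟨?_⟩) (sum_full ⟨?_⟩ ⟨?_⟩ ?_ ?_) (sum_essSurj ?_)
    (sumIso (Iso.refl _) (Iso.refl _)) (sumIso (Iso.refl _) (Iso.refl _)))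
  · exact fun {X Y} f g h => Prod.ext (congrArg (fun t => t.1) h)
      (congrArg (fun t => t.2.down) h)
  · exact fun {X Y} f g h => Prod.ext (congrArg (fun t => t.1) h)
      (congrArg (fun t => t.2.down) h)
  · exact fun {X Y} f => ⟨(f.1, f.2.down), rfl⟩
  · exact fun {X Y} f => ⟨(f.1, f.2.down), rfl⟩
  · exact fun a b f => hom_inl_inr_false _ _ f.2
  · exact fun a b f => hom_inr_inl_false _ _ f.2
  · rintro ⟨x, y | y⟩
    · exact Or.inl ⟨⟨x, y⟩, ⟨Iso.refl _⟩⟩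
    · exact Or.inr ⟨⟨x, y⟩, ⟨Iso.refl _⟩⟩

theorem add_tens (S S' : GSpan H G) (T : GSpan H' G') :
    Rel (tens (add S S') T) (add (tens S T) (tens S' T)) := by
  refine Rel.symm (rel_mk (((Sum.inl_ _ _).prod (𝟭 _)).sum' ((Sum.inr_ _ _).prod (𝟭 _)))
    (sum_faithful ⟨?_⟩ ⟨?_⟩) (sum_full ⟨?_⟩ ⟨?_⟩ ?_ ?_) (sum_essSurj ?_)
    (sumIso (Iso.refl _) (Iso.refl _)) (sumIso (Iso.refl _) (Iso.refl _)))
  · exact fun {X Y} f g h => Prod.ext (congrArg (fun t => t.1.down) h)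
      (congrArg (fun t => t.2) h)
  · exact fun {X Y} f g h => Prod.ext (congrArg (fun t => t.1.down) h)
      (congrArg (fun t => t.2) h)
  · exact fun {X Y} f => ⟨(f.1.down, f.2), rfl⟩
  · exact fun {X Y} f => ⟨(f.1.down, f.2), rfl⟩
  · exact fun a b f => hom_inl_inr_false _ _ f.1
  · exact fun a b f => hom_inr_inl_false _ _ f.1
  · rintro ⟨x | x, y⟩
    · exact Or.inl ⟨⟨x, y⟩, ⟨Iso.refl _⟩⟩
    · exact Or.inr ⟨⟨x, y⟩, ⟨Iso.refl _⟩⟩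

end GSpan

/-! ## Bisets of finite groupoids -/

/-- A finite left-`G` right-`H` biset, a 1-cell from `H` to `G`: a functor from `Hᵒᵖ × G` to finite
sets. -/
structure GBiset (H G : FinGrpd) : Type 1 where
  obj : H.carrier → G.carrier → Type
  [fin : ∀ h g, Finite (obj h g)]
  map {h h' : H.carrier} {g g' : G.carrier} : (h' ⟶ h) → (g ⟶ g') → obj h g → obj h' g'
  map_id {h : H.carrier} {g : G.carrier} (x : obj h g) : map (𝟙 h) (𝟙 g) x = x
  map_comp {h h' h'' : H.carrier} {g g' g'' : G.carrier} (β : h' ⟶ h) (β' : h'' ⟶ h')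
    (α : g ⟶ g') (α' : g' ⟶ g'') (x : obj h g) :
    map (β' ≫ β) (α ≫ α') x = map β' α' (map β α x)

namespace GBiset

attribute [instance] GBiset.fin

variable {H G K L H' G' K' : FinGrpd}

/-- Two bisets are related if they are naturally isomorphic. -/
def Rel (U V : GBiset H G) : Prop :=
  ∃ φ : ∀ h g, U.obj h g → V.obj h g, (∀ h g, Function.Bijective (φ h g)) ∧
    ∀ {h h' : H.carrier} {g g' : G.carrier} (β : h' ⟶ h) (α : g ⟶ g') (x : U.obj h g),
      φ h' g' (U.map β α x) = V.map β α (φ h g x)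

theorem Rel.refl (U : GBiset H G) : Rel U U :=
  ⟨fun _ _ x => x, fun _ _ => Function.bijective_id, fun _ _ _ => rfl⟩

theorem Rel.symm {U V : GBiset H G} : Rel U V → Rel V U := by
  rintro ⟨φ, hφ, hn⟩
  refine ⟨fun h g => (Equiv.ofBijective _ (hφ h g)).symm, fun h g => Equiv.bijective _, ?_⟩
  intro h h' g g' β α x
  obtain ⟨y, rfl⟩ := (hφ h g).2 x
  rw [Equiv.symm_apply_eq]
  simp [Equiv.ofBijective_apply, Equiv.ofBijective_symm_apply_apply, hn]

theorem Rel.trans {U V W : GBiset H G} : Rel U V → Rel V W → Rel U W := by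
  rintro ⟨φ, hφ, hn⟩ ⟨ψ, hψ, hm⟩
  exact ⟨fun h g x => ψ h g (φ h g x), fun h g => (hψ h g).comp (hφ h g),
    fun β α x => by simp only [hn, hm]⟩

instance setoid (H G : FinGrpd) : Setoid (GBiset H G) :=
  ⟨Rel, Rel.refl, Rel.symm, Rel.trans⟩

/-- A biset isomorphism from inverse natural maps. -/
theorem rel_mk {U V : GBiset H G} (φ : ∀ h g, U.obj h g → V.obj h g)
    (ψ : ∀ h g, V.obj h g → U.obj h g) (h₁ : ∀ h g x, ψ h g (φ h g x) = x)
    (h₂ : ∀ h g x, φ h g (ψ h g x) = x)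
    (hn : ∀ {h h' : H.carrier} {g g' : G.carrier} (β : h' ⟶ h) (α : g ⟶ g') (x : U.obj h g),
      φ h' g' (U.map β α x) = V.map β α (φ h g x)) : Rel U V :=
  ⟨φ, fun h g => Function.bijective_iff_has_inverse.2 ⟨ψ h g, h₁ h g, h₂ h g⟩, hn⟩

/-- The biset `G(u -, -)` of a functor `u`. -/
def push (u : H.carrier ⥤ G.carrier) : GBiset H G where
  obj h g := u.obj h ⟶ g
  map β α x := u.map β ≫ x ≫ α
  map_id x := by simp
  map_comp β β' α α' x := by simp

/-- The biset `G(-, u -)` of a functor `u`. -/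
def pull (u : H.carrier ⥤ G.carrier) : GBiset G H where
  obj g h := g ⟶ u.obj h
  map β α x := β ≫ x ≫ u.map α
  map_id x := by simp
  map_comp β β' α α' x := by simp

/-- The relation defining the coend which computes the composite of two bisets. -/
def compSetoid (V : GBiset K H) (U : GBiset H G) (k : K.carrier) (g : G.carrier) :
    Setoid (Σ h : H.carrier, V.obj k h × U.obj h g) where
  r a b := ∃ η : a.1 ⟶ b.1, V.map (𝟙 k) η a.2.1 = b.2.1 ∧ U.map η (𝟙 g) b.2.2 = a.2.2
  iseqv := by
    refine ⟨fun a => ⟨𝟙 _, V.map_id _, U.map_id _⟩, ?_, ?_⟩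
    · rintro ⟨h, y, x⟩ ⟨h', y', x'⟩ ⟨η, e₁, e₂⟩
      dsimp only at η e₁ e₂
      subst e₁ e₂
      refine ⟨inv η, ?_, ?_⟩
      · have := V.map_comp (𝟙 k) (𝟙 k) η (inv η) y
        simp only [Category.comp_id, IsIso.hom_inv_id, V.map_id] at this
        exact this.symm
      · have := U.map_comp η (inv η) (𝟙 g) (𝟙 g) x'
        simp only [Category.comp_id, IsIso.inv_hom_id, U.map_id] at this
        exact this.symm
    · rintro ⟨h, y, x⟩ ⟨h', y', x'⟩ ⟨h'', y'', x''⟩ ⟨η, e₁, e₂⟩ ⟨θ, e₃, e₄⟩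
      dsimp only at η e₁ e₂ θ e₃ e₄
      subst e₁ e₃ e₄ e₂
      refine ⟨η ≫ θ, ?_, ?_⟩
      · simpa using V.map_comp (𝟙 k) (𝟙 k) η θ y
      · simpa using U.map_comp θ η (𝟙 g) (𝟙 g) x''

theorem map_map (U : GBiset H G) {h h' h'' : H.carrier} {g g' g'' : G.carrier} (β : h' ⟶ h)
    (β' : h'' ⟶ h') (α : g ⟶ g') (α' : g' ⟶ g'') (x : U.obj h g) :
    U.map β' α' (U.map β α x) = U.map (β' ≫ β) (α ≫ α') x := (U.map_comp β β' α α' x).symm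

/-- Horizontal composition of `V : K → H` and `U : H → G`: the set-theoretic coend
`∫^h V(-, h) × U(h, -)`. -/
def comp (V : GBiset K H) (U : GBiset H G) : GBiset K G where
  obj k g := Quotient (compSetoid V U k g)
  map {k k' g g'} β α :=
    Quotient.map (fun a => ⟨a.1, V.map β (𝟙 _) a.2.1, U.map (𝟙 _) α a.2.2⟩) (by
      rintro ⟨h, y, x⟩ ⟨h', y', x'⟩ ⟨η, e₁, e₂⟩
      dsimp only at η e₁ e₂
      subst e₁ e₂
      exact ⟨η, by simp [map_map], by simp [map_map]⟩)
  map_id := by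
    rintro k g ⟨a⟩
    exact congrArg (Quotient.mk _) (by simp [map_id])
  map_comp := by
    rintro k k' k'' g g' g'' β β' α α' ⟨a⟩
    exact congrArg (Quotient.mk _) (by simp [map_map])

/-- The class of a pair in the coend. -/
def cls (V : GBiset K H) (U : GBiset H G) {k : K.carrier} {g : G.carrier} (h : H.carrier)
    (y : V.obj k h) (x : U.obj h g) : (comp V U).obj k g :=
  Quotient.mk (compSetoid V U k g) ⟨h, y, x⟩

theorem cls_eq (V : GBiset K H) (U : GBiset H G) {k : K.carrier} {g : G.carrier} {h h' : H.carrier}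
    (η : h ⟶ h') (y : V.obj k h) (x : U.obj h' g) :
    cls V U h' (V.map (𝟙 k) η y) x = cls V U h y (U.map η (𝟙 g) x) :=
  (Quotient.sound (s := compSetoid V U k g)
    (show (compSetoid V U k g).r ⟨h, y, _⟩ ⟨h', _, x⟩ from ⟨η, rfl, rfl⟩)).symm

theorem cls_exact (V : GBiset K H) (U : GBiset H G) {k : K.carrier} {g : G.carrier}
    {h h' : H.carrier} {y : V.obj k h} {x : U.obj h g} {y' : V.obj k h'} {x' : U.obj h' g}
    (e : cls V U h y x = cls V U h' y' x') :
    ∃ η : h ⟶ h', V.map (𝟙 k) η y = y' ∧ U.map η (𝟙 g) x' = x :=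
  Quotient.exact e

theorem comp_map_cls (V : GBiset K H) (U : GBiset H G) {k k' : K.carrier} {g g' : G.carrier}
    (β : k' ⟶ k) (α : g ⟶ g') (h : H.carrier) (y : V.obj k h) (x : U.obj h g) :
    (comp V U).map β α (cls V U h y x) = cls V U h (V.map β (𝟙 _) y) (U.map (𝟙 _) α x) := rfl

theorem cls_ind (V : GBiset K H) (U : GBiset H G) {k : K.carrier} {g : G.carrier}
    {p : (comp V U).obj k g → Prop} (hp : ∀ h y x, p (cls V U h y x)) (q) : p q :=
  Quotient.ind (fun a => hp a.1 a.2.1 a.2.2) q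

/-- Maps out of the coend. -/
def lift (V : GBiset K H) (U : GBiset H G) {k : K.carrier} {g : G.carrier} {X : Type}
    (f : ∀ h, V.obj k h → U.obj h g → X)
    (hf : ∀ {h h'} (η : h ⟶ h') y x, f h' (V.map (𝟙 k) η y) x = f h y (U.map η (𝟙 g) x)) :
    (comp V U).obj k g → X :=
  Quotient.lift (fun a => f a.1 a.2.1 a.2.2) (by
    rintro ⟨h, y, x⟩ ⟨h', y', x'⟩ ⟨η, e₁, e₂⟩
    dsimp only at η e₁ e₂
    subst e₁ e₂
    exact (hf η y x').symm)

/-- The sum of two parallel bisets is their pointwise disjoint union. -/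
def add (U V : GBiset H G) : GBiset H G where
  obj h g := U.obj h g ⊕ V.obj h g
  map β α := Sum.map (U.map β α) (V.map β α)
  map_id := by rintro h g (x | x) <;> simp [map_id]
  map_comp := by rintro h h' h'' g g' g'' β β' α α' (x | x) <;> simp [map_map]

/-- The empty biset. -/
def zero (H G : FinGrpd) : GBiset H G where
  obj _ _ := PEmpty
  map _ _ x := x
  map_id _ := rfl
  map_comp _ _ _ _ _ := rfl

/-- The product of two bisets. -/
def tens (U : GBiset H G) (V : GBiset H' G') : GBiset (H.prod H') (G.prod G') where
  obj h g := U.obj h.1 g.1 × V.obj h.2 g.2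
  map β α x := (U.map β.1 α.1 x.1, V.map β.2 α.2 x.2)
  map_id := fun x => Prod.ext (U.map_id x.1) (V.map_id x.2)
  map_comp := fun β β' α α' x => Prod.ext (U.map_comp β.1 β'.1 α.1 α'.1 x.1)
    (V.map_comp β.2 β'.2 α.2 α'.2 x.2)

/-- Restriction of a biset along two functors. -/
def res (U : GBiset H G) (d : K.carrier ⥤ H.carrier) (e : L.carrier ⥤ G.carrier) : GBiset K L where
  obj k l := U.obj (d.obj k) (e.obj l)
  map β α := U.map (d.map β) (e.map α)
  map_id := by simp [map_id]
  map_comp := by simp [map_map]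

theorem comp_congr {V V' : GBiset K H} {U U' : GBiset H G} :
    Rel V V' → Rel U U' → Rel (comp V U) (comp V' U') := by
  suffices key : ∀ {V V' : GBiset K H} {U U' : GBiset H G}, Rel V V' → Rel U U' →
      Rel (comp V U) (comp V' U') from key
  rintro V V' U U' ⟨φ, hφ, hn⟩ ⟨ψ, hψ, hm⟩
  refine ⟨fun k g => lift V U (fun h y x => cls V' U' h (φ _ _ y) (ψ _ _ x)) ?_, ?_, ?_⟩
  · intro h h' η y x
    exact (congrArg (fun t => cls V' U' h' t (ψ _ _ x)) (hn _ _ y)).trans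
      ((cls_eq V' U' η _ _).trans (congrArg (cls V' U' h (φ _ _ y)) (hm _ _ x).symm))
  · intro k g
    constructor
    · intro a b
      induction a using cls_ind with | hp h y x
      induction b using cls_ind with | hp h' y' x'
      intro e
      obtain ⟨η, e₁, e₂⟩ := cls_exact V' U' e
      change h ⟶ h' at η
      have e₁' : V.map (𝟙 k) η y = y' := (hφ _ _).1 ((hn _ _ _).trans e₁)
      have e₂' : U.map η (𝟙 g) x' = x := (hψ _ _).1 ((hm _ _ _).trans e₂)
      rw [← e₁', ← e₂', cls_eq]
    · intro a
      induction a using cls_ind with | hp h y x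
      obtain ⟨y, rfl⟩ := (hφ _ _).2 y
      obtain ⟨x, rfl⟩ := (hψ _ _).2 x
      exact ⟨cls V U h y x, rfl⟩
  · intro k k' g g' β α a
    induction a using cls_ind with | hp h y x
    change cls V' U' h (φ _ _ (V.map β (𝟙 _) y)) (ψ _ _ (U.map (𝟙 _) α x)) = _
    rw [hn, hm]
    rfl

theorem push_comp (d : K.carrier ⥤ H.carrier) (U : GBiset H G) :
    Rel (comp (push d) U) (res U d (𝟭 _)) := by
  refine rel_mk (fun k g => lift (push d) U (fun h (y : d.obj k ⟶ h) x => U.map y (𝟙 _) x) ?_)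
    (fun k g x => cls (push d) U (d.obj k) (𝟙 _) x) ?_ ?_ ?_
  · intro h h' η (y : d.obj k ⟶ h) x
    change U.map (d.map (𝟙 k) ≫ y ≫ η) (𝟙 _) x = U.map y (𝟙 _) (U.map η (𝟙 _) x)
    rw [map_map]
    simp
  · intro k g a
    induction a using cls_ind with | hp h y x
    change d.obj k ⟶ h at y
    refine (cls_eq (push d) U y (𝟙 (d.obj k)) x).symm.trans
      (congrArg (fun t => cls (push d) U h t x) ?_)
    change d.map (𝟙 k) ≫ 𝟙 _ ≫ y = y
    simp
  · intro k g x
    exact U.map_id x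
  · intro k k' g g' β α a
    induction a using cls_ind with | hp h y x
    change d.obj k ⟶ h at y
    change U.map (d.map β ≫ y ≫ 𝟙 h) (𝟙 _) (U.map (𝟙 h) α x) = U.map (d.map β) α (U.map y (𝟙 _) x)
    rw [map_map, map_map]
    simp

theorem comp_pull (U : GBiset K H) (e : G.carrier ⥤ H.carrier) :
    Rel (comp U (pull e)) (res U (𝟭 _) e) := by
  refine rel_mk (fun k g => lift U (pull e) (fun h y (x : h ⟶ e.obj g) => U.map (𝟙 _) x y) ?_)
    (fun k g y => cls U (pull e) (e.obj g) y (𝟙 _)) ?_ ?_ ?_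
  · intro h h' η y (x : h' ⟶ e.obj g)
    change U.map (𝟙 _) x (U.map (𝟙 _) η y) = U.map (𝟙 _) (η ≫ x ≫ e.map (𝟙 g)) y
    rw [map_map]
    simp
  · intro k g a
    induction a using cls_ind with | hp h y x
    change h ⟶ e.obj g at x
    refine (cls_eq U (pull e) x y (𝟙 (e.obj g))).trans
      (congrArg (fun t => cls U (pull e) h y t) ?_)
    change x ≫ 𝟙 _ ≫ e.map (𝟙 g) = x
    simp
  · intro k g x
    exact U.map_id x
  · intro k k' g g' β α a
    induction a using cls_ind with | hp h y x
    change h ⟶ e.obj g at x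
    change U.map (𝟙 _) (𝟙 h ≫ x ≫ e.map α) (U.map β (𝟙 h) y) = U.map β (e.map α) (U.map (𝟙 _) x y)
    rw [map_map, map_map]
    simp

theorem push_equiv (e : H.carrier ≌ G.carrier) : Rel (push e.functor) (pull e.inverse) := by
  refine rel_mk (fun h g x => (e.toAdjunction.homEquiv h g) x)
    (fun h g x => (e.toAdjunction.homEquiv h g).symm x) ?_ ?_ ?_
  · intro h g x
    exact Equiv.symm_apply_apply _ _
  · intro h g x
    exact Equiv.apply_symm_apply _ _
  · intro h h' g g' β α (x : e.functor.obj h ⟶ g)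
    exact (e.toAdjunction.homEquiv_naturality_left β (x ≫ α)).trans
      (congrArg (fun t => β ≫ t) (e.toAdjunction.homEquiv_naturality_right x α))

theorem comp_assoc (W : GBiset K H) (V : GBiset H G) (U : GBiset G L) :
    Rel (comp (comp W V) U) (comp W (comp V U)) := by
  refine rel_mk
    (fun k l => lift (comp W V) U
      (fun g q x => lift W V (fun h z y => cls W (comp V U) h z (cls V U g y x)) ?_ q) ?_)
    (fun k l => lift W (comp V U)
      (fun h z q => lift V U (fun g y x => cls (comp W V) U g (cls W V h z y) x) ?_ q) ?_) ?_ ?_ ?_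
  · intro h h' η z y
    rw [cls_eq, comp_map_cls, map_id]
  · intro g g' η q x
    induction q using cls_ind with | hp h z y
    change cls W (comp V U) h (W.map _ _ z) (cls V U g' (V.map (𝟙 _) η y) x) =
      cls W (comp V U) h z (cls V U g y (U.map η (𝟙 _) x))
    rw [cls_eq, map_id, cls_eq]
  · intro g g' η y x
    rw [← cls_eq, comp_map_cls, map_id]
  · intro h h' η z q
    induction q using cls_ind with | hp g y x
    change cls (comp W V) U g (cls W V h' (W.map (𝟙 _) η z) y) x =
      cls (comp W V) U g (cls W V h z (V.map η (𝟙 _) y)) (U.map (𝟙 _) (𝟙 _) x)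
    rw [cls_eq, map_id]
  · intro k l a
    induction a using cls_ind with | hp g q x
    induction q using cls_ind with | hp h z y
    rfl
  · intro k l a
    induction a using cls_ind with | hp h z q
    induction q using cls_ind with | hp g y x
    rfl
  · intro k k' l l' β α a
    induction a using cls_ind with | hp g q x
    induction q using cls_ind with | hp h z y
    change cls W (comp V U) h (W.map _ _ z) (cls V U g (V.map (𝟙 _) (𝟙 _) y) (U.map (𝟙 _) α x)) =
      cls W (comp V U) h (W.map _ _ z) (cls V U g (V.map (𝟙 _) (𝟙 _) y) (U.map (𝟙 _) α x))
    rfl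

theorem tens_congr {U U' : GBiset H G} {V V' : GBiset H' G'} :
    Rel U U' → Rel V V' → Rel (tens U V) (tens U' V') := by
  rintro ⟨φ, hφ, hn⟩ ⟨ψ, hψ, hm⟩
  refine ⟨fun h g x => (φ _ _ x.1, ψ _ _ x.2), fun h g => ?_, ?_⟩
  · exact Function.Bijective.prodMap (hφ _ _) (hψ _ _)
  · intro h h' g g' β α x
    exact Prod.ext (hn _ _ _) (hm _ _ _)

theorem tens_comp (V : GBiset K H) (U : GBiset H G) (V' : GBiset K' H') (U' : GBiset H' G') :
    Rel (comp (tens V V') (tens U U')) (tens (comp V U) (comp V' U')) := by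
  refine ⟨fun k g => lift _ _ (fun h y x => (cls V U h.1 y.1 x.1, cls V' U' h.2 y.2 x.2)) ?_, ?_, ?_⟩
  · intro h h' η y x
    exact Prod.ext (cls_eq V U η.1 y.1 x.1) (cls_eq V' U' η.2 y.2 x.2)
  · intro k g
    constructor
    · intro a b
      induction a using cls_ind with | hp h y x
      induction b using cls_ind with | hp h' y' x'
      intro e
      obtain ⟨η, e₁, e₂⟩ := cls_exact V U (congrArg Prod.fst e)
      obtain ⟨θ, e₃, e₄⟩ := cls_exact V' U' (congrArg Prod.snd e)
      have := cls_eq (tens V V') (tens U U') (g := g) (k := k) (h := h) (h' := h') (η, θ) y x'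
      refine Eq.trans ?_ (this.symm.trans ?_)
      · exact congrArg _ (Prod.ext e₂.symm e₄.symm)
      · exact congrArg (fun t => cls (tens V V') (tens U U') h' t x') (Prod.ext e₁ e₃)
    · rintro ⟨a, b⟩
      induction a using cls_ind with | hp h y x
      induction b using cls_ind with | hp h' y' x'
      exact ⟨cls (tens V V') (tens U U') (h, h') (y, y') (x, x'), rfl⟩
  · intro k k' g g' β α a
    induction a using cls_ind with | hp h y x
    rfl

theorem add_congr {U U' V V' : GBiset H G} :
    Rel U U' → Rel V V' → Rel (add U V) (add U' V') := by
  rintro ⟨φ, hφ, hn⟩ ⟨ψ, hψ, hm⟩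
  refine ⟨fun h g => Sum.map (φ h g) (ψ h g), fun h g => ?_, ?_⟩
  · exact ⟨Function.Injective.sumMap (hφ h g).1 (hψ h g).1,
      Function.Surjective.sumMap (hφ h g).2 (hψ h g).2⟩
  · rintro h h' g g' β α (x | x)
    · exact congrArg Sum.inl (hn _ _ _)
    · exact congrArg Sum.inr (hm _ _ _)

theorem add_comm' (U V : GBiset H G) : Rel (add U V) (add V U) := by
  refine rel_mk (fun h g => Sum.swap) (fun h g => Sum.swap) ?_ ?_ ?_
  · exact fun h g => Sum.swap_swap
  · exact fun h g => Sum.swap_swap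
  · rintro h h' g g' β α (x | x) <;> rfl

theorem add_assoc' (U V W : GBiset H G) : Rel (add (add U V) W) (add U (add V W)) := by
  refine rel_mk (fun h g => Equiv.sumAssoc _ _ _) (fun h g => (Equiv.sumAssoc _ _ _).symm) ?_ ?_ ?_
  · exact fun h g x => Equiv.symm_apply_apply _ x
  · exact fun h g x => Equiv.apply_symm_apply _ x
  · rintro h h' g g' β α ((x | x) | x) <;> rfl

theorem zero_add' (U : GBiset H G) : Rel (add (zero H G) U) U := by
  refine rel_mk (fun h g => Sum.elim PEmpty.elim id) (fun h g => Sum.inr) ?_ ?_ ?_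
  · rintro h g (x | x)
    · exact x.elim
    · rfl
  · intro h g x
    rfl
  · rintro h h' g g' β α (x | x)
    · exact x.elim
    · rfl

theorem rel_zero (U : GBiset H G) (hU : ∀ h g, U.obj h g → False) : Rel U (zero H G) :=
  rel_mk (fun h g x => (hU h g x).elim) (fun _ _ x => x.elim) (fun h g x => (hU h g x).elim)
    (fun _ _ x => x.elim) (fun {h _ g _} _ _ x => (hU h g x).elim)

theorem comp_add (V : GBiset K H) (U U' : GBiset H G) :
    Rel (comp V (add U U')) (add (comp V U) (comp V U')) := by
  refine rel_mk (fun k g => lift V (add U U')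
      (fun h y x => Sum.elim (fun x => Sum.inl (cls V U h y x)) (fun x => Sum.inr (cls V U' h y x)) x)
      ?_)
    (fun k g => Sum.elim
      (lift V U (fun h y x => cls V (add U U') h y (Sum.inl x))
        (fun η y x => cls_eq V (add U U') η y (Sum.inl x)))
      (lift V U' (fun h y x => cls V (add U U') h y (Sum.inr x))
        (fun η y x => cls_eq V (add U U') η y (Sum.inr x)))) ?_ ?_ ?_
  · rintro h h' η y (x | x)
    · exact congrArg Sum.inl (cls_eq V U η y x)
    · exact congrArg Sum.inr (cls_eq V U' η y x)
  · intro k g a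
    induction a using cls_ind with | hp h y x
    rcases x with x | x <;> rfl
  · rintro k g (a | a)
    · induction a using cls_ind with | hp h y x
      rfl
    · induction a using cls_ind with | hp h y x
      rfl
  · intro k k' g g' β α a
    induction a using cls_ind with | hp h y x
    rcases x with x | x <;> rfl

theorem add_comp (V V' : GBiset K H) (U : GBiset H G) :
    Rel (comp (add V V') U) (add (comp V U) (comp V' U)) := by
  refine rel_mk (fun k g => lift (add V V') U
      (fun h y x => Sum.elim (fun y => Sum.inl (cls V U h y x)) (fun y => Sum.inr (cls V' U h y x)) y)
      ?_)
    (fun k g => Sum.elim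
      (lift V U (fun h y x => cls (add V V') U h (Sum.inl y) x)
        (fun η y x => cls_eq (add V V') U η (Sum.inl y) x))
      (lift V' U (fun h y x => cls (add V V') U h (Sum.inr y) x)
        (fun η y x => cls_eq (add V V') U η (Sum.inr y) x))) ?_ ?_ ?_
  · rintro h h' η (y | y) x
    · exact congrArg Sum.inl (cls_eq V U η y x)
    · exact congrArg Sum.inr (cls_eq V' U η y x)
  · intro k g a
    induction a using cls_ind with | hp h y x
    rcases y with y | y <;> rfl
  · rintro k g (a | a)
    · induction a using cls_ind with | hp h y x
      rfl
    · induction a using cls_ind with | hp h y x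
      rfl
  · intro k k' g g' β α a
    induction a using cls_ind with | hp h y x
    rcases y with y | y <;> rfl

theorem tens_add (U : GBiset H G) (V V' : GBiset H' G') :
    Rel (tens U (add V V')) (add (tens U V) (tens U V')) := by
  refine rel_mk (fun h g => Equiv.prodSumDistrib _ _ _)
    (fun h g => (Equiv.prodSumDistrib _ _ _).symm) ?_ ?_ ?_
  · exact fun h g x => Equiv.symm_apply_apply _ x
  · exact fun h g x => Equiv.apply_symm_apply _ x
  · rintro h h' g g' β α ⟨x, y | y⟩ <;> rfl

theorem add_tens (U U' : GBiset H G) (V : GBiset H' G') :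
    Rel (tens (add U U') V) (add (tens U V) (tens U' V)) := by
  refine rel_mk (fun h g => Equiv.sumProdDistrib _ _ _)
    (fun h g => (Equiv.sumProdDistrib _ _ _).symm) ?_ ?_ ?_
  · exact fun h g x => Equiv.symm_apply_apply _ x
  · exact fun h g x => Equiv.apply_symm_apply _ x
  · rintro h h' g g' β α ⟨x | x, y⟩ <;> rfl

/-- Pulling back and pushing forward along an equivalence is the identity. -/
theorem pull_push (f : H.carrier ⥤ G.carrier) [f.IsEquivalence] :
    Rel (comp (pull f) (push f)) (push (𝟭 G.carrier)) := by
  refine ⟨fun g g' => lift (pull f) (push f) (fun h y x => y ≫ x) ?_, ?_, ?_⟩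
  · intro h h' η (y : g ⟶ f.obj h) (x : f.obj h' ⟶ g')
    change (𝟙 g ≫ y ≫ f.map η) ≫ x = y ≫ f.map η ≫ x ≫ 𝟙 g'
    simp
  · intro g g'
    constructor
    · intro a b
      induction a using cls_ind with | hp h y x
      induction b using cls_ind with | hp h' y' x'
      intro e
      change g ⟶ f.obj h at y
      change g ⟶ f.obj h' at y'
      change f.obj h ⟶ g' at x
      change f.obj h' ⟶ g' at x'
      replace e : y ≫ x = y' ≫ x' := e
      have e₂ : f.map (f.preimage (inv y ≫ y')) = inv y ≫ y' := f.map_preimage _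
      have := cls_eq (pull f) (push f) (f.preimage (inv y ≫ y')) y x'
      have h₁ : (pull f).map (𝟙 g) (f.preimage (inv y ≫ y')) y = y' := by
        change 𝟙 g ≫ y ≫ f.map _ = y'
        simp
      have h₂ : (push f).map (f.preimage (inv y ≫ y')) (𝟙 g') x' = x := by
        change f.map _ ≫ x' ≫ 𝟙 g' = x
        simp [← e]
      rw [h₁, h₂] at this
      exact this.symm
    · intro (x : g ⟶ g')
      exact ⟨cls (pull f) (push f) (f.objPreimage g) (f.objObjPreimageIso g).inv
        ((f.objObjPreimageIso g).hom ≫ x), by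
          change (f.objObjPreimageIso g).inv ≫ (f.objObjPreimageIso g).hom ≫ x = x
          simp⟩
  · intro k k' g g' β α a
    induction a using cls_ind with | hp h y x
    change k ⟶ f.obj h at y
    change f.obj h ⟶ g at x
    change (β ≫ y ≫ f.map (𝟙 _)) ≫ (f.map (𝟙 _) ≫ x ≫ α) = β ≫ (y ≫ x) ≫ α
    simp

theorem push_congr {f f' : H.carrier ⥤ G.carrier} (α : f ≅ f') : Rel (push f) (push f') := by
  refine rel_mk (fun h g (x : f.obj h ⟶ g) => α.inv.app h ≫ x)
    (fun h g (x : f'.obj h ⟶ g) => α.hom.app h ≫ x) ?_ ?_ ?_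
  · intro h g (x : f.obj h ⟶ g)
    exact α.hom_inv_id_app_assoc h x
  · intro h g (x : f'.obj h ⟶ g)
    exact α.inv_hom_id_app_assoc h x
  · intro h h' g g' β γ (x : f.obj h ⟶ g)
    change α.inv.app h' ≫ f.map β ≫ x ≫ γ = f'.map β ≫ (α.inv.app h ≫ x) ≫ γ
    simp

theorem pull_congr {f f' : H.carrier ⥤ G.carrier} (α : f ≅ f') : Rel (pull f) (pull f') := by
  refine rel_mk (fun g h (x : g ⟶ f.obj h) => x ≫ α.hom.app h)
    (fun g h (x : g ⟶ f'.obj h) => x ≫ α.inv.app h) ?_ ?_ ?_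
  · intro g h (x : g ⟶ f.obj h)
    change (x ≫ α.hom.app h) ≫ α.inv.app h = x
    simp
  · intro g h (x : g ⟶ f'.obj h)
    change (x ≫ α.inv.app h) ≫ α.hom.app h = x
    simp
  · intro g g' h h' β γ (x : g ⟶ f.obj h)
    change (β ≫ x ≫ f.map γ) ≫ α.hom.app h' = β ≫ (x ≫ α.hom.app h) ≫ f'.map γ
    simp

/-- Base change for iso-comma squares. -/
theorem base_change {S T : FinGrpd} (a : S.carrier ⥤ G.carrier) (b : T.carrier ⥤ G.carrier) :
    Rel (comp (pull (G := S) (H := FinGrpd.isoComma a b) (Comma.fst a b))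
        (push (G := T) (H := FinGrpd.isoComma a b) (Comma.snd a b)))
      (comp (push a) (pull b)) := by
  refine Rel.trans ?_ (push_comp a (pull b)).symm
  refine ⟨fun s t => lift _ _ (fun (i : Comma a b) (y : s ⟶ i.left) (x : i.right ⟶ t) =>
    (a.map y ≫ i.hom ≫ b.map x : a.obj s ⟶ b.obj t)) ?_, ?_, ?_⟩
  · intro (i : Comma a b) (j : Comma a b) (η : i ⟶ j) (y : s ⟶ i.left) (x : j.right ⟶ t)
    change a.map (𝟙 s ≫ y ≫ η.left) ≫ j.hom ≫ b.map x =
      a.map y ≫ i.hom ≫ b.map (η.right ≫ x ≫ 𝟙 t)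
    simp
  · intro s t
    constructor
    · intro p q
      induction p using cls_ind with | hp i y x
      induction q using cls_ind with | hp j y' x'
      change Comma a b at i j
      change s ⟶ i.left at y
      change s ⟶ j.left at y'
      change i.right ⟶ t at x
      change j.right ⟶ t at x'
      intro e
      replace e : a.map y ≫ i.hom ≫ b.map x = a.map y' ≫ j.hom ≫ b.map x' := e
      let η : i ⟶ j := ⟨inv y ≫ y', x ≫ inv x', by
        have e' : i.hom ≫ b.map x = a.map (inv y) ≫ a.map y' ≫ j.hom ≫ b.map x' := by simp [← e]
        simp [reassoc_of% e']⟩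
      have := cls_eq (pull (G := S) (H := FinGrpd.isoComma a b) (Comma.fst a b))
        (push (G := T) (H := FinGrpd.isoComma a b) (Comma.snd a b)) (k := s) (g := t) η y x'
      refine Eq.trans ?_ (this.symm.trans ?_)
      · refine congrArg (fun z => cls (pull (G := S) (H := FinGrpd.isoComma a b) (Comma.fst a b))
          (push (G := T) (H := FinGrpd.isoComma a b) (Comma.snd a b)) (k := s) (g := t) i y z) ?_
        change x = (x ≫ inv x') ≫ x' ≫ 𝟙 t
        simp
      · refine congrArg (fun z => cls (pull (G := S) (H := FinGrpd.isoComma a b) (Comma.fst a b))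
          (push (G := T) (H := FinGrpd.isoComma a b) (Comma.snd a b)) (k := s) (g := t) j z x') ?_
        change 𝟙 s ≫ y ≫ (inv y ≫ y') = y'
        simp
    · intro (z : a.obj s ⟶ b.obj t)
      refine ⟨cls _ _ (⟨s, t, z⟩ : Comma a b) (𝟙 s) (𝟙 t), ?_⟩
      change a.map (𝟙 s) ≫ z ≫ b.map (𝟙 t) = z
      simp
  · intro s s' t t' β α p
    induction p using cls_ind with | hp i y x
    change Comma a b at i
    change s ⟶ i.left at y
    change i.right ⟶ t at x
    change a.map (β ≫ y ≫ 𝟙 i.left) ≫ i.hom ≫ b.map (𝟙 i.right ≫ x ≫ α) =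
      a.map β ≫ (a.map y ≫ i.hom ≫ b.map x) ≫ b.map α
    simp

end GBiset

namespace FinGrpd

/-- Associativity of products. -/
def assocE (G H K : FinGrpd) : ((G.prod H).prod K).carrier ≌ (G.prod (H.prod K)).carrier :=
  prod.associativity G.carrier H.carrier K.carrier

/-- Left unitality of products. -/
def leftE (G : FinGrpd) : (one.prod G).carrier ≌ G.carrier :=
  prod.leftUnitorEquivalence G.carrier

/-- Right unitality of products. -/
def rightE (G : FinGrpd) : (G.prod one).carrier ≌ G.carrier :=
  prod.rightUnitorEquivalence G.carrier

/-- Symmetry of products. -/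
def braidE (G H : FinGrpd) : (G.prod H).carrier ≌ (H.prod G).carrier :=
  Prod.braiding G.carrier H.carrier

/-- The product of two functors. -/
def prodMap {G H G' H' : FinGrpd} (a : G.carrier ⥤ H.carrier) (b : G'.carrier ⥤ H'.carrier) :
    (G.prod G').carrier ⥤ (H.prod H').carrier := a.prod b

end FinGrpd

section

open FinGrpd

namespace GSpan

variable {H G K L H' G' K' H'' G'' : FinGrpd}

theorem rel_equiv {S S' : GSpan H G} (e : S.apex.carrier ≌ S'.apex.carrier)
    (α : e.functor ⋙ S'.l ≅ S.l) (β : e.functor ⋙ S'.r ≅ S.r) : Rel S S' :=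
  ⟨e.functor, e.isEquivalence_functor, ⟨α⟩, ⟨β⟩⟩

theorem push_push (a : K.carrier ⥤ H.carrier) (b : H.carrier ⥤ G.carrier) :
    Rel (comp (push a) (push b)) (push (a ⋙ b)) := comp_push (push a) b

theorem tens_push (a : H.carrier ⥤ G.carrier) (b : H'.carrier ⥤ G'.carrier) :
    Rel (tens (push a) (push b)) (push (prodMap a b)) := Rel.refl _

theorem push_congr {a b : H.carrier ⥤ G.carrier} (α : a ≅ b) : Rel (push a) (push b) :=
  rel_equiv (S := push a) (S' := push b) CategoryTheory.Equivalence.refl (Iso.refl _) α.symm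

theorem id_comp' (S : GSpan H G) : Rel (comp (push (𝟭 H.carrier)) S) S :=
  push_comp (CategoryTheory.Equivalence.refl) S

theorem comp_id' (S : GSpan H G) : Rel (comp S (push (𝟭 G.carrier))) S :=
  comp_push S (𝟭 G.carrier)

theorem comp_zero' (S : GSpan K H) : Rel (comp S (zero H G)) (zero K G) :=
  rel_zero _ (fun (x : Comma _ _) => x.right.as.elim)

theorem zero_comp' (S : GSpan H G) : Rel (comp (zero K H) S) (zero K G) :=
  rel_zero _ (fun (x : Comma _ _) => x.left.as.elim)

theorem tens_zero' (S : GSpan H G) : Rel (tens S (zero H' G')) (zero _ _) :=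
  rel_zero _ (fun (x : S.apex.carrier × Discrete PEmpty) => x.2.as.elim)

theorem zero_tens' (S : GSpan H G) : Rel (tens (zero H' G') S) (zero _ _) :=
  rel_zero _ (fun (x : Discrete PEmpty × S.apex.carrier) => x.1.as.elim)

theorem assoc_nat (S : GSpan H G) (S' : GSpan H' G') (S'' : GSpan H'' G'') :
    Rel (comp (tens (tens S S') S'') (push (assocE G G' G'').functor))
      (comp (push (assocE H H' H'').functor) (tens S (tens S' S''))) :=
  (comp_push _ _).trans (Rel.trans
    (rel_equiv (S' := ⟨_, (tens S (tens S' S'')).l ⋙ (assocE H H' H'').inverse, (tens S (tens S' S'')).r⟩)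
      (assocE S.apex S'.apex S''.apex) (Iso.refl _) (Iso.refl _))
    (push_comp (assocE H H' H'') _).symm)

theorem left_nat (S : GSpan H G) :
    Rel (comp (tens (push (𝟭 one.carrier)) S) (push (leftE G).functor))
      (comp (push (leftE H).functor) S) :=
  (comp_push _ _).trans (Rel.trans
    (rel_equiv (S' := ⟨_, (S).l ⋙ (leftE H).inverse, (S).r⟩)
      (leftE S.apex) (Iso.refl _) (Iso.refl _))
    (push_comp (leftE H) _).symm)

theorem right_nat (S : GSpan H G) :
    Rel (comp (tens S (push (𝟭 one.carrier))) (push (rightE G).functor))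
      (comp (push (rightE H).functor) S) :=
  (comp_push _ _).trans (Rel.trans
    (rel_equiv (S' := ⟨_, (S).l ⋙ (rightE H).inverse, (S).r⟩)
      (rightE S.apex) (Iso.refl _) (Iso.refl _))
    (push_comp (rightE H) _).symm)

theorem braid_nat (S : GSpan H G) (S' : GSpan H' G') :
    Rel (comp (tens S S') (push (braidE G G').functor))
      (comp (push (braidE H H').functor) (tens S' S)) :=
  (comp_push _ _).trans (Rel.trans
    (rel_equiv (S' := ⟨_, (tens S' S).l ⋙ (braidE H H').inverse, (tens S' S).r⟩)
      (braidE S.apex S'.apex) (Iso.refl _) (Iso.refl _))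
    (push_comp (braidE H H') _).symm)

end GSpan

namespace GBiset

variable {H G K L H' G' K' H'' G'' : FinGrpd}

theorem push_push (a : K.carrier ⥤ H.carrier) (b : H.carrier ⥤ G.carrier) :
    Rel (comp (push a) (push b)) (push (a ⋙ b)) := push_comp a (push b)

theorem tens_push (a : H.carrier ⥤ G.carrier) (b : H'.carrier ⥤ G'.carrier) :
    Rel (tens (push a) (push b)) (push (prodMap a b)) :=
  rel_mk (fun _ _ x => x) (fun _ _ x => x) (fun _ _ _ => rfl) (fun _ _ _ => rfl)
    (fun _ _ _ => rfl)

theorem id_comp' (S : GBiset H G) : Rel (comp (push (𝟭 H.carrier)) S) S :=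
  push_comp (𝟭 H.carrier) S

theorem comp_id' (S : GBiset H G) : Rel (comp S (push (𝟭 G.carrier))) S :=
  (comp_congr (Rel.refl _) (push_equiv CategoryTheory.Equivalence.refl)).trans
    (comp_pull S (𝟭 G.carrier))

theorem comp_zero' (S : GBiset K H) : Rel (comp S (zero H G)) (zero K G) :=
  rel_zero _ (fun _ _ a => cls_ind S (zero H G) (p := fun _ => False) (fun _ _ x => x.elim) a)

theorem zero_comp' (S : GBiset H G) : Rel (comp (zero K H) S) (zero K G) :=
  rel_zero _ (fun _ _ a => cls_ind (zero K H) S (p := fun _ => False) (fun _ x _ => x.elim) a)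

theorem tens_zero' (S : GBiset H G) : Rel (tens S (zero H' G')) (zero _ _) :=
  rel_zero _ (fun _ _ a => a.2.elim)

theorem zero_tens' (S : GBiset H G) : Rel (tens (zero H' G') S) (zero _ _) :=
  rel_zero _ (fun _ _ a => a.1.elim)

theorem comp_push_equiv (S : GBiset K H) (e : H.carrier ≌ G.carrier) :
    Rel (comp S (push e.functor)) (res S (𝟭 _) e.inverse) :=
  (comp_congr (Rel.refl _) (push_equiv e)).trans (comp_pull S e.inverse)

theorem assoc_nat (S : GBiset H G) (S' : GBiset H' G') (S'' : GBiset H'' G'') :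
    Rel (comp (tens (tens S S') S'') (push (assocE G G' G'').functor))
      (comp (push (assocE H H' H'').functor) (tens S (tens S' S''))) :=
  (comp_push_equiv _ (assocE G G' G'')).trans (Rel.trans
    (rel_mk (U := res (tens (tens S S') S'') (𝟭 _) (assocE G G' G'').inverse)
      (V := res (tens S (tens S' S'')) (assocE H H' H'').functor (𝟭 _))
      (fun _ _ x => (x.1.1, x.1.2, x.2)) (fun _ _ x => ((x.1, x.2.1), x.2.2))
      (fun _ _ _ => rfl) (fun _ _ _ => rfl) (fun _ _ _ => rfl))
    (push_comp (assocE H H' H'').functor _).symm)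

theorem left_nat (S : GBiset H G) :
    Rel (comp (tens (push (𝟭 one.carrier)) S) (push (leftE G).functor))
      (comp (push (leftE H).functor) S) :=
  (comp_push_equiv _ (leftE G)).trans (Rel.trans
    (rel_mk (U := res (tens (push (𝟭 one.carrier)) S) (𝟭 _) (leftE G).inverse)
      (V := res S (leftE H).functor (𝟭 _)) (fun _ _ x => x.2) (fun h _ x => (eqToHom (by rcases h with ⟨⟨⟨⟩⟩, h⟩; rfl), x))
      (fun _ _ _ => Prod.ext (Subsingleton.elim (α := ((_ : Discrete PUnit) ⟶ _)) _ _) rfl)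
      (fun _ _ _ => rfl) (fun _ _ _ => rfl))
    (push_comp (leftE H).functor _).symm)

theorem right_nat (S : GBiset H G) :
    Rel (comp (tens S (push (𝟭 one.carrier))) (push (rightE G).functor))
      (comp (push (rightE H).functor) S) :=
  (comp_push_equiv _ (rightE G)).trans (Rel.trans
    (rel_mk (U := res (tens S (push (𝟭 one.carrier))) (𝟭 _) (rightE G).inverse)
      (V := res S (rightE H).functor (𝟭 _)) (fun _ _ x => x.1) (fun h _ x => (x, eqToHom (by rcases h with ⟨h, ⟨⟨⟩⟩⟩; rfl)))
      (fun _ _ _ => Prod.ext rfl (Subsingleton.elim (α := ((_ : Discrete PUnit) ⟶ _)) _ _))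
      (fun _ _ _ => rfl) (fun _ _ _ => rfl))
    (push_comp (rightE H).functor _).symm)

theorem braid_nat (S : GBiset H G) (S' : GBiset H' G') :
    Rel (comp (tens S S') (push (braidE G G').functor))
      (comp (push (braidE H H').functor) (tens S' S)) :=
  (comp_push_equiv _ (braidE G G')).trans (Rel.trans
    (rel_mk (U := res (tens S S') (𝟭 _) (braidE G G').inverse)
      (V := res (tens S' S) (braidE H H').functor (𝟭 _)) (fun _ _ x => (x.2, x.1)) (fun _ _ x => (x.2, x.1))
      (fun _ _ _ => rfl) (fun _ _ _ => rfl) (fun _ _ _ => rfl))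
    (push_comp (braidE H H').functor _).symm)

end GBiset

end

/-! ## The truncated bicategories of spans and of bisets -/

/-- A category enriched in commutative monoids. -/
class AddHoms (C : Type u) [Category.{v} C] where
  [mon : ∀ X Y : C, AddCommMonoid (X ⟶ Y)]
  comp_add {X Y Z : C} (f : X ⟶ Y) (g h : Y ⟶ Z) : f ≫ (g + h) = f ≫ g + f ≫ h
  add_comp {X Y Z : C} (f g : X ⟶ Y) (h : Y ⟶ Z) : (f + g) ≫ h = f ≫ h + g ≫ h
  comp_zero {X Y : C} (f : X ⟶ Y) (Z : C) : f ≫ (0 : Y ⟶ Z) = 0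
  zero_comp (X : C) {Y Z : C} (f : Y ⟶ Z) : (0 : X ⟶ Y) ≫ f = 0

attribute [reducible, instance] AddHoms.mon

/-- A monoidal category enriched in commutative monoids. -/
class AddTensor (C : Type u) [Category.{v} C] [MonoidalCategory C] [AddHoms C] : Prop where
  tensor_add {X Y X' Y' : C} (f : X ⟶ Y) (g h : X' ⟶ Y') : f ⊗ₘ (g + h) = f ⊗ₘ g + f ⊗ₘ h
  add_tensor {X Y X' Y' : C} (f g : X ⟶ Y) (h : X' ⟶ Y') : (f + g) ⊗ₘ h = f ⊗ₘ h + g ⊗ₘ h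
  tensor_zero {X Y : C} (f : X ⟶ Y) (X' Y' : C) : f ⊗ₘ (0 : X' ⟶ Y') = 0
  zero_tensor (X Y : C) {X' Y' : C} (f : X' ⟶ Y') : (0 : X ⟶ Y) ⊗ₘ f = 0

/-- The category of finite groupoids and isomorphism classes of spans, with sums given by disjoint
unions and tensor products by cartesian products. -/
structure SpanCat : Type 1 where
  of ::
  grpd : FinGrpd

namespace SpanCat

open FinGrpd

instance : Category.{1} SpanCat where
  Hom H G := Quotient (GSpan.setoid H.grpd G.grpd)
  id G := Quotient.mk _ (GSpan.push (𝟭 G.grpd.carrier))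
  comp := Quotient.map₂ GSpan.comp (fun _ _ h _ _ h' => GSpan.comp_congr h h')
  id_comp := by
    rintro H G ⟨S⟩
    exact Quotient.sound (GSpan.id_comp' S)
  comp_id := by
    rintro H G ⟨S⟩
    exact Quotient.sound (GSpan.comp_id' S)
  assoc := by
    rintro H G K L ⟨S⟩ ⟨T⟩ ⟨U⟩
    exact Quotient.sound (GSpan.comp_assoc S T U)

/-- The isomorphism class of a 1-cell. -/
def mk {H G : FinGrpd} (S : GSpan H G) : of H ⟶ of G := Quotient.mk (GSpan.setoid H G) S

theorem mk_eq {H G : FinGrpd} {S T : GSpan H G} (h : GSpan.Rel S T) : mk S = mk T :=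
  Quotient.sound h

theorem mk_exact {H G : FinGrpd} {S T : GSpan H G} (h : mk S = mk T) : GSpan.Rel S T :=
  Quotient.exact h

theorem ind {H G : SpanCat} {p : (H ⟶ G) → Prop}
    (h : ∀ S : GSpan H.grpd G.grpd, p (mk S)) (f : H ⟶ G) : p f :=
  Quotient.ind h f

theorem mk_comp_mk {K H G : FinGrpd} (S : GSpan K H) (T : GSpan H G) :
    mk S ≫ mk T = mk (S.comp T) := rfl

instance (H G : SpanCat) : Add (H ⟶ G) :=
  ⟨Quotient.map₂ GSpan.add (fun _ _ h _ _ h' => GSpan.add_congr h h')⟩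

instance (H G : SpanCat) : Zero (H ⟶ G) := ⟨mk (GSpan.zero H.grpd G.grpd)⟩

instance : AddHoms SpanCat where
  mon H G :=
    { add := fun f g => f + g
      zero := 0
      add_assoc := by
        rintro ⟨S⟩ ⟨T⟩ ⟨U⟩
        exact Quotient.sound (GSpan.add_assoc' S T U)
      zero_add := by
        rintro ⟨S⟩
        exact Quotient.sound (GSpan.zero_add' S)
      add_zero := by
        rintro ⟨S⟩
        exact Quotient.sound ((GSpan.add_comm' S (GSpan.zero H.grpd G.grpd)).trans (GSpan.zero_add' S))
      add_comm := by
        rintro ⟨S⟩ ⟨T⟩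
        exact Quotient.sound (GSpan.add_comm' S T)
      nsmul := nsmulRec
      nsmul_zero := fun _ => rfl
      nsmul_succ := fun _ _ => rfl }
  comp_add := by
    rintro K H G ⟨S⟩ ⟨T⟩ ⟨U⟩
    exact Quotient.sound (GSpan.comp_add S T U)
  add_comp := by
    rintro K H G ⟨S⟩ ⟨T⟩ ⟨U⟩
    exact Quotient.sound (GSpan.add_comp S T U)
  comp_zero := by
    rintro K H ⟨S⟩ G
    exact Quotient.sound (GSpan.comp_zero' S)
  zero_comp := by
    rintro K H G ⟨S⟩
    exact Quotient.sound (GSpan.zero_comp' S)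

theorem mk_add {H G : FinGrpd} (S T : GSpan H G) : mk (S.add T) = mk S + mk T := rfl

theorem mk_zero (H G : FinGrpd) : mk (GSpan.zero H G) = 0 := rfl

/-- The isomorphism given by an equivalence of groupoids. -/
def pushIso {H G : FinGrpd} (e : H.carrier ≌ G.carrier) : of H ≅ of G where
  hom := mk (GSpan.push e.functor)
  inv := mk (GSpan.push e.inverse)
  hom_inv_id := mk_eq ((GSpan.push_push _ _).trans (GSpan.push_congr e.unitIso.symm))
  inv_hom_id := mk_eq ((GSpan.push_push _ _).trans (GSpan.push_congr e.counitIso))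

instance : MonoidalCategoryStruct SpanCat where
  tensorObj G H := of (FinGrpd.prod G.grpd H.grpd)
  tensorUnit := of FinGrpd.one
  tensorHom f g := Quotient.map₂ GSpan.tens (fun _ _ h _ _ k => GSpan.tens_congr h k) f g
  whiskerLeft X _ _ f := Quotient.map₂ GSpan.tens (fun _ _ h _ _ k => GSpan.tens_congr h k)
    (𝟙 X) f
  whiskerRight f Y := Quotient.map₂ GSpan.tens (fun _ _ h _ _ k => GSpan.tens_congr h k)
    f (𝟙 Y)
  associator G H K := pushIso (assocE G.grpd H.grpd K.grpd)
  leftUnitor G := pushIso (leftE G.grpd)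
  rightUnitor G := pushIso (rightE G.grpd)

theorem mk_tensor_mk {H G H' G' : FinGrpd} (S : GSpan H G) (T : GSpan H' G') :
    (mk S ⊗ₘ mk T : of H ⊗ of H' ⟶ of G ⊗ of G') = mk (S.tens T) := rfl

theorem push_comp_push {K H G : FinGrpd} (a : K.carrier ⥤ H.carrier) (b : H.carrier ⥤ G.carrier) :
    mk (GSpan.push a) ≫ mk (GSpan.push b) = mk (GSpan.push (a ⋙ b)) :=
  mk_eq (GSpan.push_push a b)

theorem push_tensor_push {H G H' G' : FinGrpd} (a : H.carrier ⥤ G.carrier)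
    (b : H'.carrier ⥤ G'.carrier) :
    (mk (GSpan.push a) ⊗ₘ mk (GSpan.push b) : of H ⊗ of H' ⟶ of G ⊗ of G') =
      mk (GSpan.push (prodMap a b)) :=
  mk_eq (GSpan.tens_push a b)

instance : MonoidalCategory SpanCat := MonoidalCategory.ofTensorHom
  (id_tensorHom_id := fun X₁ X₂ => push_tensor_push (𝟭 X₁.grpd.carrier) (𝟭 X₂.grpd.carrier))
  (id_tensorHom := fun _ _ _ _ => rfl)
  (tensorHom_id := fun _ _ => rfl)
  (tensorHom_comp_tensorHom := by
    rintro X₁ Y₁ Z₁ X₂ Y₂ Z₂ ⟨f₁⟩ ⟨f₂⟩ ⟨g₁⟩ ⟨g₂⟩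
    exact mk_eq (GSpan.tens_comp f₁ g₁ f₂ g₂))
  (associator_naturality := by
    rintro X₁ X₂ X₃ Y₁ Y₂ Y₃ ⟨f₁⟩ ⟨f₂⟩ ⟨f₃⟩
    exact mk_eq (GSpan.assoc_nat f₁ f₂ f₃))
  (leftUnitor_naturality := by
    rintro X Y ⟨f⟩
    exact mk_eq (GSpan.left_nat f))
  (rightUnitor_naturality := by
    rintro X Y ⟨f⟩
    exact mk_eq (GSpan.right_nat f))
  (pentagon := fun W X Y Z => by
    refine (congrArg₂ _ (push_tensor_push (assocE W.grpd X.grpd Y.grpd).functor (𝟭 _)) (congrArg₂ _ rfl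
      (push_tensor_push (𝟭 _) (assocE X.grpd Y.grpd Z.grpd).functor))).trans ?_
    refine (congrArg₂ _ rfl (push_comp_push _ _)).trans ((push_comp_push _ _).trans ?_)
    exact (push_comp_push (assocE (W.grpd.prod X.grpd) Y.grpd Z.grpd).functor (assocE W.grpd X.grpd (Y.grpd.prod Z.grpd)).functor).symm)
  (triangle := fun X Y => by
    refine (congrArg₂ _ rfl (push_tensor_push (𝟭 _) (leftE Y.grpd).functor)).trans ?_
    refine (push_comp_push _ _).trans ?_
    exact (push_tensor_push (rightE X.grpd).functor (𝟭 _)).symm)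

instance : AddTensor SpanCat where
  tensor_add := by
    rintro X Y X' Y' ⟨f⟩ ⟨g⟩ ⟨h⟩
    exact mk_eq (GSpan.tens_add f g h)
  add_tensor := by
    rintro X Y X' Y' ⟨f⟩ ⟨g⟩ ⟨h⟩
    exact mk_eq (GSpan.add_tens f g h)
  tensor_zero := by
    rintro X Y ⟨f⟩ X' Y'
    exact mk_eq (GSpan.tens_zero' f)
  zero_tensor := by
    rintro X Y X' Y' ⟨f⟩
    exact mk_eq (GSpan.zero_tens' f)

instance : SymmetricCategory SpanCat where
  braiding G H := pushIso (braidE G.grpd H.grpd)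
  braiding_naturality_right := by
    rintro X Y Z ⟨f⟩
    exact mk_eq (GSpan.braid_nat _ f)
  braiding_naturality_left := by
    rintro X Y ⟨f⟩ Z
    exact mk_eq (GSpan.braid_nat f _)
  hexagon_forward X Y Z := by
    refine (congrArg₂ _ rfl (push_comp_push (braidE X.grpd (Y.grpd.prod Z.grpd)).functor
      (assocE Y.grpd Z.grpd X.grpd).functor)).trans ((push_comp_push _ _).trans ?_)
    refine Eq.symm ((congrArg₂ _ (push_tensor_push (braidE X.grpd Y.grpd).functor (𝟭 _)) ((congrArg₂ _ rfl
      (push_tensor_push (𝟭 _) (braidE X.grpd Z.grpd).functor)).trans (push_comp_push _ _))).trans ?_)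
    exact push_comp_push _ _
  hexagon_reverse X Y Z := by
    refine (congrArg₂ _ rfl (push_comp_push (braidE (X.grpd.prod Y.grpd) Z.grpd).functor
      (assocE Z.grpd X.grpd Y.grpd).inverse)).trans ((push_comp_push _ _).trans ?_)
    refine Eq.symm ((congrArg₂ _ (push_tensor_push (𝟭 _) (braidE Y.grpd Z.grpd).functor) ((congrArg₂ _ rfl
      (push_tensor_push (braidE X.grpd Z.grpd).functor (𝟭 _))).trans (push_comp_push _ _))).trans ?_)
    exact push_comp_push _ _
  symmetry X Y := (pushIso (braidE X.grpd Y.grpd)).hom_inv_id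

end SpanCat

/-- The category of finite groupoids and isomorphism classes of bisets, with sums given by disjoint
unions and tensor products by cartesian products. -/
structure BisetCat : Type 1 where
  of ::
  grpd : FinGrpd

namespace BisetCat

open FinGrpd

instance : Category.{1} BisetCat where
  Hom H G := Quotient (GBiset.setoid H.grpd G.grpd)
  id G := Quotient.mk _ (GBiset.push (𝟭 G.grpd.carrier))
  comp := Quotient.map₂ GBiset.comp (fun _ _ h _ _ h' => GBiset.comp_congr h h')
  id_comp := by
    rintro H G ⟨S⟩
    exact Quotient.sound (GBiset.id_comp' S)
  comp_id := by
    rintro H G ⟨S⟩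
    exact Quotient.sound (GBiset.comp_id' S)
  assoc := by
    rintro H G K L ⟨S⟩ ⟨T⟩ ⟨U⟩
    exact Quotient.sound (GBiset.comp_assoc S T U)

/-- The isomorphism class of a 1-cell. -/
def mk {H G : FinGrpd} (S : GBiset H G) : of H ⟶ of G := Quotient.mk (GBiset.setoid H G) S

theorem mk_eq {H G : FinGrpd} {S T : GBiset H G} (h : GBiset.Rel S T) : mk S = mk T :=
  Quotient.sound h

theorem mk_exact {H G : FinGrpd} {S T : GBiset H G} (h : mk S = mk T) : GBiset.Rel S T :=
  Quotient.exact h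

theorem ind {H G : BisetCat} {p : (H ⟶ G) → Prop}
    (h : ∀ S : GBiset H.grpd G.grpd, p (mk S)) (f : H ⟶ G) : p f :=
  Quotient.ind h f

theorem mk_comp_mk {K H G : FinGrpd} (S : GBiset K H) (T : GBiset H G) :
    mk S ≫ mk T = mk (S.comp T) := rfl

instance (H G : BisetCat) : Add (H ⟶ G) :=
  ⟨Quotient.map₂ GBiset.add (fun _ _ h _ _ h' => GBiset.add_congr h h')⟩

instance (H G : BisetCat) : Zero (H ⟶ G) := ⟨mk (GBiset.zero H.grpd G.grpd)⟩

instance : AddHoms BisetCat where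
  mon H G :=
    { add := fun f g => f + g
      zero := 0
      add_assoc := by
        rintro ⟨S⟩ ⟨T⟩ ⟨U⟩
        exact Quotient.sound (GBiset.add_assoc' S T U)
      zero_add := by
        rintro ⟨S⟩
        exact Quotient.sound (GBiset.zero_add' S)
      add_zero := by
        rintro ⟨S⟩
        exact Quotient.sound ((GBiset.add_comm' S (GBiset.zero H.grpd G.grpd)).trans (GBiset.zero_add' S))
      add_comm := by
        rintro ⟨S⟩ ⟨T⟩
        exact Quotient.sound (GBiset.add_comm' S T)
      nsmul := nsmulRec
      nsmul_zero := fun _ => rfl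
      nsmul_succ := fun _ _ => rfl }
  comp_add := by
    rintro K H G ⟨S⟩ ⟨T⟩ ⟨U⟩
    exact Quotient.sound (GBiset.comp_add S T U)
  add_comp := by
    rintro K H G ⟨S⟩ ⟨T⟩ ⟨U⟩
    exact Quotient.sound (GBiset.add_comp S T U)
  comp_zero := by
    rintro K H ⟨S⟩ G
    exact Quotient.sound (GBiset.comp_zero' S)
  zero_comp := by
    rintro K H G ⟨S⟩
    exact Quotient.sound (GBiset.zero_comp' S)

theorem mk_add {H G : FinGrpd} (S T : GBiset H G) : mk (S.add T) = mk S + mk T := rfl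

theorem mk_zero (H G : FinGrpd) : mk (GBiset.zero H G) = 0 := rfl

/-- The isomorphism given by an equivalence of groupoids. -/
def pushIso {H G : FinGrpd} (e : H.carrier ≌ G.carrier) : of H ≅ of G where
  hom := mk (GBiset.push e.functor)
  inv := mk (GBiset.push e.inverse)
  hom_inv_id := mk_eq ((GBiset.push_push _ _).trans (GBiset.push_congr e.unitIso.symm))
  inv_hom_id := mk_eq ((GBiset.push_push _ _).trans (GBiset.push_congr e.counitIso))

instance : MonoidalCategoryStruct BisetCat where
  tensorObj G H := of (FinGrpd.prod G.grpd H.grpd)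
  tensorUnit := of FinGrpd.one
  tensorHom f g := Quotient.map₂ GBiset.tens (fun _ _ h _ _ k => GBiset.tens_congr h k) f g
  whiskerLeft X _ _ f := Quotient.map₂ GBiset.tens (fun _ _ h _ _ k => GBiset.tens_congr h k)
    (𝟙 X) f
  whiskerRight f Y := Quotient.map₂ GBiset.tens (fun _ _ h _ _ k => GBiset.tens_congr h k)
    f (𝟙 Y)
  associator G H K := pushIso (assocE G.grpd H.grpd K.grpd)
  leftUnitor G := pushIso (leftE G.grpd)
  rightUnitor G := pushIso (rightE G.grpd)

theorem mk_tensor_mk {H G H' G' : FinGrpd} (S : GBiset H G) (T : GBiset H' G') :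
    (mk S ⊗ₘ mk T : of H ⊗ of H' ⟶ of G ⊗ of G') = mk (S.tens T) := rfl

theorem push_comp_push {K H G : FinGrpd} (a : K.carrier ⥤ H.carrier) (b : H.carrier ⥤ G.carrier) :
    mk (GBiset.push a) ≫ mk (GBiset.push b) = mk (GBiset.push (a ⋙ b)) :=
  mk_eq (GBiset.push_push a b)

theorem push_tensor_push {H G H' G' : FinGrpd} (a : H.carrier ⥤ G.carrier)
    (b : H'.carrier ⥤ G'.carrier) :
    (mk (GBiset.push a) ⊗ₘ mk (GBiset.push b) : of H ⊗ of H' ⟶ of G ⊗ of G') =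
      mk (GBiset.push (prodMap a b)) :=
  mk_eq (GBiset.tens_push a b)

instance : MonoidalCategory BisetCat := MonoidalCategory.ofTensorHom
  (id_tensorHom_id := fun X₁ X₂ => push_tensor_push (𝟭 X₁.grpd.carrier) (𝟭 X₂.grpd.carrier))
  (id_tensorHom := fun _ _ _ _ => rfl)
  (tensorHom_id := fun _ _ => rfl)
  (tensorHom_comp_tensorHom := by
    rintro X₁ Y₁ Z₁ X₂ Y₂ Z₂ ⟨f₁⟩ ⟨f₂⟩ ⟨g₁⟩ ⟨g₂⟩
    exact mk_eq (GBiset.tens_comp f₁ g₁ f₂ g₂))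
  (associator_naturality := by
    rintro X₁ X₂ X₃ Y₁ Y₂ Y₃ ⟨f₁⟩ ⟨f₂⟩ ⟨f₃⟩
    exact mk_eq (GBiset.assoc_nat f₁ f₂ f₃))
  (leftUnitor_naturality := by
    rintro X Y ⟨f⟩
    exact mk_eq (GBiset.left_nat f))
  (rightUnitor_naturality := by
    rintro X Y ⟨f⟩
    exact mk_eq (GBiset.right_nat f))
  (pentagon := fun W X Y Z => by
    refine (congrArg₂ _ (push_tensor_push (assocE W.grpd X.grpd Y.grpd).functor (𝟭 _)) (congrArg₂ _ rfl
      (push_tensor_push (𝟭 _) (assocE X.grpd Y.grpd Z.grpd).functor))).trans ?_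
    refine (congrArg₂ _ rfl (push_comp_push _ _)).trans ((push_comp_push _ _).trans ?_)
    exact (push_comp_push (assocE (W.grpd.prod X.grpd) Y.grpd Z.grpd).functor (assocE W.grpd X.grpd (Y.grpd.prod Z.grpd)).functor).symm)
  (triangle := fun X Y => by
    refine (congrArg₂ _ rfl (push_tensor_push (𝟭 _) (leftE Y.grpd).functor)).trans ?_
    refine (push_comp_push _ _).trans ?_
    exact (push_tensor_push (rightE X.grpd).functor (𝟭 _)).symm)

instance : AddTensor BisetCat where
  tensor_add := by
    rintro X Y X' Y' ⟨f⟩ ⟨g⟩ ⟨h⟩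
    exact mk_eq (GBiset.tens_add f g h)
  add_tensor := by
    rintro X Y X' Y' ⟨f⟩ ⟨g⟩ ⟨h⟩
    exact mk_eq (GBiset.add_tens f g h)
  tensor_zero := by
    rintro X Y ⟨f⟩ X' Y'
    exact mk_eq (GBiset.tens_zero' f)
  zero_tensor := by
    rintro X Y X' Y' ⟨f⟩
    exact mk_eq (GBiset.zero_tens' f)

instance : SymmetricCategory BisetCat where
  braiding G H := pushIso (braidE G.grpd H.grpd)
  braiding_naturality_right := by
    rintro X Y Z ⟨f⟩
    exact mk_eq (GBiset.braid_nat _ f)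
  braiding_naturality_left := by
    rintro X Y ⟨f⟩ Z
    exact mk_eq (GBiset.braid_nat f _)
  hexagon_forward X Y Z := by
    refine (congrArg₂ _ rfl (push_comp_push (braidE X.grpd (Y.grpd.prod Z.grpd)).functor
      (assocE Y.grpd Z.grpd X.grpd).functor)).trans ((push_comp_push _ _).trans ?_)
    refine Eq.symm ((congrArg₂ _ (push_tensor_push (braidE X.grpd Y.grpd).functor (𝟭 _)) ((congrArg₂ _ rfl
      (push_tensor_push (𝟭 _) (braidE X.grpd Z.grpd).functor)).trans (push_comp_push _ _))).trans ?_)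
    exact push_comp_push _ _
  hexagon_reverse X Y Z := by
    refine (congrArg₂ _ rfl (push_comp_push (braidE (X.grpd.prod Y.grpd) Z.grpd).functor
      (assocE Z.grpd X.grpd Y.grpd).inverse)).trans ((push_comp_push _ _).trans ?_)
    refine Eq.symm ((congrArg₂ _ (push_tensor_push (𝟭 _) (braidE Y.grpd Z.grpd).functor) ((congrArg₂ _ rfl
      (push_tensor_push (braidE X.grpd Z.grpd).functor (𝟭 _))).trans (push_comp_push _ _))).trans ?_)
    exact push_comp_push _ _
  symmetry X Y := (pushIso (braidE X.grpd Y.grpd)).hom_inv_id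

end BisetCat

section

open scoped TensorProduct

/-! ## Linearization -/

/-- The `𝕜`-module `𝕜 ⊗ K₀(N)`, where `K₀(N)` is the group completion of the commutative
monoid `N`. -/
def LinMod (𝕜 : Type w) [CommRing 𝕜] (N : Type v) [AddCommMonoid N] : Type (max w v) :=
  𝕜 ⊗[ℤ] Algebra.GrothendieckAddGroup N

namespace LinMod

variable {𝕜 : Type w} [CommRing 𝕜]

noncomputable instance (N : Type v) [AddCommMonoid N] : AddCommGroup (LinMod 𝕜 N) :=
  inferInstanceAs (AddCommGroup (𝕜 ⊗[ℤ] Algebra.GrothendieckAddGroup N))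

noncomputable instance (N : Type v) [AddCommMonoid N] : Module 𝕜 (LinMod 𝕜 N) :=
  inferInstanceAs (Module 𝕜 (𝕜 ⊗[ℤ] Algebra.GrothendieckAddGroup N))

section

variable {N : Type v} [AddCommMonoid N]

/-- The canonical map to the linearization. -/
noncomputable def inc : N →+ LinMod 𝕜 N :=
  (((TensorProduct.mk ℤ 𝕜 (Algebra.GrothendieckAddGroup N)) 1).toAddMonoidHom.comp
    Algebra.GrothendieckAddGroup.of : N →+ 𝕜 ⊗[ℤ] Algebra.GrothendieckAddGroup N)

theorem gr_eq (x : Algebra.GrothendieckAddGroup N) :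
    ∃ a b : N, x = Algebra.GrothendieckAddGroup.of a - Algebra.GrothendieckAddGroup.of b := by
  induction x using AddLocalization.ind with
  | H p =>
    refine ⟨p.1, p.2, ?_⟩
    rw [AddLocalization.mk_eq_addMonoidOf_mk', eq_sub_iff_add_eq]
    exact AddSubmonoid.LocalizationMap.mk'_spec _ _ _

theorem ind {p : LinMod 𝕜 N → Prop} (hi : ∀ n, p (inc n)) (ha : ∀ x y, p x → p y → p (x + y))
    (hs : ∀ (r : 𝕜) x, p x → p (r • x)) (x : LinMod 𝕜 N) : p x := by
  refine TensorProduct.induction_on (motive := p) x ?_ ?_ ha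
  · have : (0 : LinMod 𝕜 N) = inc 0 := (map_zero inc).symm
    exact this ▸ hi 0
  · intro r y
    obtain ⟨a, b, rfl⟩ := gr_eq y
    have : r ⊗ₜ[ℤ] (Algebra.GrothendieckAddGroup.of a - Algebra.GrothendieckAddGroup.of b) =
        r • (inc a + (-1 : 𝕜) • inc b : LinMod 𝕜 N) := by
      rw [TensorProduct.tmul_sub, sub_eq_add_neg, smul_add, smul_smul, mul_neg, mul_one, neg_smul]
      have h : ∀ c : N, r ⊗ₜ[ℤ] Algebra.GrothendieckAddGroup.of c = r • (inc c : LinMod 𝕜 N) := by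
        intro c
        refine Eq.trans ?_ (TensorProduct.smul_tmul' r (1 : 𝕜)
          (Algebra.GrothendieckAddGroup.of c)).symm
        rw [smul_eq_mul, mul_one]
      rw [← h a, ← h b]
      rfl
    rw [this]
    exact hs _ _ (ha _ _ (hi _) (hs _ _ (hi _)))

variable {V : Type*} [AddCommGroup V] [Module 𝕜 V]

/-- The universal property of the linearization. -/
noncomputable def lift (f : N →+ V) : LinMod 𝕜 N →ₗ[𝕜] V :=
  LinearMap.liftBaseChange 𝕜 (Algebra.GrothendieckAddGroup.lift f).toIntLinearMap

theorem lift_inc (f : N →+ V) (n : N) : lift f (inc n : LinMod 𝕜 N) = f n := by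
  have : Algebra.GrothendieckAddGroup.lift f (Algebra.GrothendieckAddGroup.of n) = f n :=
    DFunLike.congr_fun (Algebra.GrothendieckAddGroup.lift.symm_apply_apply f) n
  refine (LinearMap.liftBaseChange_tmul 𝕜 _ _ _).trans ?_
  rw [one_smul]
  exact this

end

variable {N N' : Type v} [AddCommMonoid N] [AddCommMonoid N']
variable {V : Type*} [AddCommGroup V] [Module 𝕜 V]

/-- The extension of a biadditive map to linearizations. -/
noncomputable def lift₂ (f : N → N' → V) (h₁ : ∀ a b c, f (a + b) c = f a c + f b c)
    (h₂ : ∀ a b c, f a (b + c) = f a b + f a c) (h₃ : ∀ a, f 0 a = 0) (h₄ : ∀ a, f a 0 = 0) :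
    LinMod 𝕜 N →ₗ[𝕜] LinMod 𝕜 N' →ₗ[𝕜] V :=
  lift (V := LinMod 𝕜 N' →ₗ[𝕜] V)
    { toFun := fun n => lift { toFun := f n, map_zero' := h₄ n, map_add' := h₂ n }
      map_zero' := by
        refine LinearMap.ext fun x => ?_
        induction x using ind (𝕜 := 𝕜) with
        | hi n => rw [lift_inc]; exact h₃ n
        | ha x y hx hy => rw [map_add, map_add, hx, hy]
        | hs r x hx => rw [map_smul, map_smul, hx]
      map_add' := fun a b => by
        refine LinearMap.ext fun x => ?_
        induction x using ind (𝕜 := 𝕜) with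
        | hi n => rw [LinearMap.add_apply, lift_inc, lift_inc, lift_inc]; exact h₁ a b n
        | ha x y hx hy => rw [map_add, map_add, hx, hy]
        | hs r x hx => rw [map_smul, map_smul, hx] }

theorem lift₂_inc (f : N → N' → V) (h₁ : ∀ a b c, f (a + b) c = f a c + f b c)
    (h₂ : ∀ a b c, f a (b + c) = f a b + f a c) (h₃ : ∀ a, f 0 a = 0) (h₄ : ∀ a, f a 0 = 0)
    (n : N) (n' : N') :
    lift₂ f h₁ h₂ h₃ h₄ (inc n : LinMod 𝕜 N) (inc n' : LinMod 𝕜 N') = f n n' := by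
  unfold lift₂
  rw [lift_inc]
  exact lift_inc _ n'

end LinMod

/-- The `𝕜`-linear category with the same objects as `C` and morphisms `𝕜 ⊗ K₀(C(X, Y))`. -/
structure Lin (𝕜 : Type w) (C : Type u) : Type u where
  of ::
  base : C

namespace Lin

open LinMod

variable {𝕜 : Type w} [CommRing 𝕜] {C : Type u} [Category.{v} C] [AddHoms C]

/-- Bilinear composition. -/
noncomputable def compL (X Y Z : C) :
    LinMod 𝕜 (X ⟶ Y) →ₗ[𝕜] LinMod 𝕜 (Y ⟶ Z) →ₗ[𝕜] LinMod 𝕜 (X ⟶ Z) :=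
  lift₂ (fun a b => inc (a ≫ b))
    (fun a b c => by rw [AddHoms.add_comp, map_add]) (fun a b c => by rw [AddHoms.comp_add, map_add])
    (fun a => by rw [AddHoms.zero_comp, map_zero]) (fun a => by rw [AddHoms.comp_zero, map_zero])

noncomputable instance : CategoryStruct.{max w v} (Lin 𝕜 C) where
  Hom X Y := LinMod 𝕜 (X.base ⟶ Y.base)
  id X := inc (𝟙 X.base)
  comp f g := compL _ _ _ f g

noncomputable instance instGrp (X Y : Lin 𝕜 C) : AddCommGroup (X ⟶ Y) :=
  inferInstanceAs (AddCommGroup (LinMod 𝕜 (X.base ⟶ Y.base)))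

noncomputable instance instMod (X Y : Lin 𝕜 C) : Module 𝕜 (X ⟶ Y) :=
  inferInstanceAs (Module 𝕜 (LinMod 𝕜 (X.base ⟶ Y.base)))

variable (𝕜) in
/-- The class of a morphism in the linearization. -/
noncomputable def incl {X Y : C} (f : X ⟶ Y) : (of X : Lin 𝕜 C) ⟶ of Y := inc (𝕜 := 𝕜) f

theorem incl_add {X Y : C} (f g : X ⟶ Y) : incl 𝕜 (f + g) = incl 𝕜 f + incl 𝕜 g :=
  map_add inc f g

theorem incl_zero (X Y : C) : incl 𝕜 (0 : X ⟶ Y) = 0 :=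
  map_zero inc

theorem incl_comp {X Y Z : C} (f : X ⟶ Y) (g : Y ⟶ Z) : incl 𝕜 (f ≫ g) = incl 𝕜 f ≫ incl 𝕜 g :=
  (lift₂_inc (𝕜 := 𝕜) (fun (a : X ⟶ Y) (b : Y ⟶ Z) => (inc (a ≫ b) : LinMod 𝕜 (X ⟶ Z)))
    _ _ _ _ f g).symm

theorem incl_id (X : C) : incl 𝕜 (𝟙 X) = 𝟙 (of X) := rfl

theorem ind {X Y : Lin 𝕜 C} {p : (X ⟶ Y) → Prop} (hi : ∀ f : X.base ⟶ Y.base, p (incl 𝕜 f))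
    (ha : ∀ f g, p f → p g → p (f + g)) (hs : ∀ (r : 𝕜) f, p f → p (r • f)) (f : X ⟶ Y) : p f :=
  LinMod.ind hi ha hs f

theorem add_comp' {X Y Z : Lin 𝕜 C} (f g : X ⟶ Y) (h : Y ⟶ Z) : (f + g) ≫ h = f ≫ h + g ≫ h :=
  LinearMap.map_add₂ (compL _ _ _) f g h

theorem comp_add' {X Y Z : Lin 𝕜 C} (f : X ⟶ Y) (g h : Y ⟶ Z) : f ≫ (g + h) = f ≫ g + f ≫ h :=
  map_add (compL _ _ _ f) g h

theorem smul_comp' {X Y Z : Lin 𝕜 C} (r : 𝕜) (f : X ⟶ Y) (h : Y ⟶ Z) :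
    (r • f) ≫ h = r • (f ≫ h) :=
  LinearMap.map_smul₂ (compL _ _ _) r f h

theorem comp_smul' {X Y Z : Lin 𝕜 C} (f : X ⟶ Y) (r : 𝕜) (h : Y ⟶ Z) :
    f ≫ (r • h) = r • (f ≫ h) :=
  map_smul (compL _ _ _ f) r h

noncomputable instance : Category.{max w v} (Lin 𝕜 C) where
  id_comp {X Y} f := by
    induction f using ind with
    | hi f => rw [← incl_id, ← incl_comp, Category.id_comp]
    | ha f g hf hg => rw [comp_add', hf, hg]
    | hs r f hf => rw [comp_smul', hf]
  comp_id {X Y} f := by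
    induction f using ind with
    | hi f => rw [← incl_id, ← incl_comp, Category.comp_id]
    | ha f g hf hg => rw [add_comp', hf, hg]
    | hs r f hf => rw [smul_comp', hf]
  assoc {W X Y Z} f g h := by
    induction f using ind with
    | hi f =>
      induction g using ind with
      | hi g =>
        induction h using ind with
        | hi h => rw [← incl_comp, ← incl_comp, ← incl_comp, ← incl_comp, Category.assoc]
        | ha f g hf hg => simp only [comp_add', hf, hg]
        | hs r f hf => simp only [comp_smul', hf]
      | ha f g hf hg => simp only [add_comp', comp_add', hf, hg]
      | hs r f hf => simp only [smul_comp', comp_smul', hf]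
    | ha f g hf hg => simp only [add_comp', hf, hg]
    | hs r f hf => simp only [smul_comp', hf]

noncomputable instance : Preadditive (Lin 𝕜 C) where
  homGroup := instGrp
  add_comp _ _ _ f g h := add_comp' f g h
  comp_add _ _ _ f g h := comp_add' f g h

noncomputable instance : Linear 𝕜 (Lin 𝕜 C) where
  homModule := instMod
  smul_comp _ _ _ r f h := smul_comp' r f h
  comp_smul _ _ _ f r h := comp_smul' f r h

variable (𝕜) in
/-- The class of an isomorphism in the linearization. -/
noncomputable def inclIso {X Y : C} (e : X ≅ Y) : (of X : Lin 𝕜 C) ≅ of Y where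
  hom := incl 𝕜 e.hom
  inv := incl 𝕜 e.inv
  hom_inv_id := by rw [← incl_comp, e.hom_inv_id, incl_id]
  inv_hom_id := by rw [← incl_comp, e.inv_hom_id, incl_id]

section

variable {D : Type*} [Category* D] [AddHoms D]

/-- The linear extension of an additive functor on morphisms. -/
noncomputable def mapL (F : C ⥤ D) (h₁ : ∀ {X Y : C} (f g : X ⟶ Y), F.map (f + g) = F.map f + F.map g)
    (h₂ : ∀ X Y : C, F.map (0 : X ⟶ Y) = 0) (X Y : C) :
    LinMod 𝕜 (X ⟶ Y) →ₗ[𝕜] LinMod 𝕜 (F.obj X ⟶ F.obj Y) :=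
  LinMod.lift (inc.comp { toFun := F.map, map_zero' := h₂ _ _, map_add' := h₁ })

/-- The linearization of an additive functor. -/
noncomputable def mapLin (F : C ⥤ D) (h₁ : ∀ {X Y : C} (f g : X ⟶ Y), F.map (f + g) = F.map f + F.map g)
    (h₂ : ∀ X Y : C, F.map (0 : X ⟶ Y) = 0) : Lin 𝕜 C ⥤ Lin 𝕜 D where
  obj X := of (F.obj X.base)
  map {X Y} f := mapL (𝕜 := 𝕜) F h₁ h₂ X.base Y.base f
  map_id X := (LinMod.lift_inc _ (𝟙 X.base)).trans (congrArg inc (F.map_id _))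
  map_comp {X Y Z} f g := by
    induction f using ind with
    | hi f =>
      induction g using ind with
      | hi g =>
        rw [← incl_comp]
        refine (LinMod.lift_inc _ _).trans ?_
        refine Eq.trans ?_ (congrArg₂ (fun a b => a ≫ b) (LinMod.lift_inc _ _)
          (LinMod.lift_inc _ _)).symm
        refine Eq.trans ?_ (incl_comp _ _)
        exact congrArg inc (F.map_comp f g)
      | ha f g hf hg =>
        rw [comp_add']
        refine (map_add _ _ _).trans ?_
        rw [hf, hg, ← comp_add']
        exact congrArg _ (map_add _ _ _).symm
      | hs r f hf =>
        rw [comp_smul']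
        refine (map_smul _ _ _).trans ?_
        rw [hf, ← comp_smul']
        exact congrArg _ (map_smul _ _ _).symm
    | ha f f' hf hf' =>
      rw [add_comp']
      refine (map_add _ _ _).trans ?_
      rw [hf, hf', ← add_comp']
      exact congrArg (fun t => t ≫ _) (map_add _ _ _).symm
    | hs r f hf =>
      rw [smul_comp']
      refine (map_smul _ _ _).trans ?_
      rw [hf, ← smul_comp']
      exact congrArg (fun t => t ≫ _) (map_smul _ _ _).symm

variable (F : C ⥤ D) (h₁ : ∀ {X Y : C} (f g : X ⟶ Y), F.map (f + g) = F.map f + F.map g)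
    (h₂ : ∀ X Y : C, F.map (0 : X ⟶ Y) = 0)

theorem mapLin_incl {X Y : C} (f : X ⟶ Y) :
    (mapLin (𝕜 := 𝕜) F h₁ h₂).map (incl 𝕜 f) = incl 𝕜 (F.map f) :=
  LinMod.lift_inc (𝕜 := 𝕜) (V := LinMod 𝕜 (F.obj X ⟶ F.obj Y)) _ f

instance : (mapLin (𝕜 := 𝕜) F h₁ h₂).Additive where
  map_add {_ _ f g} := map_add (mapL (𝕜 := 𝕜) F h₁ h₂ _ _) f g

instance : (mapLin (𝕜 := 𝕜) F h₁ h₂).Linear 𝕜 where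
  map_smul f r := map_smul (mapL (𝕜 := 𝕜) F h₁ h₂ _ _) r f

end

section

variable [MonoidalCategory C] [AddTensor C]

/-- Bilinear tensor product of morphisms. -/
noncomputable def tensL (X Y X' Y' : C) :
    LinMod 𝕜 (X ⟶ Y) →ₗ[𝕜] LinMod 𝕜 (X' ⟶ Y') →ₗ[𝕜] LinMod 𝕜 (X ⊗ X' ⟶ Y ⊗ Y') :=
  lift₂ (fun a b => inc (a ⊗ₘ b))
    (fun a b c => by rw [AddTensor.add_tensor, map_add])
    (fun a b c => by rw [AddTensor.tensor_add, map_add])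
    (fun a => by rw [AddTensor.zero_tensor, map_zero])
    (fun a => by rw [AddTensor.tensor_zero, map_zero])

noncomputable instance : MonoidalCategoryStruct (Lin 𝕜 C) where
  tensorObj X Y := of (X.base ⊗ Y.base)
  tensorUnit := of (𝟙_ C)
  tensorHom f g := tensL _ _ _ _ f g
  whiskerLeft X _ _ f := tensL _ _ _ _ (𝟙 X) f
  whiskerRight f Y := tensL _ _ _ _ f (𝟙 Y)
  associator X Y Z := inclIso 𝕜 (α_ X.base Y.base Z.base)
  leftUnitor X := inclIso 𝕜 (λ_ X.base)
  rightUnitor X := inclIso 𝕜 (ρ_ X.base)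

theorem incl_tensor {X Y X' Y' : C} (f : X ⟶ Y) (g : X' ⟶ Y') :
    (incl 𝕜 (f ⊗ₘ g) : (of X : Lin 𝕜 C) ⊗ of X' ⟶ of Y ⊗ of Y') = incl 𝕜 f ⊗ₘ incl 𝕜 g :=
  (lift₂_inc (𝕜 := 𝕜) (fun (a : X ⟶ Y) (b : X' ⟶ Y') =>
    (inc (a ⊗ₘ b) : LinMod 𝕜 (X ⊗ X' ⟶ Y ⊗ Y'))) _ _ _ _ f g).symm

theorem add_tensor' {X Y X' Y' : Lin 𝕜 C} (f g : X ⟶ Y) (h : X' ⟶ Y') :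
    (f + g) ⊗ₘ h = f ⊗ₘ h + g ⊗ₘ h :=
  LinearMap.map_add₂ (tensL _ _ _ _) f g h

theorem tensor_add' {X Y X' Y' : Lin 𝕜 C} (f : X ⟶ Y) (g h : X' ⟶ Y') :
    f ⊗ₘ (g + h) = f ⊗ₘ g + f ⊗ₘ h :=
  map_add (tensL _ _ _ _ f) g h

theorem smul_tensor' {X Y X' Y' : Lin 𝕜 C} (r : 𝕜) (f : X ⟶ Y) (h : X' ⟶ Y') :
    (r • f) ⊗ₘ h = r • (f ⊗ₘ h) :=
  LinearMap.map_smul₂ (tensL _ _ _ _) r f h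

theorem tensor_smul' {X Y X' Y' : Lin 𝕜 C} (r : 𝕜) (f : X ⟶ Y) (h : X' ⟶ Y') :
    f ⊗ₘ (r • h) = r • (f ⊗ₘ h) :=
  map_smul (tensL _ _ _ _ f) r h

noncomputable instance : MonoidalCategory (Lin 𝕜 C) := MonoidalCategory.ofTensorHom
  (id_tensorHom_id := fun X₁ X₂ => (incl_tensor _ _).symm.trans
    (congrArg (incl 𝕜) (id_tensorHom_id X₁.base X₂.base)))
  (id_tensorHom := fun _ _ _ _ => rfl)
  (tensorHom_id := fun _ _ => rfl)
  (tensorHom_comp_tensorHom := by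
    intro X₁ Y₁ Z₁ X₂ Y₂ Z₂ f₁ f₂ g₁ g₂
    induction f₁ using ind with
    | hi f₁ =>
      induction f₂ using ind with
      | hi f₂ =>
        induction g₁ using ind with
        | hi g₁ =>
          induction g₂ using ind with
          | hi g₂ =>
            rw [← incl_comp, ← incl_comp]
            refine (congrArg₂ (fun a b => a ≫ b) (incl_tensor _ _) (incl_tensor _ _)).symm.trans ?_
            exact (incl_comp _ _).symm.trans ((congrArg (incl 𝕜)
              (tensorHom_comp_tensorHom _ _ _ _)).trans (incl_tensor _ _))
          | ha f g hf hg => simp only [tensor_add', comp_add', hf, hg]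
          | hs r f hf => simp only [tensor_smul', comp_smul', hf]
        | ha f g hf hg => simp only [add_tensor', comp_add', hf, hg]
        | hs r f hf => simp only [smul_tensor', comp_smul', hf]
      | ha f g hf hg => simp only [tensor_add', add_comp', hf, hg]
      | hs r f hf => simp only [tensor_smul', smul_comp', hf]
    | ha f g hf hg => simp only [add_tensor', add_comp', hf, hg]
    | hs r f hf => simp only [smul_tensor', smul_comp', hf])
  (associator_naturality := by
    intro X₁ X₂ X₃ Y₁ Y₂ Y₃ f₁ f₂ f₃
    induction f₁ using ind with
    | hi f₁ =>
      induction f₂ using ind with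
      | hi f₂ =>
        induction f₃ using ind with
        | hi f₃ =>
          refine ((congrArg (fun a => a ≫ _) ((incl_tensor _ _).trans
            (congrArg (fun a => a ⊗ₘ incl 𝕜 f₃) (incl_tensor _ _)))).symm.trans ?_).trans
            (congrArg (fun a => _ ≫ a) ((incl_tensor _ _).trans
            (congrArg (fun a => incl 𝕜 f₁ ⊗ₘ a) (incl_tensor _ _))))
          exact (incl_comp _ _).symm.trans ((congrArg (incl 𝕜)
            (associator_naturality f₁ f₂ f₃)).trans (incl_comp _ _))
        | ha f g hf hg => simp only [tensor_add', add_comp', comp_add', hf, hg]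
        | hs r f hf => simp only [tensor_smul', smul_comp', comp_smul', hf]
      | ha f g hf hg => simp only [tensor_add', add_tensor', add_comp', comp_add', hf, hg]
      | hs r f hf => simp only [tensor_smul', smul_tensor', smul_comp', comp_smul', hf]
    | ha f g hf hg => simp only [add_tensor', add_comp', comp_add', hf, hg]
    | hs r f hf => simp only [smul_tensor', smul_comp', comp_smul', hf])
  (leftUnitor_naturality := by
    intro X Y f
    induction f using ind with
    | hi f =>
      refine (congrArg (fun a => a ≫ _) (incl_tensor (𝕜 := 𝕜) (𝟙 (𝟙_ C)) f)).symm.trans ?_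
      exact (incl_comp _ _).symm.trans ((congrArg (incl 𝕜)
        (by simp)).trans (incl_comp _ _))
    | ha f g hf hg => simp only [tensor_add', add_comp', comp_add', hf, hg]
    | hs r f hf => simp only [tensor_smul', smul_comp', comp_smul', hf])
  (rightUnitor_naturality := by
    intro X Y f
    induction f using ind with
    | hi f =>
      refine (congrArg (fun a => a ≫ _) (incl_tensor (𝕜 := 𝕜) f (𝟙 (𝟙_ C)))).symm.trans ?_
      exact (incl_comp _ _).symm.trans ((congrArg (incl 𝕜)
        (by simp)).trans (incl_comp _ _))
    | ha f g hf hg => simp only [add_tensor', add_comp', comp_add', hf, hg]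
    | hs r f hf => simp only [smul_tensor', smul_comp', comp_smul', hf])
  (pentagon := fun W X Y Z => by
    refine ((congrArg₂ (fun a b => a ≫ _ ≫ b) (incl_tensor (α_ W.base X.base Y.base).hom (𝟙 Z.base))
      (incl_tensor (𝟙 W.base) (α_ X.base Y.base Z.base).hom))).symm.trans ?_
    refine (congrArg (fun a => _ ≫ a) (incl_comp _ _)).symm.trans ?_
    refine (incl_comp _ _).symm.trans ?_
    refine (congrArg (incl 𝕜) ?_).trans (incl_comp _ _)
    rw [tensorHom_id, id_tensorHom]
    exact MonoidalCategory.pentagon _ _ _ _)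
  (triangle := fun X Y => by
    refine (congrArg (fun a => _ ≫ a) (incl_tensor (𝟙 X.base) (λ_ Y.base).hom)).symm.trans ?_
    refine (incl_comp _ _).symm.trans ?_
    refine (congrArg (incl 𝕜) ?_).trans (incl_tensor (ρ_ X.base).hom (𝟙 Y.base))
    rw [tensorHom_id, id_tensorHom]
    exact MonoidalCategory.triangle _ _)

instance : MonoidalPreadditive (Lin 𝕜 C) where
  whiskerLeft_zero := by
    intro X Y Z
    exact map_zero (tensL _ _ _ _ (inc (𝟙 X.base)))
  zero_whiskerRight := by
    intro X Y Z
    exact LinearMap.map_zero₂ (tensL _ _ _ _) (inc (𝟙 X.base))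
  whiskerLeft_add f g := tensor_add' _ f g
  add_whiskerRight f g := add_tensor' f g _

instance : MonoidalLinear 𝕜 (Lin 𝕜 C) where
  whiskerLeft_smul _ _ _ r f := tensor_smul' r _ f
  smul_whiskerRight r _ _ f _ := smul_tensor' r f _

theorem incl_whiskerLeft (X : C) {Y Z : C} (f : Y ⟶ Z) :
    (of X : Lin 𝕜 C) ◁ incl 𝕜 f = incl 𝕜 (X ◁ f) := by
  rw [← id_tensorHom, ← id_tensorHom]
  exact (incl_tensor _ _).symm

theorem incl_whiskerRight {Y Z : C} (f : Y ⟶ Z) (X : C) :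
    incl 𝕜 f ▷ (of X : Lin 𝕜 C) = incl 𝕜 (f ▷ X) := by
  rw [← tensorHom_id, ← tensorHom_id]
  exact (incl_tensor _ _).symm

noncomputable instance [SymmetricCategory C] : SymmetricCategory (Lin 𝕜 C) where
  braiding X Y := inclIso 𝕜 (β_ X.base Y.base)
  braiding_naturality_right X Y Z f := by
    induction f using ind with
    | hi f =>
      rw [incl_whiskerLeft, incl_whiskerRight]
      exact (incl_comp _ _).symm.trans ((congrArg (incl 𝕜)
        (BraidedCategory.braiding_naturality_right X.base f)).trans (incl_comp _ _))
    | ha f g hf hg =>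
      rw [MonoidalPreadditive.whiskerLeft_add, MonoidalPreadditive.add_whiskerRight,
        add_comp', comp_add', hf, hg]
    | hs r f hf =>
      rw [MonoidalLinear.whiskerLeft_smul, MonoidalLinear.smul_whiskerRight,
        smul_comp', comp_smul', hf]
  braiding_naturality_left {X Y} f Z := by
    induction f using ind with
    | hi f =>
      rw [incl_whiskerLeft, incl_whiskerRight]
      exact (incl_comp _ _).symm.trans ((congrArg (incl 𝕜)
        (BraidedCategory.braiding_naturality_left f Z.base)).trans (incl_comp _ _))
    | ha f g hf hg =>
      rw [MonoidalPreadditive.whiskerLeft_add, MonoidalPreadditive.add_whiskerRight,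
        add_comp', comp_add', hf, hg]
    | hs r f hf =>
      rw [MonoidalLinear.whiskerLeft_smul, MonoidalLinear.smul_whiskerRight,
        smul_comp', comp_smul', hf]
  hexagon_forward X Y Z := by
    refine Eq.trans ?_ ((congrArg₂ (fun a b => a ≫ _ ≫ b)
      (incl_whiskerRight (β_ X.base Y.base).hom Z.base)
      (incl_whiskerLeft Y.base (β_ X.base Z.base).hom))).symm
    refine ((congrArg (fun a => _ ≫ a) (incl_comp _ _)).symm.trans ((incl_comp _ _).symm.trans
      ?_)).trans ((incl_comp _ _).trans (congrArg (fun a => _ ≫ a) (incl_comp _ _)))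
    exact congrArg (incl 𝕜) (BraidedCategory.hexagon_forward _ _ _)
  hexagon_reverse X Y Z := by
    refine Eq.trans ?_ ((congrArg₂ (fun a b => a ≫ _ ≫ b)
      (incl_whiskerLeft X.base (β_ Y.base Z.base).hom)
      (incl_whiskerRight (β_ X.base Z.base).hom Y.base))).symm
    refine ((congrArg (fun a => _ ≫ a) (incl_comp _ _)).symm.trans ((incl_comp _ _).symm.trans
      ?_)).trans ((incl_comp _ _).trans (congrArg (fun a => _ ≫ a) (incl_comp _ _)))
    exact congrArg (incl 𝕜) (BraidedCategory.hexagon_reverse _ _ _)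
  symmetry X Y := by
    refine (incl_comp _ _).symm.trans ?_
    exact congrArg (incl 𝕜) (SymmetricCategory.symmetry _ _)

end

end Lin

end

/-! ## The realization of spans as bisets -/

namespace GSpan

variable {H G K L H' G' : FinGrpd}

/-- The biset `G(a -, -) ⊗_S H(-, b -)` realizing the span `H ←b- S -a→ G`. -/
def real (S : GSpan H G) : GBiset H G := GBiset.comp (GBiset.pull S.l) (GBiset.push S.r)

open GBiset

theorem pull_pull (a : K.carrier ⥤ H.carrier) (b : H.carrier ⥤ G.carrier) :
    GBiset.Rel (GBiset.comp (GBiset.pull b) (GBiset.pull a)) (GBiset.pull (a ⋙ b)) :=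
  comp_pull (GBiset.pull b) a

theorem real_push (a : H.carrier ⥤ G.carrier) : GBiset.Rel (real (push a)) (GBiset.push a) :=
  (GBiset.comp_congr (GBiset.push_equiv CategoryTheory.Equivalence.refl).symm
    (GBiset.Rel.refl _)).trans (GBiset.id_comp' _)

theorem real_mid {S T : FinGrpd} (l : S.carrier ⥤ H.carrier) (f : T.carrier ⥤ S.carrier)
    {S' : FinGrpd} (f' : T.carrier ⥤ S'.carrier) (r : S'.carrier ⥤ G.carrier) :
    GBiset.Rel (GBiset.comp (GBiset.pull (f ⋙ l)) (GBiset.push (f' ⋙ r)))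
      (GBiset.comp (GBiset.pull l)
        (GBiset.comp (GBiset.comp (GBiset.pull f) (GBiset.push f')) (GBiset.push r))) :=
  ((GBiset.comp_congr (pull_pull f l).symm (GBiset.push_push f' r).symm).trans
    (GBiset.comp_assoc _ _ _)).trans
    (GBiset.comp_congr (GBiset.Rel.refl _) (GBiset.comp_assoc _ _ _).symm)

theorem real_congr {S S' : GSpan H G} : Rel S S' → GBiset.Rel (real S) (real S') := by
  rintro ⟨f, hf, ⟨α⟩, ⟨β⟩⟩
  refine (GBiset.comp_congr (GBiset.pull_congr α.symm) (GBiset.push_congr β.symm)).trans ?_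
  refine (real_mid _ _ _ _).trans (GBiset.comp_congr (GBiset.Rel.refl _) ?_)
  exact (GBiset.comp_congr (GBiset.pull_push f) (GBiset.Rel.refl _)).trans (GBiset.id_comp' _)

theorem real_comp (S : GSpan K H) (T : GSpan H G) :
    GBiset.Rel (real (comp S T)) (GBiset.comp (real S) (real T)) := by
  refine (real_mid (T := FinGrpd.isoComma S.r T.l) _ _ _ _).trans ?_
  refine (GBiset.comp_congr (GBiset.Rel.refl _) ((GBiset.comp_congr (GBiset.base_change S.r T.l)
    (GBiset.Rel.refl _)).trans (GBiset.comp_assoc _ _ _))).trans ?_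
  exact (GBiset.comp_assoc _ _ _).symm

theorem real_tens (S : GSpan H G) (S' : GSpan H' G') :
    GBiset.Rel (real (tens S S')) (GBiset.tens (real S) (real S')) := by
  refine GBiset.Rel.trans (GBiset.comp_congr (V' := GBiset.tens (GBiset.pull S.l) (GBiset.pull S'.l))
    (U' := GBiset.tens (GBiset.push S.r) (GBiset.push S'.r)) ?_ ?_) (GBiset.tens_comp _ _ _ _)
  · exact GBiset.rel_mk (fun _ _ x => x) (fun _ _ x => x) (fun _ _ _ => rfl) (fun _ _ _ => rfl)
      (fun _ _ _ => rfl)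
  · exact GBiset.rel_mk (fun _ _ x => x) (fun _ _ x => x) (fun _ _ _ => rfl) (fun _ _ _ => rfl)
      (fun _ _ _ => rfl)

theorem real_zero : GBiset.Rel (real (zero H G)) (GBiset.zero H G) :=
  GBiset.rel_zero _ (fun _ _ a => cls_ind _ _ (p := fun _ => False)
    (fun (h : Discrete PEmpty) _ _ => h.as.elim) a)

theorem real_add (S T : GSpan H G) :
    GBiset.Rel (real (add S T)) (GBiset.add (real S) (real T)) := by
  refine GBiset.Rel.symm ⟨fun h g => Sum.elim
    (lift _ _ (fun s y x => cls (GBiset.pull (add S T).l) (GBiset.push (add S T).r)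
      (Sum.inl s : S.apex.carrier ⊕ T.apex.carrier) y x) ?_)
    (lift _ _ (fun s y x => cls (GBiset.pull (add S T).l) (GBiset.push (add S T).r)
      (Sum.inr s : S.apex.carrier ⊕ T.apex.carrier) y x) ?_), ?_, ?_⟩
  · exact fun {s s'} η y x => cls_eq (GBiset.pull (add S T).l) (GBiset.push (add S T).r)
      (h := (Sum.inl s : S.apex.carrier ⊕ T.apex.carrier))
      (h' := (Sum.inl s' : S.apex.carrier ⊕ T.apex.carrier)) ⟨η⟩ y x
  · exact fun {s s'} η y x => cls_eq (GBiset.pull (add S T).l) (GBiset.push (add S T).r)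
      (h := (Sum.inr s : S.apex.carrier ⊕ T.apex.carrier))
      (h' := (Sum.inr s' : S.apex.carrier ⊕ T.apex.carrier)) ⟨η⟩ y x
  · intro h g
    constructor
    · rintro (a | a) (b | b) e
      · induction a using cls_ind with | hp s y x
        induction b using cls_ind with | hp s' y' x'
        obtain ⟨η, e₁, e₂⟩ := cls_exact (GBiset.pull (add S T).l) (GBiset.push (add S T).r) e
        exact congrArg Sum.inl (Quotient.sound ⟨η.down, e₁, e₂⟩)
      · induction a using cls_ind with | hp s y x
        induction b using cls_ind with | hp s' y' x'
        obtain ⟨η, e₁, e₂⟩ := cls_exact (GBiset.pull (add S T).l) (GBiset.push (add S T).r) e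
        exact (hom_inl_inr_false _ _ η).elim
      · induction a using cls_ind with | hp s y x
        induction b using cls_ind with | hp s' y' x'
        obtain ⟨η, e₁, e₂⟩ := cls_exact (GBiset.pull (add S T).l) (GBiset.push (add S T).r) e
        exact (hom_inr_inl_false _ _ η).elim
      · induction a using cls_ind with | hp s y x
        induction b using cls_ind with | hp s' y' x'
        obtain ⟨η, e₁, e₂⟩ := cls_exact (GBiset.pull (add S T).l) (GBiset.push (add S T).r) e
        exact congrArg Sum.inr (Quotient.sound ⟨η.down, e₁, e₂⟩)
    · intro a
      induction a using cls_ind with | hp s y x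
      rcases s with s | s
      · exact ⟨Sum.inl (cls (GBiset.pull S.l) (GBiset.push S.r) s y x), rfl⟩
      · exact ⟨Sum.inr (cls (GBiset.pull T.l) (GBiset.push T.r) s y x), rfl⟩
  · rintro h h' g g' β α (a | a)
    · induction a using cls_ind with | hp s y x
      rfl
    · induction a using cls_ind with | hp s y x
      rfl

end GSpan

/-- Realization of spans as bisets, on isomorphism classes. -/
def realize : SpanCat ⥤ BisetCat where
  obj X := BisetCat.of X.grpd
  map {X Y} := Quotient.map GSpan.real (fun _ _ h => GSpan.real_congr h)
  map_id X := BisetCat.mk_eq (GSpan.real_push (𝟭 X.grpd.carrier))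
  map_comp := by
    rintro X Y Z ⟨S⟩ ⟨T⟩
    exact BisetCat.mk_eq (GSpan.real_comp S T)

theorem realize_add {X Y : SpanCat} (f g : X ⟶ Y) :
    realize.map (f + g) = realize.map f + realize.map g := by
  revert f g
  rintro ⟨f⟩ ⟨g⟩
  exact BisetCat.mk_eq (GSpan.real_add f g)

theorem realize_zero (X Y : SpanCat) : realize.map (0 : X ⟶ Y) = 0 :=
  BisetCat.mk_eq GSpan.real_zero

theorem realize_push {H G : FinGrpd} (a : H.carrier ⥤ G.carrier) :
    realize.map (SpanCat.mk (GSpan.push a)) = BisetCat.mk (GBiset.push a) :=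
  BisetCat.mk_eq (GSpan.real_push a)

theorem realize_tensor {X Y X' Y' : SpanCat} (f : X ⟶ Y) (g : X' ⟶ Y') :
    realize.map (f ⊗ₘ g) = (realize.map f ⊗ₘ realize.map g :
      realize.obj X ⊗ realize.obj X' ⟶ realize.obj Y ⊗ realize.obj Y') := by
  revert f g
  rintro ⟨f⟩ ⟨g⟩
  exact BisetCat.mk_eq (GSpan.real_tens f g)

section

variable (𝕜 : Type u) [CommRing 𝕜]

/-- The category of finite groupoids with morphism modules `𝕜 ⊗ K₀` of spans. -/
abbrev SpanK : Type 1 := Lin 𝕜 SpanCat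

/-- The category of finite groupoids with morphism modules `𝕜 ⊗ K₀` of bisets. -/
abbrev BisetK : Type 1 := Lin 𝕜 BisetCat

/-- The linear realization functor from spans to bisets. -/
noncomputable def realizeK : SpanK 𝕜 ⥤ BisetK 𝕜 :=
  Lin.mapLin (𝕜 := 𝕜) realize realize_add realize_zero

instance : (realizeK 𝕜).Additive :=
  inferInstanceAs (Lin.mapLin (𝕜 := 𝕜) realize realize_add realize_zero).Additive

instance : (realizeK 𝕜).Linear 𝕜 :=
  inferInstanceAs ((Lin.mapLin (𝕜 := 𝕜) realize realize_add realize_zero).Linear 𝕜)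

theorem realizeK_incl {X Y : SpanCat} (f : X ⟶ Y) :
    (realizeK 𝕜).map (Lin.incl 𝕜 f) = Lin.incl 𝕜 (realize.map f) :=
  Lin.mapLin_incl _ _ _ f

theorem realizeK_tensor {X Y X' Y' : SpanK 𝕜} (f : X ⟶ Y) (g : X' ⟶ Y') :
    (realizeK 𝕜).map (f ⊗ₘ g) = ((realizeK 𝕜).map f ⊗ₘ (realizeK 𝕜).map g :
      (realizeK 𝕜).obj X ⊗ (realizeK 𝕜).obj X' ⟶ (realizeK 𝕜).obj Y ⊗ (realizeK 𝕜).obj Y') := by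
  induction f using Lin.ind with
  | hi f =>
    induction g using Lin.ind with
    | hi g =>
      refine (congrArg (realizeK 𝕜).map (Lin.incl_tensor f g)).symm.trans ?_
      refine (realizeK_incl 𝕜 _).trans ((congrArg (Lin.incl 𝕜) (realize_tensor f g)).trans ?_)
      exact (Lin.incl_tensor _ _).trans (congrArg₂ (fun a b => a ⊗ₘ b) (realizeK_incl 𝕜 f).symm
        (realizeK_incl 𝕜 g).symm)
    | ha f g hf hg =>
      rw [Lin.tensor_add', Functor.map_add, Functor.map_add, hf, hg]
      exact (Lin.tensor_add' _ _ _).symm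
    | hs r f hf =>
      rw [Lin.tensor_smul', Functor.map_smul, Functor.map_smul, hf]
      exact (Lin.tensor_smul' _ _ _).symm
  | ha f g hf hg =>
    rw [Lin.add_tensor', Functor.map_add, Functor.map_add, hf, hg]
    exact (Lin.add_tensor' _ _ _).symm
  | hs r f hf =>
    rw [Lin.smul_tensor', Functor.map_smul, Functor.map_smul, hf]
    exact (Lin.smul_tensor' _ _ _).symm

theorem realizeK_push {H G : FinGrpd} (a : H.carrier ⥤ G.carrier) :
    (realizeK 𝕜).map (Lin.incl 𝕜 (SpanCat.mk (GSpan.push a))) =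
      Lin.incl 𝕜 (BisetCat.mk (GBiset.push a)) :=
  (realizeK_incl 𝕜 _).trans (congrArg (Lin.incl 𝕜) (realize_push a))

/-- Realization is a strict tensor functor. -/
noncomputable instance : (realizeK 𝕜).Monoidal :=
  Functor.CoreMonoidal.toMonoidal
    { εIso := Iso.refl _
      μIso := fun _ _ => Iso.refl _
      μIso_hom_natural_left := fun f X => by
        refine (Category.comp_id _).trans (Eq.trans ?_ (Category.id_comp _).symm)
        rw [← tensorHom_id, ← tensorHom_id, realizeK_tensor, CategoryTheory.Functor.map_id]
      μIso_hom_natural_right := fun X f => by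
        refine (Category.comp_id _).trans (Eq.trans ?_ (Category.id_comp _).symm)
        rw [← id_tensorHom, ← id_tensorHom, realizeK_tensor, CategoryTheory.Functor.map_id]
      associativity := fun X Y Z => by
        refine Eq.trans (congrArg₂ (fun a b => a ≫ 𝟙 _ ≫ b) (id_whiskerRight _ _)
          (realizeK_push 𝕜 (FinGrpd.assocE X.base.grpd Y.base.grpd Z.base.grpd).functor)) ?_
        refine Eq.trans ?_ (congrArg (fun a => (α_ _ _ _).hom ≫ a ≫ 𝟙 _) (whiskerLeft_id _ _)).symm
        refine (Category.id_comp _).trans ((Category.id_comp _).trans (Eq.symm ?_))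
        exact (congrArg (fun a => (α_ _ _ _).hom ≫ a) (Category.id_comp _)).trans
          (Category.comp_id _)
      left_unitality := fun X => by
        refine Eq.trans ?_ (congrArg₂ (fun a b => a ≫ 𝟙 _ ≫ b) (id_whiskerRight _ _)
          (realizeK_push 𝕜 (FinGrpd.leftE X.base.grpd).functor)).symm
        exact ((Category.id_comp _).trans (Category.id_comp _)).symm
      right_unitality := fun X => by
        refine Eq.trans ?_ (congrArg₂ (fun a b => a ≫ 𝟙 _ ≫ b) (whiskerLeft_id _ _)
          (realizeK_push 𝕜 (FinGrpd.rightE X.base.grpd).functor)).symm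
        exact ((Category.id_comp _).trans (Category.id_comp _)).symm }

noncomputable instance : (realizeK 𝕜).Braided where
  braided X Y := by
    refine (congrArg (fun a => 𝟙 _ ≫ a)
      (realizeK_push 𝕜 (FinGrpd.braidE X.base.grpd Y.base.grpd).functor)).trans ?_
    exact (Category.id_comp _).trans (Category.comp_id _).symm

end

/-! ## Linear functors and Day convolution -/

section

variable (𝕜 : Type w) [CommRing 𝕜] (C : Type u₁) [Category.{max w u₁} C] [Preadditive C]
  [Linear 𝕜 C]

/-- The property of being a `𝕜`-linear functor to `𝕜`-modules. -/
def linProp : ObjectProperty (C ⥤ ModuleCat.{max w u₁} 𝕜) :=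
  fun F => F.Additive ∧ F.Linear 𝕜

/-- The category of `𝕜`-linear functors from `C` to `𝕜`-modules. -/
abbrev LinRep := (linProp 𝕜 C).FullSubcategory

end

namespace LinRep

variable {𝕜 : Type w} [CommRing 𝕜] {C : Type u₁} [Category.{max w u₁} C] [Preadditive C]
  [Linear 𝕜 C]

/-- The module of values at an object. -/
abbrev El (M : LinRep 𝕜 C) (c : C) : Type (max w u₁) := M.obj.obj c

/-- The value at a morphism. -/
def act (M : LinRep 𝕜 C) {c d : C} (f : c ⟶ d) : M.El c →ₗ[𝕜] M.El d := (M.obj.map f).hom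

/-- A component of a natural transformation. -/
def ap {M N : LinRep 𝕜 C} (φ : M ⟶ N) (c : C) : M.El c →ₗ[𝕜] N.El c := (φ.hom.app c).hom

section

variable (M N P : LinRep 𝕜 C) {c d e : C}

@[simp]
theorem act_id (x : M.El c) : M.act (𝟙 c) x = x := by
  simp [act]

theorem act_congr {f g : c ⟶ d} (h : f = g) (x : M.El c) : M.act f x = M.act g x := by rw [h]

theorem act_act (f : c ⟶ d) (g : d ⟶ e) (x : M.El c) : M.act g (M.act f x) = M.act (f ≫ g) x := by
  simp [act]

theorem act_add (f g : c ⟶ d) (x : M.El c) : M.act (f + g) x = M.act f x + M.act g x := by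
  have := M.property.1
  simp [act, Functor.map_add]

theorem act_smul (r : 𝕜) (f : c ⟶ d) (x : M.El c) : M.act (r • f) x = r • M.act f x := by
  have := M.property.2
  simp [act, Functor.map_smul]

variable {M N P}

@[simp]
theorem ap_id (x : M.El c) : ap (𝟙 M) c x = x := rfl

@[simp]
theorem ap_comp (φ : M ⟶ N) (ψ : N ⟶ P) (x : M.El c) : ap (φ ≫ ψ) c x = ap ψ c (ap φ c x) := rfl

theorem ap_act (φ : M ⟶ N) (f : c ⟶ d) (x : M.El c) :
    ap φ d (M.act f x) = N.act f (ap φ c x) :=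
  congrArg (fun t => t.hom x) (φ.hom.naturality f)

@[simp]
theorem ap_add (φ ψ : M ⟶ N) (x : M.El c) : ap (φ + ψ) c x = ap φ c x + ap ψ c x := rfl

@[simp]
theorem ap_zero (x : M.El c) : ap (0 : M ⟶ N) c x = 0 := rfl

@[simp]
theorem ap_smul (r : 𝕜) (φ : M ⟶ N) (x : M.El c) : ap (r • φ) c x = r • ap φ c x := rfl

theorem hom_ext' {φ ψ : M ⟶ N} (h : ∀ c (x : M.El c), ap φ c x = ap ψ c x) : φ = ψ := by
  refine ObjectProperty.hom_ext _ (NatTrans.ext (funext fun c => ModuleCat.hom_ext ?_))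
  exact LinearMap.ext (h c)

end

/-- A linear functor from its values. -/
def ofData (obj : C → Type (max w u₁)) [∀ c, AddCommGroup (obj c)] [∀ c, Module 𝕜 (obj c)]
    (map : ∀ {c d : C}, (c ⟶ d) → obj c →ₗ[𝕜] obj d) (h₁ : ∀ c x, map (𝟙 c) x = x)
    (h₂ : ∀ {c d e : C} (f : c ⟶ d) (g : d ⟶ e) x, map (f ≫ g) x = map g (map f x))
    (h₃ : ∀ {c d : C} (f g : c ⟶ d) x, map (f + g) x = map f x + map g x)
    (h₄ : ∀ {c d : C} (r : 𝕜) (f : c ⟶ d) x, map (r • f) x = r • map f x) : LinRep 𝕜 C where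
  obj :=
    { obj := fun c => ModuleCat.of 𝕜 (obj c)
      map := fun f => ModuleCat.ofHom (map f)
      map_id := fun c => ModuleCat.hom_ext (LinearMap.ext (h₁ c))
      map_comp := fun f g => ModuleCat.hom_ext (LinearMap.ext (h₂ f g)) }
  property := ⟨⟨fun {_ _ f g} => ModuleCat.hom_ext (LinearMap.ext (h₃ f g))⟩,
    ⟨fun f r => ModuleCat.hom_ext (LinearMap.ext (h₄ r f))⟩⟩

/-- A morphism of linear functors from its components. -/
def homMk' {M N : LinRep 𝕜 C} (φ : ∀ c, M.El c →ₗ[𝕜] N.El c)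
    (h : ∀ {c d : C} (f : c ⟶ d) (x : M.El c), φ d (M.act f x) = N.act f (φ c x)) : M ⟶ N :=
  ObjectProperty.homMk
    { app := fun c => ModuleCat.ofHom (φ c)
      naturality := fun _ _ f => ModuleCat.hom_ext (LinearMap.ext (h f)) }

theorem ap_homMk' {M N : LinRep 𝕜 C} (φ : ∀ c, M.El c →ₗ[𝕜] N.El c)
    (h : ∀ {c d : C} (f : c ⟶ d) (x : M.El c), φ d (M.act f x) = N.act f (φ c x)) {c : C}
    (x : M.El c) : ap (homMk' φ h) c x = φ c x := rfl

/-- The functor corepresented by an object. -/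
def corep (b : C) : LinRep 𝕜 C :=
  ofData (fun c => b ⟶ c) (fun f => Linear.rightComp 𝕜 b f) (fun _ x => Category.comp_id x)
    (fun f g x => (Category.assoc x f g).symm) (fun _ _ _ => Preadditive.comp_add _ _ _ _ _ _)
    (fun _ _ _ => Linear.comp_smul _ _ _ _ _ _)

theorem corep_act {b c d : C} (f : c ⟶ d) (x : b ⟶ c) : (corep (𝕜 := 𝕜) b).act f x = x ≫ f := rfl

variable [MonoidalCategory C] [MonoidalPreadditive C] [MonoidalLinear 𝕜 C]

/-- Generators of the value at `c` of the Day convolution of `M` and `N`. -/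
abbrev DayGen (M N : LinRep 𝕜 C) (c : C) : Type (max w u₁) :=
  Σ u v : C, (u ⊗ v ⟶ c) × M.El u × N.El v

/-- The free module on the generators of the Day convolution. -/
abbrev DayFree (M N : LinRep 𝕜 C) (c : C) : Type (max w u₁) := DayGen M N c →₀ 𝕜

/-- A generator of the Day convolution. -/
noncomputable def gen (M N : LinRep 𝕜 C) {c u v : C} (f : u ⊗ v ⟶ c) (m : M.El u) (n : N.El v) :
    DayFree M N c := Finsupp.single ⟨u, v, f, m, n⟩ 1

/-- The relations of the Day convolution: linearity in each of the three arguments, and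
dinaturality. -/
inductive DayRel (M N : LinRep 𝕜 C) (c : C) : DayFree M N c → Prop
  | add₁ {u v : C} (f g : u ⊗ v ⟶ c) (m : M.El u) (n : N.El v) :
    DayRel M N c (gen M N (f + g) m n - gen M N f m n - gen M N g m n)
  | add₂ {u v : C} (f : u ⊗ v ⟶ c) (m m' : M.El u) (n : N.El v) :
    DayRel M N c (gen M N f (m + m') n - gen M N f m n - gen M N f m' n)
  | add₃ {u v : C} (f : u ⊗ v ⟶ c) (m : M.El u) (n n' : N.El v) :
    DayRel M N c (gen M N f m (n + n') - gen M N f m n - gen M N f m n')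
  | smul₁ {u v : C} (r : 𝕜) (f : u ⊗ v ⟶ c) (m : M.El u) (n : N.El v) :
    DayRel M N c (gen M N (r • f) m n - r • gen M N f m n)
  | smul₂ {u v : C} (r : 𝕜) (f : u ⊗ v ⟶ c) (m : M.El u) (n : N.El v) :
    DayRel M N c (gen M N f (r • m) n - r • gen M N f m n)
  | smul₃ {u v : C} (r : 𝕜) (f : u ⊗ v ⟶ c) (m : M.El u) (n : N.El v) :
    DayRel M N c (gen M N f m (r • n) - r • gen M N f m n)
  | nat {u v u' v' : C} (a : u ⟶ u') (b : v ⟶ v') (f : u' ⊗ v' ⟶ c) (m : M.El u) (n : N.El v) :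
    DayRel M N c (gen M N ((a ⊗ₘ b) ≫ f) m n - gen M N f (M.act a m) (N.act b n))

/-- The value at `c` of the Day convolution of `M` and `N`: the coend
`∫^{u,v} C(u ⊗ v, c) ⊗ M(u) ⊗ N(v)`. -/
def DayObj (M N : LinRep 𝕜 C) (c : C) : Type (max w u₁) :=
  DayFree M N c ⧸ Submodule.span 𝕜 {x | DayRel M N c x}

noncomputable instance (M N : LinRep 𝕜 C) (c : C) : AddCommGroup (DayObj M N c) :=
  inferInstanceAs (AddCommGroup (DayFree M N c ⧸ Submodule.span 𝕜 {x | DayRel M N c x}))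

noncomputable instance (M N : LinRep 𝕜 C) (c : C) : Module 𝕜 (DayObj M N c) :=
  inferInstanceAs (Module 𝕜 (DayFree M N c ⧸ Submodule.span 𝕜 {x | DayRel M N c x}))

section

variable {M N : LinRep 𝕜 C} {c d u v u' v' : C}

/-- The class of a generator. -/
noncomputable def dcls (f : u ⊗ v ⟶ c) (m : M.El u) (n : N.El v) : DayObj M N c :=
  Submodule.Quotient.mk (gen M N f m n)

theorem dcls_eq {x y : DayFree M N c} (h : DayRel M N c (x - y)) :
    (Submodule.Quotient.mk x : DayFree M N c ⧸ Submodule.span 𝕜 {x | DayRel M N c x}) =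
      Submodule.Quotient.mk y :=
  (Submodule.Quotient.eq _).2 (Submodule.subset_span h)

theorem dcls_add₁ (f g : u ⊗ v ⟶ c) (m : M.El u) (n : N.El v) :
    dcls (f + g) m n = dcls f m n + dcls g m n :=
  dcls_eq (by rw [← sub_sub]; exact DayRel.add₁ f g m n)

theorem dcls_add₂ (f : u ⊗ v ⟶ c) (m m' : M.El u) (n : N.El v) :
    dcls f (m + m') n = dcls f m n + dcls f m' n :=
  dcls_eq (by rw [← sub_sub]; exact DayRel.add₂ f m m' n)

theorem dcls_add₃ (f : u ⊗ v ⟶ c) (m : M.El u) (n n' : N.El v) :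
    dcls f m (n + n') = dcls f m n + dcls f m n' :=
  dcls_eq (by rw [← sub_sub]; exact DayRel.add₃ f m n n')

theorem dcls_smul₁ (r : 𝕜) (f : u ⊗ v ⟶ c) (m : M.El u) (n : N.El v) :
    dcls (r • f) m n = r • dcls f m n := dcls_eq (DayRel.smul₁ r f m n)

theorem dcls_smul₂ (r : 𝕜) (f : u ⊗ v ⟶ c) (m : M.El u) (n : N.El v) :
    dcls f (r • m) n = r • dcls f m n := dcls_eq (DayRel.smul₂ r f m n)

theorem dcls_smul₃ (r : 𝕜) (f : u ⊗ v ⟶ c) (m : M.El u) (n : N.El v) :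
    dcls f m (r • n) = r • dcls f m n := dcls_eq (DayRel.smul₃ r f m n)

theorem dcls_nat (a : u ⟶ u') (b : v ⟶ v') (f : u' ⊗ v' ⟶ c) (m : M.El u) (n : N.El v) :
    dcls f (M.act a m) (N.act b n) = dcls ((a ⊗ₘ b) ≫ f) m n :=
  (dcls_eq (DayRel.nat a b f m n)).symm

theorem dcls_ind {p : DayObj M N c → Prop}
    (hp : ∀ {u v : C} (f : u ⊗ v ⟶ c) (m : M.El u) (n : N.El v), p (dcls f m n))
    (ha : ∀ x y, p x → p y → p (x + y)) (x : DayObj M N c) : p x := by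
  refine Submodule.Quotient.induction_on _ x (fun y => ?_)
  induction y using Finsupp.induction_linear with
  | zero =>
    have h := hp (0 : 𝟙_ C ⊗ 𝟙_ C ⟶ c) (0 : M.El (𝟙_ C)) (0 : N.El (𝟙_ C))
    have e := dcls_smul₁ (0 : 𝕜) (0 : 𝟙_ C ⊗ 𝟙_ C ⟶ c) (0 : M.El (𝟙_ C)) (0 : N.El (𝟙_ C))
    rw [zero_smul, zero_smul] at e
    rw [e] at h
    exact h
  | add f g hf hg => exact ha _ _ hf hg
  | single a r =>
    obtain ⟨u, v, f, m, n⟩ := a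
    have h := hp (r • f) m n
    rw [dcls_smul₁] at h
    have e : (Finsupp.single ⟨u, v, f, m, n⟩ r : DayFree M N c) = r • gen M N f m n := by
      rw [gen, Finsupp.smul_single, smul_eq_mul, mul_one]
    rw [e]
    exact h

variable {V : Type (max w u₁)} [AddCommGroup V] [Module 𝕜 V]

/-- A trilinear dinatural family, which is a map out of a value of the Day convolution. -/
structure Fam (M N : LinRep 𝕜 C) (c : C) (V : Type (max w u₁)) [AddCommGroup V] [Module 𝕜 V] where
  φ : ∀ {u v : C}, (u ⊗ v ⟶ c) → M.El u → N.El v → V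
  add₁ : ∀ {u v : C} (f g : u ⊗ v ⟶ c) (m : M.El u) (n : N.El v), φ (f + g) m n = φ f m n + φ g m n
  add₂ : ∀ {u v : C} (f : u ⊗ v ⟶ c) (m m' : M.El u) (n : N.El v),
    φ f (m + m') n = φ f m n + φ f m' n
  add₃ : ∀ {u v : C} (f : u ⊗ v ⟶ c) (m : M.El u) (n n' : N.El v),
    φ f m (n + n') = φ f m n + φ f m n'
  smul₁ : ∀ {u v : C} (r : 𝕜) (f : u ⊗ v ⟶ c) (m : M.El u) (n : N.El v),
    φ (r • f) m n = r • φ f m n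
  smul₂ : ∀ {u v : C} (r : 𝕜) (f : u ⊗ v ⟶ c) (m : M.El u) (n : N.El v),
    φ f (r • m) n = r • φ f m n
  smul₃ : ∀ {u v : C} (r : 𝕜) (f : u ⊗ v ⟶ c) (m : M.El u) (n : N.El v),
    φ f m (r • n) = r • φ f m n
  nat : ∀ {u v u' v' : C} (a : u ⟶ u') (b : v ⟶ v') (f : u' ⊗ v' ⟶ c) (m : M.El u) (n : N.El v),
    φ f (M.act a m) (N.act b n) = φ ((a ⊗ₘ b) ≫ f) m n

/-- The linear map induced by a family, on the free module. -/
noncomputable def Fam.free (b : Fam M N c V) : DayFree M N c →ₗ[𝕜] V :=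
  Finsupp.lift V 𝕜 (DayGen M N c) (fun g => b.φ g.2.2.1 g.2.2.2.1 g.2.2.2.2)

theorem Fam.free_gen (b : Fam M N c V) (f : u ⊗ v ⟶ c) (m : M.El u) (n : N.El v) :
    b.free (gen M N f m n) = b.φ f m n := by
  simp [Fam.free, gen]

/-- The linear map induced by a family. -/
noncomputable def Fam.lift (b : Fam M N c V) : DayObj M N c →ₗ[𝕜] V :=
  Submodule.liftQ _ b.free (by
    rw [Submodule.span_le]
    rintro x (⟨f, g, m, n⟩ | ⟨f, m, m', n⟩ | ⟨f, m, n, n'⟩ | ⟨r, f, m, n⟩ | ⟨r, f, m, n⟩ |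
      ⟨r, f, m, n⟩ | ⟨a, a', f, m, n⟩) <;>
    simp [Fam.free_gen, b.add₁, b.add₂, b.add₃, b.smul₁, b.smul₂, b.smul₃, b.nat])

theorem Fam.lift_dcls (b : Fam M N c V) (f : u ⊗ v ⟶ c) (m : M.El u) (n : N.El v) :
    b.lift (dcls f m n) = b.φ f m n :=
  b.free_gen f m n

end

/-- The functoriality of the Day convolution in its value. -/
noncomputable def dayMap (M N : LinRep 𝕜 C) {c d : C} (h : c ⟶ d) :
    DayObj M N c →ₗ[𝕜] DayObj M N d :=
  Fam.lift
    { φ := fun f m n => dcls (f ≫ h) m n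
      add₁ := fun f g m n => by rw [Preadditive.add_comp, dcls_add₁]
      add₂ := fun f m m' n => by rw [dcls_add₂]
      add₃ := fun f m n n' => by rw [dcls_add₃]
      smul₁ := fun r f m n => by rw [Linear.smul_comp, dcls_smul₁]
      smul₂ := fun r f m n => by rw [dcls_smul₂]
      smul₃ := fun r f m n => by rw [dcls_smul₃]
      nat := fun a b f m n => by rw [dcls_nat, Category.assoc] }

theorem dayMap_dcls {M N : LinRep 𝕜 C} {c d u v : C} (h : c ⟶ d) (f : u ⊗ v ⟶ c) (m : M.El u)
    (n : N.El v) : dayMap M N h (dcls f m n) = dcls (f ≫ h) m n :=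
  Fam.lift_dcls _ _ _ _

/-- Day convolution of linear functors. -/
noncomputable def day (M N : LinRep 𝕜 C) : LinRep 𝕜 C :=
  ofData (DayObj M N) (fun h => dayMap M N h)
    (fun c x => by
      induction x using dcls_ind with
      | hp f m n => rw [dayMap_dcls, Category.comp_id]
      | ha x y hx hy => rw [map_add, hx, hy])
    (fun f g x => by
      induction x using dcls_ind with
      | hp f m n => rw [dayMap_dcls, dayMap_dcls, dayMap_dcls, Category.assoc]
      | ha x y hx hy => rw [map_add, map_add, map_add, hx, hy])
    (fun f g x => by
      induction x using dcls_ind with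
      | hp f m n => rw [dayMap_dcls, dayMap_dcls, dayMap_dcls, Preadditive.comp_add, dcls_add₁]
      | ha x y hx hy => rw [map_add, map_add, map_add, hx, hy, add_add_add_comm])
    (fun r f x => by
      induction x using dcls_ind with
      | hp f m n => rw [dayMap_dcls, dayMap_dcls, Linear.comp_smul, dcls_smul₁]
      | ha x y hx hy => rw [map_add, map_add, hx, hy, smul_add])

section

variable {M N P Q : LinRep 𝕜 C} {c d u v u' v' : C}

/-- The universal element `m ⊗ n`. -/
noncomputable def tm (m : M.El u) (n : N.El v) : (day M N).El (u ⊗ v) := dcls (𝟙 _) m n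

theorem act_tm (f : u ⊗ v ⟶ c) (m : M.El u) (n : N.El v) :
    (day M N).act f (tm m n) = dcls f m n :=
  (dayMap_dcls f (𝟙 _) m n).trans (by rw [Category.id_comp])

theorem add_tm (m m' : M.El u) (n : N.El v) : tm (m + m') n = tm m n + tm m' n := dcls_add₂ _ _ _ _

theorem tm_add (m : M.El u) (n n' : N.El v) : tm m (n + n') = tm m n + tm m n' := dcls_add₃ _ _ _ _

theorem smul_tm (r : 𝕜) (m : M.El u) (n : N.El v) : tm (r • m) n = r • tm m n := dcls_smul₂ _ _ _ _

theorem tm_smul (r : 𝕜) (m : M.El u) (n : N.El v) : tm m (r • n) = r • tm m n := dcls_smul₃ _ _ _ _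

theorem tm_nat (a : u ⟶ u') (b : v ⟶ v') (m : M.El u) (n : N.El v) :
    tm (M.act a m) (N.act b n) = (day M N).act (a ⊗ₘ b) (tm m n) := by
  rw [act_tm]
  exact (dcls_nat _ _ _ _ _).trans (by rw [Category.comp_id])

theorem tm_natL (a : u ⟶ u') (m : M.El u) (n : N.El v) :
    tm (M.act a m) n = (day M N).act (a ▷ v) (tm m n) := by
  have := tm_nat a (𝟙 v) m n
  rwa [act_id, tensorHom_id] at this

theorem tm_natR (b : v ⟶ v') (m : M.El u) (n : N.El v) :
    tm m (N.act b n) = (day M N).act (u ◁ b) (tm m n) := by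
  have := tm_nat (𝟙 u) b m n
  rwa [act_id, id_tensorHom] at this

theorem day_ind {p : (day M N).El c → Prop}
    (hp : ∀ {u v : C} (f : u ⊗ v ⟶ c) (m : M.El u) (n : N.El v), p ((day M N).act f (tm m n)))
    (ha : ∀ x y, p x → p y → p (x + y)) (x : (day M N).El c) : p x :=
  dcls_ind (p := p) (fun f m n => by have := hp f m n; rwa [act_tm] at this) ha x

theorem day_ext {φ ψ : day M N ⟶ P}
    (h : ∀ {u v : C} (m : M.El u) (n : N.El v), ap φ _ (tm m n) = ap ψ _ (tm m n)) : φ = ψ := by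
  refine hom_ext' fun c x => ?_
  induction x using day_ind with
  | hp f m n => rw [ap_act, ap_act, h]
  | ha x y hx hy => rw [map_add, map_add, hx, hy]

theorem day_ext₃ {φ ψ : day (day M N) P ⟶ Q}
    (h : ∀ {u v w : C} (m : M.El u) (n : N.El v) (p : P.El w),
      ap φ _ (tm (tm m n) p) = ap ψ _ (tm (tm m n) p)) : φ = ψ := by
  refine day_ext fun x p => ?_
  induction x using day_ind with
  | hp f m n => rw [tm_natL, ap_act, ap_act, h]
  | ha x y hx hy => rw [add_tm, map_add, map_add, hx, hy]

theorem day_ext₃' {φ ψ : day M (day N P) ⟶ Q}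
    (h : ∀ {u v w : C} (m : M.El u) (n : N.El v) (p : P.El w),
      ap φ _ (tm m (tm n p)) = ap ψ _ (tm m (tm n p))) : φ = ψ := by
  refine day_ext fun m x => ?_
  induction x using day_ind with
  | hp f n p => rw [tm_natR, ap_act, ap_act, h]
  | ha x y hx hy => rw [tm_add, map_add, map_add, hx, hy]

theorem day_ext₄ {R : LinRep 𝕜 C} {φ ψ : day (day (day M N) P) Q ⟶ R}
    (h : ∀ {u v w z : C} (m : M.El u) (n : N.El v) (p : P.El w) (q : Q.El z),
      ap φ _ (tm (tm (tm m n) p) q) = ap ψ _ (tm (tm (tm m n) p) q)) : φ = ψ := by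
  refine day_ext₃ fun x p q => ?_
  induction x using day_ind with
  | hp f m n => rw [tm_natL, tm_natL, ap_act, ap_act, h]
  | ha x y hx hy => rw [add_tm, add_tm, map_add, map_add, hx, hy]

/-- A bilinear natural family `M(u) × N(v) → P(u ⊗ v)`. -/
structure Bil (M N P : LinRep 𝕜 C) where
  φ : ∀ {u v : C}, M.El u → N.El v → P.El (u ⊗ v)
  add₂ : ∀ {u v : C} (m m' : M.El u) (n : N.El v), φ (m + m') n = φ m n + φ m' n
  add₃ : ∀ {u v : C} (m : M.El u) (n n' : N.El v), φ m (n + n') = φ m n + φ m n'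
  smul₂ : ∀ {u v : C} (r : 𝕜) (m : M.El u) (n : N.El v), φ (r • m) n = r • φ m n
  smul₃ : ∀ {u v : C} (r : 𝕜) (m : M.El u) (n : N.El v), φ m (r • n) = r • φ m n
  natL : ∀ {u v u' : C} (a : u ⟶ u') (m : M.El u) (n : N.El v),
    φ (M.act a m) n = P.act (a ▷ v) (φ m n)
  natR : ∀ {u v v' : C} (b : v ⟶ v') (m : M.El u) (n : N.El v),
    φ m (N.act b n) = P.act (u ◁ b) (φ m n)

/-- The family at one value. -/
noncomputable def Bil.fam (b : Bil M N P) (c : C) : Fam M N c (P.El c) where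
  φ f m n := P.act f (b.φ m n)
  add₁ f g m n := P.act_add _ _ _
  add₂ f m m' n := by rw [b.add₂, map_add]
  add₃ f m n n' := by rw [b.add₃, map_add]
  smul₁ r f m n := P.act_smul _ _ _
  smul₂ r f m n := by rw [b.smul₂, map_smul]
  smul₃ r f m n := by rw [b.smul₃, map_smul]
  nat a b' f m n := by
    rw [b.natL, b.natR, act_act, act_act]
    refine act_congr _ ?_ _
    rw [tensorHom_def', Category.assoc]

/-- The universal property of the Day convolution, at one value. -/
noncomputable def Bil.descAt (b : Bil M N P) (c : C) : (day M N).El c →ₗ[𝕜] P.El c := (b.fam c).lift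

theorem Bil.descAt_act_tm (b : Bil M N P) (f : u ⊗ v ⟶ c) (m : M.El u) (n : N.El v) :
    b.descAt c ((day M N).act f (tm m n)) = P.act f (b.φ m n) := by
  rw [act_tm]
  exact Fam.lift_dcls (b.fam c) f m n

/-- The universal property of the Day convolution. -/
noncomputable def Bil.desc (b : Bil M N P) : day M N ⟶ P :=
  homMk' b.descAt (fun {c d} f x => by
    induction x using day_ind with
    | hp g m n => rw [act_act, b.descAt_act_tm, b.descAt_act_tm, act_act]
    | ha x y hx hy => rw [map_add, map_add, map_add, map_add, hx, hy])

theorem Bil.desc_tm (b : Bil M N P) (m : M.El u) (n : N.El v) : ap b.desc _ (tm m n) = b.φ m n :=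
  (Fam.lift_dcls (b.fam _) _ _ _).trans (P.act_id _)

/-- Day convolution of morphisms. -/
noncomputable def dayHom {M N M' N' : LinRep 𝕜 C} (f : M ⟶ M') (g : N ⟶ N') :
    day M N ⟶ day M' N' :=
  Bil.desc
    { φ := fun m n => tm (ap f _ m) (ap g _ n)
      add₂ := fun m m' n => by rw [map_add, add_tm]
      add₃ := fun m n n' => by rw [map_add, tm_add]
      smul₂ := fun r m n => by rw [map_smul, smul_tm]
      smul₃ := fun r m n => by rw [map_smul, tm_smul]
      natL := fun a m n => by rw [ap_act, tm_natL]
      natR := fun b m n => by rw [ap_act, tm_natR] }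

theorem dayHom_tm {M N M' N' : LinRep 𝕜 C} (f : M ⟶ M') (g : N ⟶ N') (m : M.El u) (n : N.El v) :
    ap (dayHom f g) _ (tm m n) = tm (ap f _ m) (ap g _ n) :=
  Bil.desc_tm _ _ _

/-- Part of the associativity of the Day convolution. -/
noncomputable def assocFam (M N : LinRep 𝕜 C) {P : LinRep 𝕜 C} {w : C} (p : P.El w) (c : C) :
    Fam M N c ((day M (day N P)).El (c ⊗ w)) where
  φ f m n := (day M (day N P)).act ((α_ _ _ _).inv ≫ f ▷ w) (tm m (tm n p))
  add₁ f g m n := by rw [MonoidalPreadditive.add_whiskerRight, Preadditive.comp_add, act_add]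
  add₂ f m m' n := by rw [add_tm, map_add]
  add₃ f m n n' := by rw [add_tm, tm_add, map_add]
  smul₁ r f m n := by rw [MonoidalLinear.smul_whiskerRight, Linear.comp_smul, act_smul]
  smul₂ r f m n := by rw [smul_tm, map_smul]
  smul₃ r f m n := by rw [smul_tm, tm_smul, map_smul]
  nat a b f m n := by
    rw [tm_natL, tm_natL, tm_natR, act_act, act_act]
    refine act_congr _ ?_ _
    rw [comp_whiskerRight, associator_inv_naturality_left_assoc, tensorHom_def',
      comp_whiskerRight]
    simp

/-- Part of the associativity of the Day convolution. -/
noncomputable def assocAux (M N : LinRep 𝕜 C) {P : LinRep 𝕜 C} {w : C} (p : P.El w) (c : C) :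
    (day M N).El c →ₗ[𝕜] (day M (day N P)).El (c ⊗ w) := (assocFam M N p c).lift

theorem assocAux_act_tm {w : C} (p : P.El w) (f : u ⊗ v ⟶ c) (m : M.El u) (n : N.El v) :
    assocAux M N p c ((day M N).act f (tm m n)) =
      (day M (day N P)).act ((α_ _ _ _).inv ≫ f ▷ w) (tm m (tm n p)) := by
  rw [act_tm]
  exact Fam.lift_dcls (assocFam M N p c) f m n

/-- Associativity of the Day convolution. -/
noncomputable def assocHom (M N P : LinRep 𝕜 C) : day (day M N) P ⟶ day M (day N P) :=
  Bil.desc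
    { φ := fun x p => assocAux M N p _ x
      add₂ := fun m m' n => map_add _ _ _
      add₃ := fun {u v} x p p' => by
        induction x using day_ind with
        | hp f m n => rw [assocAux_act_tm, assocAux_act_tm, assocAux_act_tm, tm_add, tm_add, map_add]
        | ha x y hx hy => rw [map_add, hx, hy, map_add, map_add, add_add_add_comm]
      smul₂ := fun r m n => map_smul _ _ _
      smul₃ := fun {u v} r x p => by
        induction x using day_ind with
        | hp f m n => rw [assocAux_act_tm, assocAux_act_tm, tm_smul, tm_smul, map_smul]
        | ha x y hx hy => rw [map_add, hx, hy, map_add, smul_add]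
      natL := fun a x p => by
        induction x using day_ind with
        | hp f m n => rw [act_act, assocAux_act_tm, assocAux_act_tm, act_act, comp_whiskerRight,
            Category.assoc]
        | ha x y hx hy => rw [map_add, map_add, hx, hy, map_add, map_add]
      natR := fun {u v v'} b x p => by
        induction x using day_ind with
        | hp f m n =>
          rw [assocAux_act_tm, assocAux_act_tm, tm_natR, tm_natR, act_act, act_act]
          refine act_congr _ ?_ _
          rw [Category.assoc, ← whisker_exchange, associator_inv_naturality_right_assoc]
        | ha x y hx hy => rw [map_add, hx, hy, map_add, map_add] }

theorem assocHom_tm {w : C} (m : M.El u) (n : N.El v) (p : P.El w) :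
    ap (assocHom M N P) _ (tm (tm m n) p) =
      (day M (day N P)).act (α_ _ _ _).inv (tm m (tm n p)) := by
  refine (Bil.desc_tm _ _ _).trans ?_
  have := assocAux_act_tm p (𝟙 (u ⊗ v)) m n
  rwa [act_id, id_whiskerRight, Category.comp_id] at this

/-- Part of the inverse associativity of the Day convolution. -/
noncomputable def assocInvFam (N P : LinRep 𝕜 C) {M : LinRep 𝕜 C} {w : C} (m : M.El w) (c : C) :
    Fam N P c ((day (day M N) P).El (w ⊗ c)) where
  φ f n p := (day (day M N) P).act ((α_ _ _ _).hom ≫ w ◁ f) (tm (tm m n) p)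
  add₁ f g m n := by rw [MonoidalPreadditive.whiskerLeft_add, Preadditive.comp_add, act_add]
  add₂ f m m' n := by rw [tm_add, add_tm, map_add]
  add₃ f m n n' := by rw [tm_add, map_add]
  smul₁ r f m n := by rw [MonoidalLinear.whiskerLeft_smul, Linear.comp_smul, act_smul]
  smul₂ r f m n := by rw [tm_smul, smul_tm, map_smul]
  smul₃ r f m n := by rw [tm_smul, map_smul]
  nat a b f m n := by
    rw [tm_natR, tm_natR, tm_natL, act_act, act_act]
    refine act_congr _ ?_ _
    rw [MonoidalCategory.tensorHom_def]
    simp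

/-- Part of the inverse associativity of the Day convolution. -/
noncomputable def assocInvAux (N P : LinRep 𝕜 C) {M : LinRep 𝕜 C} {w : C} (m : M.El w) (c : C) :
    (day N P).El c →ₗ[𝕜] (day (day M N) P).El (w ⊗ c) := (assocInvFam N P m c).lift

theorem assocInvAux_act_tm {w : C} (m : M.El w) (f : u ⊗ v ⟶ c) (n : N.El u) (p : P.El v) :
    assocInvAux N P m c ((day N P).act f (tm n p)) =
      (day (day M N) P).act ((α_ _ _ _).hom ≫ w ◁ f) (tm (tm m n) p) := by
  rw [act_tm]
  exact Fam.lift_dcls (assocInvFam N P m c) f n p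

/-- Inverse associativity of the Day convolution. -/
noncomputable def assocInv (M N P : LinRep 𝕜 C) : day M (day N P) ⟶ day (day M N) P :=
  Bil.desc
    { φ := fun m x => assocInvAux N P m _ x
      add₃ := fun m m' n => map_add _ _ _
      add₂ := fun {u v} m m' x => by
        induction x using day_ind with
        | hp f n p =>
          rw [assocInvAux_act_tm, assocInvAux_act_tm, assocInvAux_act_tm, add_tm, add_tm, map_add]
        | ha x y hx hy => rw [map_add, hx, hy, map_add, map_add, add_add_add_comm]
      smul₃ := fun r m n => map_smul _ _ _
      smul₂ := fun {u v} r m x => by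
        induction x using day_ind with
        | hp f n p => rw [assocInvAux_act_tm, assocInvAux_act_tm, smul_tm, smul_tm, map_smul]
        | ha x y hx hy => rw [map_add, hx, hy, map_add, smul_add]
      natR := fun a m x => by
        induction x using day_ind with
        | hp f n p => rw [act_act, assocInvAux_act_tm, assocInvAux_act_tm, act_act,
            MonoidalCategory.whiskerLeft_comp, Category.assoc]
        | ha x y hx hy => rw [map_add, map_add, hx, hy, map_add, map_add]
      natL := fun {u v v'} b m x => by
        induction x using day_ind with
        | hp f n p =>
          rw [assocInvAux_act_tm, assocInvAux_act_tm, tm_natL, tm_natL, act_act, act_act]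
          refine act_congr _ ?_ _
          simp [whisker_exchange]
        | ha x y hx hy => rw [map_add, hx, hy, map_add, map_add] }

theorem assocInv_tm {w : C} (m : M.El u) (n : N.El v) (p : P.El w) :
    ap (assocInv M N P) _ (tm m (tm n p)) =
      (day (day M N) P).act (α_ _ _ _).hom (tm (tm m n) p) := by
  refine (Bil.desc_tm _ _ _).trans ?_
  have := assocInvAux_act_tm m (𝟙 (v ⊗ w)) n p
  rwa [act_id, whiskerLeft_id, Category.comp_id] at this

/-- The Day convolution associator. -/
noncomputable def assocIso (M N P : LinRep 𝕜 C) : day (day M N) P ≅ day M (day N P) where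
  hom := assocHom M N P
  inv := assocInv M N P
  hom_inv_id := day_ext₃ fun m n p => by
    rw [ap_comp, assocHom_tm, ap_act, assocInv_tm, act_act, Iso.hom_inv_id, act_id, ap_id]
  inv_hom_id := day_ext₃' fun m n p => by
    rw [ap_comp, assocInv_tm, ap_act, assocHom_tm, act_act, Iso.inv_hom_id, act_id, ap_id]

/-- The unit of the Day convolution. -/
abbrev dayUnit : LinRep 𝕜 C := corep (𝟙_ C)

/-- An element of the unit, as a morphism. -/
def uel (s : (dayUnit (𝕜 := 𝕜) (C := C)).El u) : 𝟙_ C ⟶ u := s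

/-- The universal element of the unit. -/
def uone : (dayUnit (𝕜 := 𝕜) (C := C)).El (𝟙_ C) := 𝟙 (𝟙_ C)

theorem uel_uone : uel (uone (𝕜 := 𝕜) (C := C)) = 𝟙 _ := rfl

theorem uel_add (s s' : (dayUnit (𝕜 := 𝕜) (C := C)).El u) : uel (s + s') = uel s + uel s' := rfl

theorem uel_smul (r : 𝕜) (s : (dayUnit (𝕜 := 𝕜) (C := C)).El u) : uel (r • s) = r • uel s := rfl

theorem uel_act (f : u ⟶ v) (s : (dayUnit (𝕜 := 𝕜) (C := C)).El u) :
    uel (dayUnit.act f s) = uel s ≫ f := rfl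

theorem act_uone (s : (dayUnit (𝕜 := 𝕜) (C := C)).El u) : dayUnit.act (uel s) uone = s :=
  Category.id_comp (uel s)

/-- Left unitality of the Day convolution. -/
noncomputable def leftHom (M : LinRep 𝕜 C) : day (dayUnit (𝕜 := 𝕜) (C := C)) M ⟶ M :=
  Bil.desc
    { φ := fun {u v} s m => M.act ((λ_ v).inv ≫ uel s ▷ v) m
      add₂ := fun s s' n => by
        rw [uel_add, MonoidalPreadditive.add_whiskerRight, Preadditive.comp_add, act_add]
      add₃ := fun s n n' => map_add _ _ _
      smul₂ := fun r s n => by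
        rw [uel_smul, MonoidalLinear.smul_whiskerRight, Linear.comp_smul, act_smul]
      smul₃ := fun r s n => map_smul _ _ _
      natL := fun a s n => by
        rw [uel_act, act_act, comp_whiskerRight, Category.assoc]
      natR := fun b s n => by
        rw [act_act, act_act]
        refine act_congr _ ?_ _
        rw [Category.assoc, ← whisker_exchange, leftUnitor_inv_naturality_assoc] }

theorem leftHom_tm (s : (dayUnit (𝕜 := 𝕜) (C := C)).El u) (m : M.El v) :
    ap (leftHom M) _ (tm s m) = M.act ((λ_ v).inv ≫ uel s ▷ v) m :=
  Bil.desc_tm _ _ _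

/-- Inverse left unitality of the Day convolution. -/
noncomputable def leftInv (M : LinRep 𝕜 C) : M ⟶ day (dayUnit (𝕜 := 𝕜) (C := C)) M :=
  homMk' (fun c =>
    { toFun := fun m => (day dayUnit M).act (λ_ c).hom (tm uone m)
      map_add' := fun m m' => by rw [tm_add, map_add]
      map_smul' := fun r m => by rw [tm_smul, map_smul]; rfl })
    (fun f m => by
      change (day dayUnit M).act _ (tm _ _) = (day dayUnit M).act _ ((day dayUnit M).act _ (tm _ _))
      rw [tm_natR, act_act, act_act, leftUnitor_naturality])

theorem leftInv_ap (m : M.El c) :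
    ap (leftInv M) c m = (day dayUnit M).act (λ_ c).hom (tm uone m) := rfl

/-- The left unitor of the Day convolution. -/
noncomputable def leftIso (M : LinRep 𝕜 C) : day (dayUnit (𝕜 := 𝕜) (C := C)) M ≅ M where
  hom := leftHom M
  inv := leftInv M
  hom_inv_id := day_ext fun {u v} s m => by
    rw [ap_comp, leftHom_tm, ap_act, leftInv_ap, act_act, ap_id]
    conv_rhs => rw [← act_uone s]
    rw [tm_natL]
    refine act_congr _ ?_ _
    simp
  inv_hom_id := hom_ext' fun c m => by
    rw [ap_comp, leftInv_ap, ap_act, leftHom_tm, act_act, uel_uone]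
    simp

/-- Right unitality of the Day convolution. -/
noncomputable def rightHom (M : LinRep 𝕜 C) : day M (dayUnit (𝕜 := 𝕜) (C := C)) ⟶ M :=
  Bil.desc
    { φ := fun {u v} m s => M.act ((ρ_ u).inv ≫ u ◁ uel s) m
      add₃ := fun n s s' => by
        rw [uel_add, MonoidalPreadditive.whiskerLeft_add, Preadditive.comp_add, act_add]
      add₂ := fun s n n' => map_add _ _ _
      smul₃ := fun r n s => by
        rw [uel_smul, MonoidalLinear.whiskerLeft_smul, Linear.comp_smul, act_smul]
      smul₂ := fun r s n => map_smul _ _ _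
      natR := fun a n s => by
        rw [uel_act, act_act, MonoidalCategory.whiskerLeft_comp, Category.assoc]
      natL := fun b n s => by
        rw [act_act, act_act]
        refine act_congr _ ?_ _
        rw [Category.assoc, whisker_exchange, rightUnitor_inv_naturality_assoc] }

theorem rightHom_tm (s : (dayUnit (𝕜 := 𝕜) (C := C)).El v) (m : M.El u) :
    ap (rightHom M) _ (tm m s) = M.act ((ρ_ u).inv ≫ u ◁ uel s) m :=
  Bil.desc_tm _ _ _

/-- Inverse right unitality of the Day convolution. -/
noncomputable def rightInv (M : LinRep 𝕜 C) : M ⟶ day M (dayUnit (𝕜 := 𝕜) (C := C)) :=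
  homMk' (fun c =>
    { toFun := fun m => (day M dayUnit).act (ρ_ c).hom (tm m uone)
      map_add' := fun m m' => by rw [add_tm, map_add]
      map_smul' := fun r m => by rw [smul_tm, map_smul]; rfl })
    (fun f m => by
      change (day M dayUnit).act _ (tm _ _) = (day M dayUnit).act _ ((day M dayUnit).act _ (tm _ _))
      rw [tm_natL, act_act, act_act, rightUnitor_naturality])

theorem rightInv_ap (m : M.El c) :
    ap (rightInv M) c m = (day M dayUnit).act (ρ_ c).hom (tm m uone) := rfl

/-- The right unitor of the Day convolution. -/
noncomputable def rightIso (M : LinRep 𝕜 C) : day M (dayUnit (𝕜 := 𝕜) (C := C)) ≅ M where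
  hom := rightHom M
  inv := rightInv M
  hom_inv_id := day_ext fun {u v} m s => by
    rw [ap_comp, rightHom_tm, ap_act, rightInv_ap, act_act, ap_id]
    conv_rhs => rw [← act_uone s]
    rw [tm_natR]
    refine act_congr _ ?_ _
    simp
  inv_hom_id := hom_ext' fun c m => by
    rw [ap_comp, rightInv_ap, ap_act, rightHom_tm, act_act, uel_uone]
    simp

noncomputable instance : MonoidalCategoryStruct (LinRep 𝕜 C) where
  tensorObj := day
  tensorUnit := dayUnit
  tensorHom := dayHom
  whiskerLeft X _ _ f := dayHom (𝟙 X) f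
  whiskerRight f Y := dayHom f (𝟙 Y)
  associator := assocIso
  leftUnitor := leftIso
  rightUnitor := rightIso

noncomputable instance : MonoidalCategory (LinRep 𝕜 C) := MonoidalCategory.ofTensorHom
  (id_tensorHom_id := fun X₁ X₂ => day_ext fun m n => dayHom_tm _ _ m n)
  (id_tensorHom := fun _ _ _ _ => rfl)
  (tensorHom_id := fun _ _ => rfl)
  (tensorHom_comp_tensorHom := fun f₁ f₂ g₁ g₂ => day_ext fun m n => by
    refine (congrArg (ap (dayHom g₁ g₂) _) (dayHom_tm f₁ f₂ m n)).trans ?_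
    exact (dayHom_tm _ _ _ _).trans (dayHom_tm (f₁ ≫ g₁) (f₂ ≫ g₂) m n).symm)
  (associator_naturality := fun f₁ f₂ f₃ => day_ext₃ fun m n p => by
    change ap (assocHom _ _ _) _ (ap (dayHom (dayHom f₁ f₂) f₃) _ _) =
      ap (dayHom f₁ (dayHom f₂ f₃)) _ (ap (assocHom _ _ _) _ _)
    rw [dayHom_tm, dayHom_tm, assocHom_tm, assocHom_tm, ap_act, dayHom_tm, dayHom_tm])
  (leftUnitor_naturality := fun f => day_ext fun s m => by
    change ap (leftHom _) _ (ap (dayHom (𝟙 _) f) _ _) = ap f _ (ap (leftHom _) _ _)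
    rw [dayHom_tm, leftHom_tm, ap_id, leftHom_tm, ap_act])
  (rightUnitor_naturality := fun f => day_ext fun m s => by
    change ap (rightHom _) _ (ap (dayHom f (𝟙 _)) _ _) = ap f _ (ap (rightHom _) _ _)
    rw [dayHom_tm, rightHom_tm, ap_id, rightHom_tm, ap_act])
  (pentagon := fun W X Y Z => day_ext₄ fun m n p q => by
    change ap (dayHom (𝟙 _) (assocHom _ _ _)) _ (ap (assocHom _ _ _) _
      (ap (dayHom (assocHom _ _ _) (𝟙 _)) _ _)) = ap (assocHom _ _ _) _ (ap (assocHom _ _ _) _ _)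
    rw [dayHom_tm, assocHom_tm, ap_id, tm_natL, ap_act, assocHom_tm, act_act, ap_act, dayHom_tm,
      assocHom_tm, ap_id, tm_natR, act_act, assocHom_tm, ap_act, assocHom_tm, act_act]
    refine act_congr _ ?_ _
    simp)
  (triangle := fun X Y => day_ext₃ fun m s n => by
    change ap (dayHom (𝟙 _) (leftHom _)) _ (ap (assocHom _ _ _) _ _) =
      ap (dayHom (rightHom _) (𝟙 _)) _ _
    rw [dayHom_tm, assocHom_tm, ap_act, dayHom_tm, leftHom_tm, rightHom_tm, ap_id, ap_id, tm_natL,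
      tm_natR, act_act]
    refine act_congr _ ?_ _
    simp)

theorem tensorHom_tm {M N M' N' : LinRep 𝕜 C} (f : M ⟶ M') (g : N ⟶ N') (m : M.El u) (n : N.El v) :
    ap (f ⊗ₘ g) (u ⊗ v) (tm m n : (day M N).El (u ⊗ v)) = tm (ap f _ m) (ap g _ n) :=
  dayHom_tm f g m n

instance : MonoidalPreadditive (LinRep 𝕜 C) where
  whiskerLeft_zero {X Y Z} := day_ext fun m n => by
    refine (dayHom_tm _ _ _ _).trans ?_
    refine Eq.trans ?_ (zero_smul 𝕜 (tm (ap (𝟙 X) _ m) (0 : Z.El _)))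
    rw [← tm_smul, smul_zero]
    rfl
  zero_whiskerRight {X Y Z} := day_ext fun m n => by
    refine (dayHom_tm _ _ _ _).trans ?_
    refine Eq.trans ?_ (zero_smul 𝕜 (tm (0 : Z.El _) (ap (𝟙 X) _ n)))
    rw [← smul_tm, smul_zero]
    rfl
  whiskerLeft_add f g := day_ext fun m n => by
    refine (dayHom_tm _ _ _ _).trans ((tm_add _ _ _).trans ?_)
    exact (congrArg₂ (fun a b => a + b) (dayHom_tm _ _ _ _) (dayHom_tm _ _ _ _)).symm
  add_whiskerRight f g := day_ext fun m n => by
    refine (dayHom_tm _ _ _ _).trans ((add_tm _ _ _).trans ?_)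
    exact (congrArg₂ (fun a b => a + b) (dayHom_tm _ _ _ _) (dayHom_tm _ _ _ _)).symm

instance : MonoidalLinear 𝕜 (LinRep 𝕜 C) where
  whiskerLeft_smul X _ _ r f := day_ext fun m n => by
    refine (dayHom_tm _ _ _ _).trans ((tm_smul _ _ _).trans ?_)
    exact (congrArg (fun a => r • a) (dayHom_tm _ _ _ _)).symm
  smul_whiskerRight r _ _ f X := day_ext fun m n => by
    refine (dayHom_tm _ _ _ _).trans ((smul_tm _ _ _).trans ?_)
    exact (congrArg (fun a => r • a) (dayHom_tm _ _ _ _)).symm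

variable [SymmetricCategory C]

/-- Symmetry of the Day convolution. -/
noncomputable def braidHom (M N : LinRep 𝕜 C) : day M N ⟶ day N M :=
  Bil.desc
    { φ := fun {u v} m n => (day N M).act (β_ v u).hom (tm n m)
      add₂ := fun m m' n => by rw [tm_add, map_add]
      add₃ := fun m n n' => by rw [add_tm, map_add]
      smul₂ := fun r m n => by rw [tm_smul, map_smul]
      smul₃ := fun r m n => by rw [smul_tm, map_smul]
      natL := fun a m n => by
        rw [tm_natR, act_act, act_act, BraidedCategory.braiding_naturality_right]
      natR := fun a m n => by
        rw [tm_natL, act_act, act_act, BraidedCategory.braiding_naturality_left] }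

theorem braidHom_tm (m : M.El u) (n : N.El v) :
    ap (braidHom M N) _ (tm m n) = (day N M).act (β_ v u).hom (tm n m) :=
  Bil.desc_tm _ _ _

theorem braidHom_braidHom (M N : LinRep 𝕜 C) : braidHom M N ≫ braidHom N M = 𝟙 _ :=
  day_ext fun m n => by
    rw [ap_comp, braidHom_tm, ap_act, braidHom_tm, act_act, SymmetricCategory.symmetry, act_id,
      ap_id]

noncomputable instance : SymmetricCategory (LinRep 𝕜 C) where
  braiding M N := ⟨braidHom M N, braidHom N M, braidHom_braidHom _ _, braidHom_braidHom _ _⟩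
  braiding_naturality_right X Y Z f := day_ext fun m n => by
    change ap (braidHom _ _) _ (ap (dayHom (𝟙 _) f) _ _) =
      ap (dayHom f (𝟙 _)) _ (ap (braidHom _ _) _ _)
    rw [dayHom_tm, braidHom_tm, braidHom_tm, ap_act, dayHom_tm]
  braiding_naturality_left f Z := day_ext fun m n => by
    change ap (braidHom _ _) _ (ap (dayHom f (𝟙 _)) _ _) =
      ap (dayHom (𝟙 _) f) _ (ap (braidHom _ _) _ _)
    rw [dayHom_tm, braidHom_tm, braidHom_tm, ap_act, dayHom_tm]
  hexagon_forward X Y Z := day_ext₃ fun m n p => by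
    change ap (assocHom _ _ _) _ (ap (braidHom _ _) _ (ap (assocHom _ _ _) _ _)) =
      ap (dayHom (𝟙 _) (braidHom _ _)) _ (ap (assocHom _ _ _) _
        (ap (dayHom (braidHom _ _) (𝟙 _)) _ _))
    rw [dayHom_tm, assocHom_tm, ap_act, braidHom_tm, act_act, ap_act, assocHom_tm, act_act,
      braidHom_tm, tm_natL, ap_act, ap_id, assocHom_tm, act_act, ap_act, dayHom_tm, braidHom_tm,
      tm_natR, ap_id, act_act]
    refine act_congr _ ?_ _
    simp
  hexagon_reverse X Y Z := day_ext₃' fun m n p => by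
    change ap (assocInv _ _ _) _ (ap (braidHom _ _) _ (ap (assocInv _ _ _) _ _)) =
      ap (dayHom (braidHom _ _) (𝟙 _)) _ (ap (assocInv _ _ _) _
        (ap (dayHom (𝟙 _) (braidHom _ _)) _ _))
    rw [dayHom_tm, assocInv_tm, ap_act, braidHom_tm, act_act, ap_act, assocInv_tm, act_act,
      braidHom_tm, tm_natR, ap_act, ap_id, assocInv_tm, act_act, ap_act, dayHom_tm, braidHom_tm,
      tm_natL, ap_id, act_act]
    refine act_congr _ ?_ _
    simp
  symmetry M N := braidHom_braidHom M N

end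

end LinRep

namespace LinRep

variable {𝕜 : Type w} [CommRing 𝕜] {C : Type u₁} [Category.{max w u₁} C] [Preadditive C]
  [Linear 𝕜 C] {M N P : LinRep 𝕜 C}

/-- The differences of two morphisms. -/
abbrev cqSub (f g : M ⟶ N) (c : C) : Submodule 𝕜 (N.El c) := LinearMap.range (ap f c - ap g c)

/-- The values of a coequalizer. -/
def CqObj (f g : M ⟶ N) (c : C) : Type (max w u₁) := N.El c ⧸ cqSub f g c

instance (f g : M ⟶ N) (c : C) : AddCommGroup (CqObj f g c) :=
  inferInstanceAs (AddCommGroup (N.El c ⧸ cqSub f g c))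

instance (f g : M ⟶ N) (c : C) : Module 𝕜 (CqObj f g c) :=
  inferInstanceAs (Module 𝕜 (N.El c ⧸ cqSub f g c))

/-- The projection to a coequalizer. -/
def cqMk (f g : M ⟶ N) (c : C) : N.El c →ₗ[𝕜] CqObj f g c := (cqSub f g c).mkQ

theorem cqMk_surj (f g : M ⟶ N) (c : C) : Function.Surjective (cqMk f g c) :=
  Submodule.mkQ_surjective _

theorem cqMk_eq (f g : M ⟶ N) (c : C) (x : M.El c) : cqMk f g c (ap f c x) = cqMk f g c (ap g c x) :=
  (Submodule.Quotient.eq _).2 ⟨x, rfl⟩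

/-- The universal property of a coequalizer, at one value. -/
def cqLift (f g : M ⟶ N) (c : C) {V : Type (max w u₁)} [AddCommGroup V] [Module 𝕜 V]
    (k : N.El c →ₗ[𝕜] V) (h : ∀ x, k (ap f c x) = k (ap g c x)) : CqObj f g c →ₗ[𝕜] V :=
  Submodule.liftQ _ k (by
    rintro _ ⟨x, rfl⟩
    rw [LinearMap.mem_ker, LinearMap.sub_apply, map_sub, h, sub_self])

theorem cqLift_mk (f g : M ⟶ N) (c : C) {V : Type (max w u₁)} [AddCommGroup V] [Module 𝕜 V]
    (k : N.El c →ₗ[𝕜] V) (h : ∀ x, k (ap f c x) = k (ap g c x)) (y : N.El c) :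
    cqLift f g c k h (cqMk f g c y) = k y := rfl

/-- The functoriality of the values of a coequalizer. -/
def cqMap (f g : M ⟶ N) {c d : C} (a : c ⟶ d) : CqObj f g c →ₗ[𝕜] CqObj f g d :=
  cqLift f g c ((cqMk f g d).comp (N.act a)) (fun x => by
    rw [LinearMap.comp_apply, LinearMap.comp_apply, ← ap_act, ← ap_act, cqMk_eq])

theorem cqMap_mk (f g : M ⟶ N) {c d : C} (a : c ⟶ d) (y : N.El c) :
    cqMap f g a (cqMk f g c y) = cqMk f g d (N.act a y) := rfl

/-- A coequalizer. -/
def cq (f g : M ⟶ N) : LinRep 𝕜 C :=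
  ofData (CqObj f g) (fun a => cqMap f g a)
    (fun c x => by
      obtain ⟨y, rfl⟩ := cqMk_surj f g c x
      rw [cqMap_mk, act_id])
    (fun {c d e} a b x => by
      obtain ⟨y, rfl⟩ := cqMk_surj f g c x
      rw [cqMap_mk, cqMap_mk, cqMap_mk, act_act])
    (fun {c d} a b x => by
      obtain ⟨y, rfl⟩ := cqMk_surj f g c x
      rw [cqMap_mk, cqMap_mk, cqMap_mk, act_add, map_add])
    (fun {c d} r a x => by
      obtain ⟨y, rfl⟩ := cqMk_surj f g c x
      rw [cqMap_mk, cqMap_mk, act_smul, map_smul])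

/-- The projection to a coequalizer. -/
def cqPi (f g : M ⟶ N) : N ⟶ cq f g := homMk' (cqMk f g) (fun _ _ => rfl)

theorem cqPi_surj (f g : M ⟶ N) (c : C) : Function.Surjective (ap (cqPi f g) c) := cqMk_surj f g c

theorem cqPi_eq (f g : M ⟶ N) : f ≫ cqPi f g = g ≫ cqPi f g :=
  hom_ext' fun c x => cqMk_eq f g c x

/-- The universal property of a coequalizer. -/
def cqDesc (f g : M ⟶ N) (k : N ⟶ P) (h : f ≫ k = g ≫ k) : cq f g ⟶ P :=
  homMk' (fun c => cqLift f g c (ap k c) (fun x => congrArg (fun t => ap t c x) h))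
    (fun {c d} a x => by
      obtain ⟨y, rfl⟩ := cqMk_surj f g c x
      exact ap_act k a y)

theorem cqPi_desc (f g : M ⟶ N) (k : N ⟶ P) (h : f ≫ k = g ≫ k) : cqPi f g ≫ cqDesc f g k h = k :=
  rfl

theorem cq_ext (f g : M ⟶ N) {φ ψ : cq f g ⟶ P} (h : cqPi f g ≫ φ = cqPi f g ≫ ψ) : φ = ψ :=
  hom_ext' fun c x => by
    obtain ⟨y, rfl⟩ := cqPi_surj f g c x
    exact congrArg (fun t => ap t c y) h

/-- The universal property of a coequalizer. -/
def cqIsColimit (f g : M ⟶ N) : IsColimit (Cofork.ofπ (cqPi f g) (cqPi_eq f g)) :=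
  Cofork.IsColimit.mk _ (fun s => cqDesc f g s.π s.condition) (fun _ => rfl)
    (fun _ _ h => cq_ext f g h)

instance : HasCoequalizers (LinRep 𝕜 C) := by
  have : ∀ {X Y : LinRep 𝕜 C} {f g : X ⟶ Y}, HasColimit (parallelPair f g) :=
    fun {X Y f g} => HasColimit.mk ⟨_, cqIsColimit f g⟩
  exact hasCoequalizers_of_hasColimit_parallelPair _

variable [MonoidalCategory C] [MonoidalPreadditive C] [MonoidalLinear 𝕜 C]

/-- An element of the first factor, as a family of linear maps. -/
noncomputable def tmL {X : LinRep 𝕜 C} (N : LinRep 𝕜 C) {u : C} (x : X.El u) (v : C) :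
    N.El v →ₗ[𝕜] (day X N).El (u ⊗ v) where
  toFun n := tm x n
  map_add' := tm_add x
  map_smul' r n := tm_smul r x n

/-- Part of the universal property of a coequalizer tensored with `X`. -/
noncomputable def cqTen (X : LinRep 𝕜 C) (f g : M ⟶ N) (k : day X N ⟶ P)
    (h : X ◁ f ≫ k = X ◁ g ≫ k) {u : C} (x : X.El u) (v : C) : CqObj f g v →ₗ[𝕜] P.El (u ⊗ v) :=
  cqLift f g v ((ap k _).comp (tmL N x v)) (fun m => by
    have h' := congrArg (fun t => ap t (u ⊗ v) (tm x m)) h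
    have e (f : M ⟶ N) : ap (X ◁ f) (u ⊗ v) (tm x m) = tm x (ap f v m) := dayHom_tm (𝟙 X) f x m
    have h'' : ap k (u ⊗ v) (ap (X ◁ f) (u ⊗ v) (tm x m)) =
      ap k (u ⊗ v) (ap (X ◁ g) (u ⊗ v) (tm x m)) := h'
    rw [e, e] at h''
    exact h'')

theorem cqTen_mk (X : LinRep 𝕜 C) (f g : M ⟶ N) (k : day X N ⟶ P)
    (h : X ◁ f ≫ k = X ◁ g ≫ k) {u : C} (x : X.El u) (v : C) (n : N.El v) :
    cqTen X f g k h x v (cqMk f g v n) = ap k _ (tm x n) := rfl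

/-- The universal property of a coequalizer tensored with `X`. -/
noncomputable def cqTenDesc (X : LinRep 𝕜 C) (f g : M ⟶ N) (k : day X N ⟶ P)
    (h : X ◁ f ≫ k = X ◁ g ≫ k) : day X (cq f g) ⟶ P :=
  Bil.desc
    { φ := fun x q => cqTen X f g k h x _ q
      add₂ := fun x x' q => by
        obtain ⟨n, rfl⟩ := cqMk_surj f g _ q
        rw [cqTen_mk, cqTen_mk, cqTen_mk, add_tm, map_add]
      add₃ := fun x q q' => map_add _ _ _
      smul₂ := fun r x q => by
        obtain ⟨n, rfl⟩ := cqMk_surj f g _ q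
        rw [cqTen_mk, cqTen_mk, smul_tm, map_smul]
      smul₃ := fun r x q => map_smul _ _ _
      natL := fun a x q => by
        obtain ⟨n, rfl⟩ := cqMk_surj f g _ q
        rw [cqTen_mk, cqTen_mk, tm_natL, ap_act]
      natR := fun {u v v'} b x q => by
        obtain ⟨n, rfl⟩ := cqMk_surj f g _ q
        have e : (cq f g).act b (cqMk f g v n) = cqMk f g v' (N.act b n) := rfl
        rw [e, cqTen_mk, cqTen_mk, tm_natR, ap_act] }

theorem ten_desc (X : LinRep 𝕜 C) (f g : M ⟶ N) (k : day X N ⟶ P)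
    (h : X ◁ f ≫ k = X ◁ g ≫ k) : X ◁ cqPi f g ≫ cqTenDesc X f g k h = k :=
  day_ext fun x n => by
    have e : ap (X ◁ cqPi f g) _ (tm x n) = tm x (cqMk f g _ n) := dayHom_tm (𝟙 X) (cqPi f g) x n
    refine (congrArg (ap (cqTenDesc X f g k h) _) e).trans ?_
    exact Bil.desc_tm _ _ _

theorem ten_ext (X : LinRep 𝕜 C) (f g : M ⟶ N) {φ ψ : day X (cq f g) ⟶ P}
    (h : X ◁ cqPi f g ≫ φ = X ◁ cqPi f g ≫ ψ) : φ = ψ :=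
  day_ext fun {u v} x q => by
    obtain ⟨n, rfl⟩ := cqMk_surj f g _ q
    have e : ap (X ◁ cqPi f g) (u ⊗ v) (tm x n) = tm x (cqMk f g v n) :=
      dayHom_tm (𝟙 X) (cqPi f g) x n
    have h' : ap φ (u ⊗ v) (ap (X ◁ cqPi f g) (u ⊗ v) (tm x n)) =
      ap ψ (u ⊗ v) (ap (X ◁ cqPi f g) (u ⊗ v) (tm x n)) :=
      congrArg (fun t => ap t (u ⊗ v) (tm x n)) h
    rw [e] at h'
    exact h'

instance (X : LinRep 𝕜 C) : PreservesColimitsOfShape WalkingParallelPair (tensorLeft X) where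
  preservesColimit {K} := by
    have h (M N : LinRep 𝕜 C) (f g : M ⟶ N) : PreservesColimit (parallelPair f g) (tensorLeft X) := by
      refine preservesColimit_of_preserves_colimit_cocone (cqIsColimit f g) ?_
      refine (isColimitMapCoconeCoforkEquiv (tensorLeft X) (cqPi_eq f g)).symm ?_
      exact Cofork.IsColimit.mk _ (fun s => cqTenDesc X f g s.π s.condition)
        (fun s => ten_desc X f g s.π s.condition)
        (fun s _ h => ten_ext X f g (h.trans (ten_desc X f g s.π s.condition).symm))
    have := h _ _ (K.map WalkingParallelPairHom.left) (K.map WalkingParallelPairHom.right)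
    exact preservesColimit_of_iso_diagram _ (diagramIsoParallelPair K).symm

end LinRep

namespace ModTensor

open scoped MonoidalLeftAction MonObj

variable {D : Type u} [Category.{v} D] [MonoidalCategory D] {A : D} [MonObj A]

/-- The action `A ⊗ M ⟶ M` of a module. -/
abbrev sm (M : Mod D A) : A ⊗ M.X ⟶ M.X := ModObj.smul (M := A) (X := M.X)

theorem one_sm (M : Mod D A) : η[A] ▷ M.X ≫ sm M = (λ_ M.X).hom := ModObj.one_smul_self A M.X

theorem mul_sm (M : Mod D A) : μ[A] ▷ M.X ≫ sm M = (α_ A A M.X).hom ≫ A ◁ sm M ≫ sm M :=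
  ModObj.mul_smul_self A M.X

theorem sm_hom {M N : Mod D A} (f : M ⟶ N) : sm M ≫ f.hom = A ◁ f.hom ≫ sm N :=
  f.isModHom.smul_hom

/-- A module from its action. -/
def mk (X : D) (a : A ⊗ X ⟶ X) (h₁ : η[A] ▷ X ≫ a = (λ_ X).hom)
    (h₂ : μ[A] ▷ X ≫ a = (α_ A A X).hom ≫ A ◁ a ≫ a) : Mod D A :=
  { X := X
    mod := { smul := a
             one_smul := h₁
             mul_smul := h₂ } }

/-- A morphism of modules from an equivariant morphism. -/
def homMk {M N : Mod D A} (f : M.X ⟶ N.X) (h : sm M ≫ f = A ◁ f ≫ sm N) : M ⟶ N :=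
  Mod.Hom.mk' f h

@[simp]
theorem homMk_hom {M N : Mod D A} (f : M.X ⟶ N.X) (h : sm M ≫ f = A ◁ f ≫ sm N) :
    (homMk f h).hom = f := rfl

/-- An isomorphism of modules from an equivariant isomorphism. -/
def isoMk {M N : Mod D A} (f : M.X ≅ N.X) (h : sm M ≫ f.hom = A ◁ f.hom ≫ sm N) : M ≅ N where
  hom := homMk f.hom h
  inv := homMk f.inv (by
    rw [← cancel_epi (A ◁ f.hom), ← MonoidalCategory.whiskerLeft_comp_assoc, Iso.hom_inv_id,
      whiskerLeft_id, Category.id_comp, ← reassoc_of% h, Iso.hom_inv_id, Category.comp_id])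
  hom_inv_id := Mod.hom_ext _ _ f.hom_inv_id
  inv_hom_id := Mod.hom_ext _ _ f.inv_hom_id

variable (A) in
/-- The monoid as a module over itself. -/
def unit : Mod D A := mk A μ[A] (MonObj.one_mul A) (MonObj.mul_assoc A)

variable [SymmetricCategory D]

/-- The action of `A` on the left factor of a tensor product. -/
def aL (M : Mod D A) (Y : D) : A ⊗ (M.X ⊗ Y) ⟶ M.X ⊗ Y := (α_ _ _ _).inv ≫ sm M ▷ Y

/-- The action of `A` on the right factor of a tensor product. -/
def aR (X : D) (N : Mod D A) : A ⊗ (X ⊗ N.X) ⟶ X ⊗ N.X :=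
  (α_ _ _ _).inv ≫ (β_ A X).hom ▷ N.X ≫ (α_ _ _ _).hom ≫ X ◁ sm N

/-- The action of `A` on the right factor of a tensor product, for an action `a` on this factor. -/
def aR' (X : D) {Y : D} (a : A ⊗ Y ⟶ Y) : A ⊗ (X ⊗ Y) ⟶ X ⊗ Y :=
  (α_ _ _ _).inv ≫ (β_ A X).hom ▷ Y ≫ (α_ _ _ _).hom ≫ X ◁ a

/-- The exchange of two copies of `A`. -/
def sw (A X : D) : A ⊗ (A ⊗ X) ⟶ A ⊗ (A ⊗ X) :=
  (α_ _ _ _).inv ≫ (β_ A A).hom ▷ X ≫ (α_ _ _ _).hom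

theorem sw_sm [IsCommMonObj A] (M : Mod D A) :
    sw A M.X ≫ A ◁ sm M ≫ sm M = A ◁ sm M ≫ sm M := by
  have h := mul_sm M
  rw [sw, Category.assoc, Category.assoc, ← h, ← comp_whiskerRight_assoc, IsCommMonObj.mul_comm, h,
    Iso.inv_hom_id_assoc]

/-- The left action makes a tensor product a module. -/
def modL (M : Mod D A) (Y : D) : Mod D A :=
  mk (M.X ⊗ Y) (aL M Y)
    (by
      rw [aL, associator_inv_naturality_left_assoc, ← comp_whiskerRight, one_sm]
      simp)
    (by
      rw [aL, associator_inv_naturality_left_assoc, ← comp_whiskerRight, mul_sm]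
      simp)

theorem aL_mul [IsCommMonObj A] (M : Mod D A) (Y : D) :
    sw A (M.X ⊗ Y) ≫ A ◁ aL M Y ≫ aL M Y = A ◁ aL M Y ≫ aL M Y := sw_sm (modL M Y)

theorem aL_aR (M N : Mod D A) :
    A ◁ aR M.X N ≫ aL M N.X = sw A (M.X ⊗ N.X) ≫ A ◁ aL M N.X ≫ aR M.X N := by
  have e : A ◁ (M.X ◁ sm N) ≫ (α_ A M.X N.X).inv ≫ sm M ▷ N.X =
      (α_ _ _ _).inv ≫ sm M ▷ (A ⊗ N.X) ≫ M.X ◁ sm N := by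
    rw [← whisker_exchange, associator_inv_naturality_right_assoc]
  have e' : A ◁ (sm M ▷ N.X) ≫ (α_ A M.X N.X).inv ≫ (β_ A M.X).hom ▷ N.X =
      (α_ _ _ _).inv ≫ (β_ A (A ⊗ M.X)).hom ▷ N.X ≫ (sm M ▷ A) ▷ N.X := by
    rw [← comp_whiskerRight, ← BraidedCategory.braiding_naturality_right, comp_whiskerRight,
      associator_inv_naturality_middle_assoc]
  rw [aR, aL, sw]
  simp only [MonoidalCategory.whiskerLeft_comp, Category.assoc]
  rw [e, reassoc_of% e']
  rw [associator_naturality_left_assoc, ← Category.assoc, ← Category.assoc]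
  simp only [← Category.assoc]
  congr 2
  rw [BraidedCategory.braiding_tensor_right_hom]
  have h : (β_ A A).hom ≫ (β_ A A).hom = 𝟙 _ := SymmetricCategory.symmetry _ _
  have h' : (β_ A A).hom ▷ M.X ▷ N.X ≫ (β_ A A).hom ▷ M.X ▷ N.X = 𝟙 _ := by
    rw [← comp_whiskerRight, ← comp_whiskerRight, h, id_whiskerRight, id_whiskerRight]
  simp
  simp [reassoc_of% h']

/-- The first of the two maps defining the tensor product over `A`: the action of `A` on `M`. -/
def bl (M N : Mod D A) : (M.X ⊗ A) ⊗ N.X ⟶ M.X ⊗ N.X := ((β_ M.X A).hom ≫ sm M) ▷ N.X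

/-- The second of the two maps defining the tensor product over `A`: the action of `A` on `N`. -/
def br (M N : Mod D A) : (M.X ⊗ A) ⊗ N.X ⟶ M.X ⊗ N.X := (α_ _ _ _).hom ≫ M.X ◁ sm N

/-- The exchange of `M` and `A`. -/
def bs (M N : Mod D A) : A ⊗ (M.X ⊗ N.X) ⟶ (M.X ⊗ A) ⊗ N.X :=
  (α_ _ _ _).inv ≫ (β_ A M.X).hom ▷ N.X

theorem bs_bl (M N : Mod D A) : bs M N ≫ bl M N = aL M N.X := by
  rw [bs, bl, aL, Category.assoc, ← comp_whiskerRight, SymmetricCategory.symmetry_assoc]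

theorem bs_br (M N : Mod D A) : bs M N ≫ br M N = aR M.X N := by
  rw [bs, br, aR, Category.assoc]

theorem balanced_iff (M N : Mod D A) {Z : D} (f : M.X ⊗ N.X ⟶ Z) :
    bl M N ≫ f = br M N ≫ f ↔ aL M N.X ≫ f = aR M.X N ≫ f := by
  have : IsIso (bs M N) := by
    rw [bs]
    infer_instance
  rw [← cancel_epi (bs M N), ← Category.assoc, ← Category.assoc, bs_bl, bs_br]

theorem aL_nat {M M' : Mod D A} (f : M ⟶ M') {Y Y' : D} (g : Y ⟶ Y') :
    aL M Y ≫ (f.hom ⊗ₘ g) = A ◁ (f.hom ⊗ₘ g) ≫ aL M' Y' := by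
  rw [aL, aL, Category.assoc, MonoidalCategory.tensorHom_def, ← comp_whiskerRight_assoc, sm_hom,
    MonoidalCategory.whiskerLeft_comp_assoc, associator_inv_naturality_right_assoc, whisker_exchange]
  simp

theorem aL_natR (M : Mod D A) {Y Y' : D} (g : Y ⟶ Y') :
    aL M Y ≫ M.X ◁ g = A ◁ (M.X ◁ g) ≫ aL M Y' := by
  have := aL_nat (𝟙 M) g
  simpa using this

theorem aR'_nat {X X' Y Y' : D} (f : X ⟶ X') (g : Y ⟶ Y') {a : A ⊗ Y ⟶ Y} {b : A ⊗ Y' ⟶ Y'}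
    (h : a ≫ g = A ◁ g ≫ b) : aR' X a ≫ (f ⊗ₘ g) = A ◁ (f ⊗ₘ g) ≫ aR' X' b := by
  have h₁ : aR' X a ≫ X ◁ g = A ◁ (X ◁ g) ≫ aR' X b := by
    rw [aR', aR', Category.assoc, Category.assoc, Category.assoc,
      ← MonoidalCategory.whiskerLeft_comp, h, associator_inv_naturality_right_assoc,
      whisker_exchange_assoc]
    simp
  have h₂ : aR' X b ≫ f ▷ Y' = A ◁ (f ▷ Y') ≫ aR' X' b := by
    rw [aR', aR', Category.assoc, Category.assoc, Category.assoc,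
      associator_inv_naturality_middle_assoc, ← comp_whiskerRight_assoc,
      BraidedCategory.braiding_naturality_right, whisker_exchange]
    simp
  rw [tensorHom_def', reassoc_of% h₁, h₂, MonoidalCategory.whiskerLeft_comp_assoc]

theorem aR_nat {N N' : Mod D A} {X X' : D} (f : X ⟶ X') (g : N ⟶ N') :
    aR X N ≫ (f ⊗ₘ g.hom) = A ◁ (f ⊗ₘ g.hom) ≫ aR X' N' := aR'_nat f g.hom (sm_hom g)

theorem aR_natL {X X' : D} (f : X ⟶ X') (N : Mod D A) :
    aR X N ≫ f ▷ N.X = A ◁ (f ▷ N.X) ≫ aR X' N := by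
  have := aR_nat f (𝟙 N)
  simpa using this

theorem aR'_natR (X : D) {Y Y' : D} (g : Y ⟶ Y') {a : A ⊗ Y ⟶ Y} {b : A ⊗ Y' ⟶ Y'}
    (h : a ≫ g = A ◁ g ≫ b) : aR' X a ≫ X ◁ g = A ◁ (X ◁ g) ≫ aR' X b := by
  have := aR'_nat (𝟙 X) g h
  simpa using this

theorem aL_assoc (M N : Mod D A) (Y : D) :
    aL M N.X ▷ Y ≫ (α_ _ _ _).hom = (α_ _ _ _).hom ≫ A ◁ (α_ _ _ _).hom ≫ aL M (N.X ⊗ Y) := by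
  simp [aL]

theorem aM_assoc (X : D) (N : Mod D A) (Y : D) :
    aR X N ▷ Y ≫ (α_ _ _ _).hom = (α_ _ _ _).hom ≫ A ◁ (α_ _ _ _).hom ≫ aR' X (aL N Y) := by
  simp [aR, aR', aL]

theorem aR_assoc (X Y : D) (P : Mod D A) :
    aR (X ⊗ Y) P ≫ (α_ _ _ _).hom = A ◁ (α_ _ _ _).hom ≫ aR' X (aR Y P) := by
  simp [aR, aR']

theorem aL_braid (M : Mod D A) (Y : D) : aL M Y ≫ (β_ _ _).hom = A ◁ (β_ _ _).hom ≫ aR Y M := by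
  rw [aL, aR, Category.assoc, BraidedCategory.braiding_naturality_left,
    BraidedCategory.braiding_tensor_left_hom]
  simp

theorem aR_braid (X : D) (N : Mod D A) : aR X N ≫ (β_ _ _).hom = A ◁ (β_ _ _).hom ≫ aL N X := by
  rw [← cancel_epi (A ◁ (β_ _ _).hom), ← MonoidalCategory.whiskerLeft_comp_assoc,
    SymmetricCategory.symmetry, whiskerLeft_id, Category.id_comp, ← reassoc_of% aL_braid N X,
    SymmetricCategory.symmetry, Category.comp_id]

theorem braid_assoc (X Y Z : D) :
    (β_ X (Y ⊗ Z)).hom ≫ (β_ Y Z).hom ▷ X ≫ (α_ Z Y X).hom ≫ Z ◁ (β_ Y X).hom ≫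
      (β_ Z (X ⊗ Y)).hom = (α_ X Y Z).inv := by
  have h (X Y : D) : (β_ X Y).hom ≫ (β_ Y X).hom = 𝟙 _ := SymmetricCategory.symmetry _ _
  rw [← BraidedCategory.braiding_naturality_right_assoc, BraidedCategory.braiding_tensor_right_hom,
    BraidedCategory.braiding_tensor_right_hom]
  simp only [Category.assoc, Iso.inv_hom_id_assoc]
  rw [← MonoidalCategory.whiskerLeft_comp_assoc, h, whiskerLeft_id, Category.id_comp,
    Iso.hom_inv_id_assoc, ← comp_whiskerRight_assoc, h, id_whiskerRight, Category.id_comp,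
    Iso.inv_hom_id_assoc, ← MonoidalCategory.whiskerLeft_comp_assoc, h, whiskerLeft_id,
    Category.id_comp]

variable [HasCoequalizers D]

/-- The tensor product over `A`, as an object. -/
noncomputable def ten (M N : Mod D A) : D := coequalizer (bl M N) (br M N)

/-- The projection to the tensor product over `A`. -/
noncomputable def pr (M N : Mod D A) : M.X ⊗ N.X ⟶ ten M N := coequalizer.π (bl M N) (br M N)

instance (M N : Mod D A) : Epi (pr M N) := inferInstanceAs (Epi (coequalizer.π _ _))

theorem bl_pr (M N : Mod D A) : bl M N ≫ pr M N = br M N ≫ pr M N := coequalizer.condition _ _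

theorem aL_pr (M N : Mod D A) : aL M N.X ≫ pr M N = aR M.X N ≫ pr M N :=
  (balanced_iff M N _).1 (bl_pr M N)

/-- The universal property of the tensor product over `A`. -/
noncomputable def desc {M N : Mod D A} {Z : D} (f : M.X ⊗ N.X ⟶ Z)
    (h : aL M N.X ≫ f = aR M.X N ≫ f) : ten M N ⟶ Z :=
  coequalizer.desc f ((balanced_iff M N f).2 h)

theorem pr_desc {M N : Mod D A} {Z : D} (f : M.X ⊗ N.X ⟶ Z)
    (h : aL M N.X ≫ f = aR M.X N ≫ f) : pr M N ≫ desc f h = f := coequalizer.π_desc _ _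

variable [∀ X : D, PreservesColimitsOfShape WalkingParallelPair (tensorLeft X)]

instance (X : D) : PreservesColimitsOfShape WalkingParallelPair (tensorRight X) :=
  preservesColimitsOfShape_of_natIso (BraidedCategory.tensorLeftIsoTensorRight X)

instance epiL (X : D) (M N : Mod D A) : Epi (X ◁ pr M N) :=
  inferInstanceAs (Epi ((tensorLeft X).map (coequalizer.π _ _)))

instance epiR (X : D) (M N : Mod D A) : Epi (pr M N ▷ X) :=
  inferInstanceAs (Epi ((tensorRight X).map (coequalizer.π _ _)))

instance epiLL (X Y : D) (M N : Mod D A) : Epi (X ◁ (Y ◁ pr M N)) := by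
  have : X ◁ (Y ◁ pr M N) = (α_ _ _ _).inv ≫ (X ⊗ Y) ◁ pr M N ≫ (α_ _ _ _).hom := by simp
  rw [this]
  infer_instance

instance epiRR (X Y : D) (M N : Mod D A) : Epi (pr M N ▷ X ▷ Y) := by
  have : pr M N ▷ X ▷ Y = (α_ _ _ _).hom ≫ pr M N ▷ (X ⊗ Y) ≫ (α_ _ _ _).inv := by simp
  rw [this]
  infer_instance

instance epiLR (X Y : D) (M N : Mod D A) : Epi (X ◁ (pr M N ▷ Y)) := by
  have : X ◁ (pr M N ▷ Y) = (α_ _ _ _).inv ≫ (X ◁ pr M N) ▷ Y ≫ (α_ _ _ _).hom := by simp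
  have h : (X ◁ pr M N) ▷ Y = (β_ _ _).hom ≫ Y ◁ (X ◁ pr M N) ≫ (β_ _ _).inv := by
    rw [← BraidedCategory.braiding_naturality_left_assoc, Iso.hom_inv_id, Category.comp_id]
  rw [this, h]
  infer_instance

instance epiRL (X Y : D) (M N : Mod D A) : Epi ((X ◁ pr M N) ▷ Y) := by
  have h : (X ◁ pr M N) ▷ Y = (β_ _ _).hom ≫ Y ◁ (X ◁ pr M N) ≫ (β_ _ _).inv := by
    rw [← BraidedCategory.braiding_naturality_left_assoc, Iso.hom_inv_id, Category.comp_id]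
  rw [h]
  infer_instance

/-- Descent along the projection, tensored with an object on the left. -/
noncomputable def descL (X : D) {M N : Mod D A} {Z : D} (f : X ⊗ (M.X ⊗ N.X) ⟶ Z)
    (h : X ◁ aL M N.X ≫ f = X ◁ aR M.X N ≫ f) : X ⊗ ten M N ⟶ Z :=
  Cofork.IsColimit.desc (isColimitOfHasCoequalizerOfPreservesColimit (tensorLeft X) (bl M N) (br M N))
    f (by
      have : IsIso (bs M N) := by
        rw [bs]
        infer_instance
      rw [← cancel_epi (X ◁ bs M N)]
      change X ◁ bs M N ≫ X ◁ bl M N ≫ f = X ◁ bs M N ≫ X ◁ br M N ≫ f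
      rw [← MonoidalCategory.whiskerLeft_comp_assoc, ← MonoidalCategory.whiskerLeft_comp_assoc,
        bs_bl, bs_br, h])

theorem pr_descL (X : D) {M N : Mod D A} {Z : D} (f : X ⊗ (M.X ⊗ N.X) ⟶ Z)
    (h : X ◁ aL M N.X ≫ f = X ◁ aR M.X N ≫ f) : X ◁ pr M N ≫ descL X f h = f :=
  Cofork.IsColimit.π_desc
    (isColimitOfHasCoequalizerOfPreservesColimit (tensorLeft X) (bl M N) (br M N))

/-- Descent along the projection, tensored with an object on the right. -/
noncomputable def descR (X : D) {M N : Mod D A} {Z : D} (f : (M.X ⊗ N.X) ⊗ X ⟶ Z)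
    (h : aL M N.X ▷ X ≫ f = aR M.X N ▷ X ≫ f) : ten M N ⊗ X ⟶ Z :=
  (β_ _ _).hom ≫ descL X ((β_ _ _).hom ≫ f) (by
    rw [BraidedCategory.braiding_naturality_right_assoc,
      BraidedCategory.braiding_naturality_right_assoc, h])

theorem pr_descR (X : D) {M N : Mod D A} {Z : D} (f : (M.X ⊗ N.X) ⊗ X ⟶ Z)
    (h : aL M N.X ▷ X ≫ f = aR M.X N ▷ X ≫ f) : pr M N ▷ X ≫ descR X f h = f := by
  rw [descR, BraidedCategory.braiding_naturality_left_assoc, pr_descL,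
    SymmetricCategory.symmetry_assoc]

variable [IsCommMonObj A]

/-- The action on the tensor product over `A`. -/
noncomputable def tact (M N : Mod D A) : A ⊗ ten M N ⟶ ten M N :=
  descL A (aL M N.X ≫ pr M N) (by
    have h : A ◁ aL M N.X ≫ aL M N.X ≫ pr M N = A ◁ aR M.X N ≫ aL M N.X ≫ pr M N := by
      rw [← Category.assoc (A ◁ aR M.X N), aL_aR, Category.assoc, Category.assoc, ← aL_pr,
        reassoc_of% aL_mul M N.X]
    exact h)

theorem pr_tact (M N : Mod D A) : A ◁ pr M N ≫ tact M N = aL M N.X ≫ pr M N := pr_descL _ _ _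

/-- The tensor product over `A`. -/
noncomputable def tens (M N : Mod D A) : Mod D A :=
  mk (ten M N) (tact M N)
    (by
      rw [← cancel_epi (𝟙_ D ◁ pr M N), whisker_exchange_assoc, pr_tact, ← Category.assoc]
      have := one_sm (modL M N.X)
      change η[A] ▷ (M.X ⊗ N.X) ≫ aL M N.X = _ at this
      rw [this]
      exact (leftUnitor_naturality (pr M N)).symm)
    (by
      rw [← cancel_epi ((A ⊗ A) ◁ pr M N), whisker_exchange_assoc, pr_tact, ← Category.assoc]
      have := mul_sm (modL M N.X)
      change μ[A] ▷ (M.X ⊗ N.X) ≫ aL M N.X = (α_ _ _ _).hom ≫ A ◁ aL M N.X ≫ aL M N.X at this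
      rw [this, associator_naturality_right_assoc, ← MonoidalCategory.whiskerLeft_comp_assoc,
        pr_tact, MonoidalCategory.whiskerLeft_comp_assoc, pr_tact]
      simp only [Category.assoc])

/-- The projection to the tensor product over `A`. -/
noncomputable def prj (M N : Mod D A) : M.X ⊗ N.X ⟶ (tens M N).X := pr M N

instance (M N : Mod D A) : Epi (prj M N) := inferInstanceAs (Epi (pr M N))

instance (X : D) (M N : Mod D A) : Epi (X ◁ prj M N) := epiL X M N

instance (X : D) (M N : Mod D A) : Epi (prj M N ▷ X) := epiR X M N

instance (X Y : D) (M N : Mod D A) : Epi (X ◁ (Y ◁ prj M N)) := epiLL X Y M N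

instance (X Y : D) (M N : Mod D A) : Epi (prj M N ▷ X ▷ Y) := epiRR X Y M N

instance (X Y : D) (M N : Mod D A) : Epi (X ◁ prj M N ▷ Y) := epiLR X Y M N

instance (X Y : D) (M N : Mod D A) : Epi ((X ◁ prj M N) ▷ Y) := epiRL X Y M N

theorem aL_prj (M N : Mod D A) : aL M N.X ≫ prj M N = A ◁ prj M N ≫ sm (tens M N) :=
  (pr_tact M N).symm

theorem aR_prj (M N : Mod D A) : aR M.X N ≫ prj M N = A ◁ prj M N ≫ sm (tens M N) :=
  (aL_pr M N).symm.trans (pr_tact M N).symm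

/-- A morphism out of a tensor product over `A`. -/
noncomputable def tdesc {M N P : Mod D A} (f : M.X ⊗ N.X ⟶ P.X)
    (hL : aL M N.X ≫ f = A ◁ f ≫ sm P) (hR : aR M.X N ≫ f = A ◁ f ≫ sm P) : tens M N ⟶ P :=
  homMk (desc f (hL.trans hR.symm)) (by
    refine (cancel_epi (A ◁ pr M N)).1 ?_
    have h : A ◁ pr M N ≫ tact M N ≫ desc f (hL.trans hR.symm) =
        A ◁ pr M N ≫ A ◁ desc f (hL.trans hR.symm) ≫ sm P := by
      rw [reassoc_of% pr_tact M N, ← MonoidalCategory.whiskerLeft_comp_assoc, pr_desc, hL]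
    exact h)

theorem prj_tdesc {M N P : Mod D A} (f : M.X ⊗ N.X ⟶ P.X)
    (hL : aL M N.X ≫ f = A ◁ f ≫ sm P) (hR : aR M.X N ≫ f = A ◁ f ≫ sm P) :
    prj M N ≫ (tdesc f hL hR).hom = f := pr_desc f (hL.trans hR.symm)

theorem tens_ext {M N P : Mod D A} {f g : tens M N ⟶ P} (h : prj M N ≫ f.hom = prj M N ≫ g.hom) :
    f = g := Mod.hom_ext _ _ ((cancel_epi (prj M N)).1 h)

/-- Functoriality of the tensor product over `A`. -/
noncomputable def tmap {M M' N N' : Mod D A} (f : M ⟶ M') (g : N ⟶ N') :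
    tens M N ⟶ tens M' N' :=
  tdesc ((f.hom ⊗ₘ g.hom) ≫ prj M' N')
    (by
      rw [MonoidalCategory.whiskerLeft_comp_assoc, ← aL_prj, ← Category.assoc, aL_nat,
        Category.assoc])
    (by
      rw [MonoidalCategory.whiskerLeft_comp_assoc, ← aR_prj, ← Category.assoc, aR_nat,
        Category.assoc])

theorem prj_tmap {M M' N N' : Mod D A} (f : M ⟶ M') (g : N ⟶ N') :
    prj M N ≫ (tmap f g).hom = (f.hom ⊗ₘ g.hom) ≫ prj M' N' := prj_tdesc _ _ _

/-- The symmetry of the tensor product over `A`. -/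
noncomputable def tbraid (M N : Mod D A) : tens M N ⟶ tens N M :=
  tdesc ((β_ _ _).hom ≫ prj N M)
    (by
      rw [MonoidalCategory.whiskerLeft_comp_assoc, ← aR_prj, ← Category.assoc, aL_braid,
        Category.assoc])
    (by
      rw [MonoidalCategory.whiskerLeft_comp_assoc, ← aL_prj, ← Category.assoc, aR_braid,
        Category.assoc])

theorem prj_tbraid (M N : Mod D A) : prj M N ≫ (tbraid M N).hom = (β_ _ _).hom ≫ prj N M :=
  prj_tdesc _ _ _

theorem tbraid_tbraid (M N : Mod D A) : tbraid M N ≫ tbraid N M = 𝟙 _ :=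
  tens_ext (by
    rw [Mod.comp_hom', reassoc_of% prj_tbraid M N, prj_tbraid, SymmetricCategory.symmetry_assoc,
      Mod.id_hom', Category.comp_id])

/-- The iterated projection. -/
noncomputable def prj₃ (M N P : Mod D A) : M.X ⊗ (N.X ⊗ P.X) ⟶ (tens M (tens N P)).X :=
  M.X ◁ prj N P ≫ prj M (tens N P)

theorem aL_prj₃ (M N P : Mod D A) :
    aL M (N.X ⊗ P.X) ≫ prj₃ M N P = A ◁ prj₃ M N P ≫ sm (tens M (tens N P)) := by
  rw [prj₃, reassoc_of% aL_natR M (prj N P), aL_prj, MonoidalCategory.whiskerLeft_comp_assoc]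

theorem aR_prj₃ (M N P : Mod D A) {a : A ⊗ (N.X ⊗ P.X) ⟶ N.X ⊗ P.X}
    (h : a ≫ prj N P = A ◁ prj N P ≫ sm (tens N P)) :
    aR' M.X a ≫ prj₃ M N P = A ◁ prj₃ M N P ≫ sm (tens M (tens N P)) := by
  have e : aR' M.X (sm (tens N P)) ≫ prj M (tens N P) = _ := aR_prj M (tens N P)
  rw [prj₃, reassoc_of% aR'_natR M.X (prj N P) h, e, MonoidalCategory.whiskerLeft_comp_assoc]

/-- Part of the associativity of the tensor product over `A`. -/
noncomputable def assocAux (M N P : Mod D A) : (tens M N).X ⊗ P.X ⟶ (tens M (tens N P)).X :=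
  descR P.X ((α_ _ _ _).hom ≫ prj₃ M N P) (by
    rw [reassoc_of% aL_assoc M N P.X, reassoc_of% aM_assoc M.X N P.X, aL_prj₃,
      aR_prj₃ M N P (aL_prj N P)])

theorem prj_assocAux (M N P : Mod D A) :
    prj M N ▷ P.X ≫ assocAux M N P = (α_ _ _ _).hom ≫ prj₃ M N P := pr_descR _ _ _

/-- Associativity of the tensor product over `A`. -/
noncomputable def tassoc (M N P : Mod D A) : tens (tens M N) P ⟶ tens M (tens N P) :=
  tdesc (assocAux M N P)
    (by
      rw [← cancel_epi (A ◁ prj M N ▷ P.X), ← MonoidalCategory.whiskerLeft_comp_assoc, prj_assocAux,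
        aL, Category.assoc, associator_inv_naturality_middle_assoc, ← comp_whiskerRight_assoc,
        ← aL_prj, comp_whiskerRight_assoc, prj_assocAux, reassoc_of% aL_assoc M N P.X, aL_prj₃,
        Iso.inv_hom_id_assoc, MonoidalCategory.whiskerLeft_comp_assoc])
    (by
      rw [← cancel_epi (A ◁ prj M N ▷ P.X), ← MonoidalCategory.whiskerLeft_comp_assoc, prj_assocAux,
        ← reassoc_of% aR_natL (prj M N) P, prj_assocAux, reassoc_of% aR_assoc M.X N.X P,
        aR_prj₃ M N P (aR_prj N P), MonoidalCategory.whiskerLeft_comp_assoc])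

theorem prj_tassoc (M N P : Mod D A) :
    prj M N ▷ P.X ≫ prj (tens M N) P ≫ (tassoc M N P).hom =
      (α_ _ _ _).hom ≫ M.X ◁ prj N P ≫ prj M (tens N P) := by
  rw [tassoc, prj_tdesc, prj_assocAux, prj₃]

theorem tens_ext₃ {M N P Q : Mod D A} {f g : tens (tens M N) P ⟶ Q}
    (h : prj M N ▷ P.X ≫ prj (tens M N) P ≫ f.hom = prj M N ▷ P.X ≫ prj (tens M N) P ≫ g.hom) :
    f = g := tens_ext ((cancel_epi (prj M N ▷ P.X)).1 h)

theorem tens_ext₃' {M N P Q : Mod D A} {f g : tens M (tens N P) ⟶ Q}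
    (h : M.X ◁ prj N P ≫ prj M (tens N P) ≫ f.hom = M.X ◁ prj N P ≫ prj M (tens N P) ≫ g.hom) :
    f = g := tens_ext ((cancel_epi (M.X ◁ prj N P)).1 h)

/-- Inverse associativity of the tensor product over `A`. -/
noncomputable def tassocInv (M N P : Mod D A) : tens M (tens N P) ⟶ tens (tens M N) P :=
  tbraid _ _ ≫ tmap (tbraid _ _) (𝟙 _) ≫ tassoc P N M ≫ tmap (𝟙 _) (tbraid _ _) ≫ tbraid _ _

theorem prj_tassocInv (M N P : Mod D A) :
    M.X ◁ prj N P ≫ prj M (tens N P) ≫ (tassocInv M N P).hom =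
      (α_ _ _ _).inv ≫ prj M N ▷ P.X ≫ prj (tens M N) P := by
  have h₁ : prj P N ▷ M.X ≫ prj (tens P N) M ≫ (tassoc P N M).hom ≫
      (tmap (𝟙 P) (tbraid N M)).hom ≫ (tbraid P (tens M N)).hom =
      (α_ _ _ _).hom ≫ P.X ◁ (β_ _ _).hom ≫ (β_ _ _).hom ≫ prj M N ▷ P.X ≫ prj (tens M N) P := by
    rw [reassoc_of% prj_tassoc P N M, reassoc_of% prj_tmap, prj_tbraid, Mod.id_hom',
      id_tensorHom, ← MonoidalCategory.whiskerLeft_comp_assoc, prj_tbraid,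
      MonoidalCategory.whiskerLeft_comp_assoc, BraidedCategory.braiding_naturality_right_assoc]
  rw [tassocInv, Mod.comp_hom', Mod.comp_hom', Mod.comp_hom', Mod.comp_hom', reassoc_of% prj_tbraid,
    BraidedCategory.braiding_naturality_right_assoc, reassoc_of% prj_tmap, Mod.id_hom',
    tensorHom_id, ← comp_whiskerRight_assoc, prj_tbraid, comp_whiskerRight_assoc, h₁,
    ← reassoc_of% braid_assoc M.X N.X P.X]

/-- The associator of the tensor product over `A`. -/
noncomputable def tassocIso (M N P : Mod D A) : tens (tens M N) P ≅ tens M (tens N P) where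
  hom := tassoc M N P
  inv := tassocInv M N P
  hom_inv_id := tens_ext₃ (by
    rw [Mod.comp_hom', reassoc_of% prj_tassoc, prj_tassocInv, Iso.hom_inv_id_assoc, Mod.id_hom',
      Category.comp_id])
  inv_hom_id := tens_ext₃' (by
    rw [Mod.comp_hom', reassoc_of% prj_tassocInv, prj_tassoc, Iso.inv_hom_id_assoc, Mod.id_hom',
      Category.comp_id])

/-- The projection for the tensor product with the unit. -/
noncomputable def pru (M : Mod D A) : A ⊗ M.X ⟶ (tens (unit A) M).X := prj (unit A) M

instance (M : Mod D A) : Epi (pru M) := inferInstanceAs (Epi (prj (unit A) M))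

theorem act_pru (M : Mod D A) : A ◁ sm M ≫ pru M = (α_ _ _ _).inv ≫ μ[A] ▷ M.X ≫ pru M := by
  have h : ((β_ A A).hom ≫ μ[A]) ▷ M.X ≫ pru M = ((α_ _ _ _).hom ≫ A ◁ sm M) ≫ pru M :=
    bl_pr (unit A) M
  rw [IsCommMonObj.mul_comm, Category.assoc] at h
  rw [h, Iso.inv_hom_id_assoc]

/-- Left unitality of the tensor product over `A`. -/
noncomputable def tleft (M : Mod D A) : tens (unit A) M ⟶ M :=
  tdesc (sm M)
    (by
      have h : ((α_ _ _ _).inv ≫ μ[A] ▷ M.X) ≫ sm M = A ◁ sm M ≫ sm M := by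
        rw [Category.assoc, mul_sm, Iso.inv_hom_id_assoc]
      exact h)
    (by
      have h : ((α_ A A M.X).inv ≫ (β_ A A).hom ▷ M.X ≫ (α_ A A M.X).hom ≫ A ◁ sm M) ≫ sm M =
          A ◁ sm M ≫ sm M := by
        rw [← sw_sm M, sw]
        simp only [Category.assoc]
      exact h)

theorem pru_tleft (M : Mod D A) : pru M ≫ (tleft M).hom = sm M := prj_tdesc _ _ _

/-- The left unitor of the tensor product over `A`. -/
noncomputable def tleftIso (M : Mod D A) : tens (unit A) M ≅ M :=
  isoMk
    { hom := (tleft M).hom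
      inv := (λ_ _).inv ≫ η[A] ▷ M.X ≫ pru M
      hom_inv_id := by
        refine (cancel_epi (pru M)).1 ?_
        rw [reassoc_of% pru_tleft M, Category.comp_id, leftUnitor_inv_naturality_assoc,
          whisker_exchange_assoc, act_pru, associator_inv_naturality_left_assoc,
          ← comp_whiskerRight_assoc, MonObj.one_mul]
        simp
      inv_hom_id := by
        rw [Category.assoc, Category.assoc, pru_tleft, one_sm, Iso.inv_hom_id] }
    (sm_hom (tleft M))

theorem pru_tleftIso (M : Mod D A) : pru M ≫ (tleftIso M).hom.hom = sm M := pru_tleft M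

/-- The symmetry of the tensor product over `A`, as an isomorphism. -/
noncomputable def tbraidIso (M N : Mod D A) : tens M N ≅ tens N M :=
  ⟨tbraid M N, tbraid N M, tbraid_tbraid _ _, tbraid_tbraid _ _⟩

/-- The right unitor of the tensor product over `A`. -/
noncomputable def trightIso (M : Mod D A) : tens M (unit A) ≅ M := tbraidIso _ _ ≪≫ tleftIso M

/-- The projection for the tensor product with the unit. -/
noncomputable def pru' (M : Mod D A) : M.X ⊗ A ⟶ (tens M (unit A)).X := prj M (unit A)

theorem pru_trightIso (M : Mod D A) : pru' M ≫ (trightIso M).hom.hom = (β_ _ _).hom ≫ sm M := by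
  have h : pru' M ≫ (tbraid M (unit A)).hom = (β_ _ _).hom ≫ pru M := prj_tbraid M (unit A)
  have e : (trightIso M).hom.hom = (tbraid M (unit A)).hom ≫ (tleft M).hom := rfl
  rw [e, reassoc_of% h, pru_tleft]

noncomputable instance : MonoidalCategoryStruct (Mod D A) where
  tensorObj := tens
  tensorUnit := unit A
  tensorHom := tmap
  whiskerLeft X _ _ f := tmap (𝟙 X) f
  whiskerRight f Y := tmap f (𝟙 Y)
  associator := tassocIso
  leftUnitor := tleftIso
  rightUnitor := trightIso

theorem tmap_comp {M M' M'' N N' N'' : Mod D A} (f : M ⟶ M') (g : N ⟶ N') (f' : M' ⟶ M'')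
    (g' : N' ⟶ N'') : tmap f g ≫ tmap f' g' = tmap (f ≫ f') (g ≫ g') :=
  tens_ext (by
    rw [Mod.comp_hom', reassoc_of% prj_tmap, prj_tmap, prj_tmap]
    simp)

theorem tmap_id (M N : Mod D A) : tmap (𝟙 M) (𝟙 N) = 𝟙 (tens M N) :=
  tens_ext (by
    rw [prj_tmap]
    simp)

theorem prj_tmap_tensor {M M' N N' : Mod D A} (f : M ⟶ M') (g : N ⟶ N') {Y Y' : D} (h : Y ⟶ Y') :
    prj M N ▷ Y ≫ ((tmap f g).hom ⊗ₘ h) = ((f.hom ⊗ₘ g.hom) ⊗ₘ h) ≫ prj M' N' ▷ Y' := by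
  rw [← tensorHom_id, tensorHom_comp_tensorHom, prj_tmap, ← tensorHom_id, tensorHom_comp_tensorHom,
    Category.id_comp, Category.comp_id]

theorem prj_tensor_tmap {M M' N N' : Mod D A} (f : M ⟶ M') (g : N ⟶ N') {Y Y' : D} (h : Y ⟶ Y') :
    Y ◁ prj M N ≫ (h ⊗ₘ (tmap f g).hom) = (h ⊗ₘ (f.hom ⊗ₘ g.hom)) ≫ Y' ◁ prj M' N' := by
  rw [← id_tensorHom, tensorHom_comp_tensorHom, prj_tmap, ← id_tensorHom, tensorHom_comp_tensorHom,
    Category.id_comp, Category.comp_id]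

theorem tassoc_nat {M M' N N' P P' : Mod D A} (f : M ⟶ M') (g : N ⟶ N') (h : P ⟶ P') :
    tmap (tmap f g) h ≫ tassoc M' N' P' = tassoc M N P ≫ tmap f (tmap g h) :=
  tens_ext₃ (by
    rw [Mod.comp_hom', Mod.comp_hom', reassoc_of% prj_tmap, reassoc_of% prj_tassoc M N P, prj_tmap,
      reassoc_of% prj_tmap_tensor f g h.hom, reassoc_of% prj_tensor_tmap g h f.hom, prj_tassoc,
      associator_naturality_assoc])

theorem tpentagon (W X Y Z : Mod D A) :
    tmap (tassoc W X Y) (𝟙 Z) ≫ tassoc W (tens X Y) Z ≫ tmap (𝟙 W) (tassoc X Y Z) =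
      tassoc (tens W X) Y Z ≫ tassoc W X (tens Y Z) :=
  tens_ext₃ ((cancel_epi (prj W X ▷ Y.X ▷ Z.X)).1 (by
    rw [Mod.comp_hom', Mod.comp_hom', Mod.comp_hom', reassoc_of% prj_tmap,
      reassoc_of% prj_tassoc (tens W X) Y Z, Mod.id_hom', tensorHom_id, ← comp_whiskerRight_assoc,
      ← comp_whiskerRight_assoc, Category.assoc, prj_tassoc, comp_whiskerRight_assoc,
      comp_whiskerRight_assoc, reassoc_of% prj_tassoc W (tens X Y) Z, prj_tmap, Mod.id_hom', id_tensorHom,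
      associator_naturality_middle_assoc, ← MonoidalCategory.whiskerLeft_comp_assoc,
      ← MonoidalCategory.whiskerLeft_comp_assoc, Category.assoc, prj_tassoc, associator_naturality_left_assoc,
      ← whisker_exchange_assoc, prj_tassoc, associator_naturality_right_assoc]
    simp only [MonoidalCategory.whiskerLeft_comp, Category.assoc]
    rw [pentagon_assoc]))

theorem ttriangle (X Y : Mod D A) :
    tassoc X (unit A) Y ≫ tmap (𝟙 X) (tleftIso Y).hom = tmap (trightIso X).hom (𝟙 Y) :=
  tens_ext (by
    have h₁ : X.X ◁ pru Y ≫ prj X (tens (unit A) Y) ≫ (tmap (𝟙 X) (tleftIso Y).hom).hom =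
        X.X ◁ sm Y ≫ prj X Y := by
      rw [prj_tmap, Mod.id_hom', id_tensorHom, ← MonoidalCategory.whiskerLeft_comp_assoc,
        pru_tleftIso]
    have h₂ : pru' X ▷ Y.X ≫ prj (tens X (unit A)) Y ≫ (tmap (trightIso X).hom (𝟙 Y)).hom =
        bl X Y ≫ prj X Y := by
      rw [prj_tmap, Mod.id_hom', tensorHom_id, ← comp_whiskerRight_assoc, pru_trightIso, bl]
    have h₃ : pru' X ▷ Y.X ≫ prj (tens X (unit A)) Y ≫ (tassoc X (unit A) Y).hom =
      (α_ _ _ _).hom ≫ X.X ◁ pru Y ≫ prj X (tens (unit A) Y) := prj_tassoc X (unit A) Y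
    have h₄ : bl X Y ≫ prj X Y = br X Y ≫ prj X Y := bl_pr X Y
    have : Epi (pru' X ▷ Y.X) := inferInstanceAs (Epi (prj X (unit A) ▷ Y.X))
    refine (cancel_epi (pru' X ▷ Y.X)).1 ?_
    rw [h₂, h₄, br, Mod.comp_hom', reassoc_of% h₃, h₁, Category.assoc])

theorem tleft_nat {M N : Mod D A} (f : M ⟶ N) :
    tmap (𝟙 (unit A)) f ≫ (tleftIso N).hom = (tleftIso M).hom ≫ f :=
  tens_ext (by
    have h : pru M ≫ (tmap (𝟙 (unit A)) f).hom = A ◁ f.hom ≫ pru N :=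
      (prj_tmap _ _).trans (congrArg (fun t => t ≫ pru N) (id_tensorHom A f.hom))
    have h' : pru M ≫ (tmap (𝟙 (unit A)) f ≫ (tleftIso N).hom).hom =
        pru M ≫ ((tleftIso M).hom ≫ f).hom := by
      rw [Mod.comp_hom', Mod.comp_hom', reassoc_of% h, reassoc_of% pru_tleftIso M, pru_tleftIso,
        sm_hom]
    exact h')

theorem tbraid_nat {M M' N N' : Mod D A} (f : M ⟶ M') (g : N ⟶ N') :
    tmap f g ≫ tbraid M' N' = tbraid M N ≫ tmap g f :=
  tens_ext (by
    rw [Mod.comp_hom', Mod.comp_hom', reassoc_of% prj_tmap, reassoc_of% prj_tbraid M N, prj_tmap,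
      prj_tbraid, BraidedCategory.braiding_naturality_assoc])

theorem tright_nat {M N : Mod D A} (f : M ⟶ N) :
    tmap f (𝟙 (unit A)) ≫ (trightIso N).hom = (trightIso M).hom ≫ f := by
  change _ ≫ tbraid _ _ ≫ (tleftIso N).hom = (tbraid _ _ ≫ (tleftIso M).hom) ≫ f
  rw [← Category.assoc, tbraid_nat, Category.assoc, tleft_nat, Category.assoc]

theorem thexagon (X Y Z : Mod D A) :
    tassoc X Y Z ≫ tbraid X (tens Y Z) ≫ tassoc Y Z X =
      tmap (tbraid X Y) (𝟙 Z) ≫ tassoc Y X Z ≫ tmap (𝟙 Y) (tbraid X Z) :=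
  tens_ext₃ (by
    simp only [Mod.comp_hom']
    rw [reassoc_of% prj_tassoc X Y Z, reassoc_of% prj_tbraid X (tens Y Z),
      BraidedCategory.braiding_naturality_right_assoc, prj_tassoc, reassoc_of% prj_tmap,
      Mod.id_hom', tensorHom_id, ← comp_whiskerRight_assoc, prj_tbraid, comp_whiskerRight_assoc,
      reassoc_of% prj_tassoc Y X Z, prj_tmap, Mod.id_hom', id_tensorHom,
      ← MonoidalCategory.whiskerLeft_comp_assoc, prj_tbraid,
      MonoidalCategory.whiskerLeft_comp_assoc, BraidedCategory.hexagon_forward_assoc])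

theorem thexagon' (X Y Z : Mod D A) :
    tassocInv X Y Z ≫ tbraid (tens X Y) Z ≫ tassocInv Z X Y =
      tmap (𝟙 X) (tbraid Y Z) ≫ tassocInv X Z Y ≫ tmap (tbraid X Z) (𝟙 Y) :=
  tens_ext₃' (by
    simp only [Mod.comp_hom']
    rw [reassoc_of% prj_tassocInv X Y Z, reassoc_of% prj_tbraid (tens X Y) Z,
      BraidedCategory.braiding_naturality_left_assoc, prj_tassocInv, reassoc_of% prj_tmap,
      Mod.id_hom', id_tensorHom, ← MonoidalCategory.whiskerLeft_comp_assoc, prj_tbraid,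
      MonoidalCategory.whiskerLeft_comp_assoc, reassoc_of% prj_tassocInv X Z Y, prj_tmap,
      Mod.id_hom', tensorHom_id, ← comp_whiskerRight_assoc, prj_tbraid, comp_whiskerRight_assoc,
      BraidedCategory.hexagon_reverse_assoc])

noncomputable instance : MonoidalCategory (Mod D A) := MonoidalCategory.ofTensorHom
  (id_tensorHom_id := tmap_id)
  (id_tensorHom := fun _ _ _ _ => rfl)
  (tensorHom_id := fun _ _ => rfl)
  (tensorHom_comp_tensorHom := fun f₁ f₂ g₁ g₂ => tmap_comp f₁ f₂ g₁ g₂)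
  (associator_naturality := fun f₁ f₂ f₃ => tassoc_nat f₁ f₂ f₃)
  (leftUnitor_naturality := fun f => tleft_nat f)
  (rightUnitor_naturality := fun f => tright_nat f)
  (pentagon := tpentagon)
  (triangle := ttriangle)

noncomputable instance : SymmetricCategory (Mod D A) where
  braiding := tbraidIso
  braiding_naturality_right X _ _ f := tbraid_nat (𝟙 X) f
  braiding_naturality_left f Z := tbraid_nat f (𝟙 Z)
  hexagon_forward := thexagon
  hexagon_reverse := thexagon'
  symmetry := tbraid_tbraid

end ModTensor

namespace ModTensor

open scoped MonoidalLeftAction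

variable {D : Type u} [Category.{v} D] [MonoidalCategory D] {A : D} [MonObj A]
  [SymmetricCategory D] [HasCoequalizers D]
  [∀ X : D, PreservesColimitsOfShape WalkingParallelPair (tensorLeft X)] [IsCommMonObj A]

/-- The forgetful functor is lax symmetric monoidal: its structure maps are the projection to the
tensor product over `A`, and the unit of `A`. -/
noncomputable instance : (Mod.forget (D := D) A).LaxMonoidal where
  ε := MonObj.one (X := A)
  μ M N := prj M N
  μ_natural_left f M := by
    have h := (prj_tmap f (𝟙 M)).symm
    rw [Mod.id_hom', tensorHom_id] at h
    exact h
  μ_natural_right M f := by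
    have h := (prj_tmap (𝟙 M) f).symm
    rw [Mod.id_hom', id_tensorHom] at h
    exact h
  associativity M N P := prj_tassoc M N P
  left_unitality M := by
    have h : (MonObj.one (X := A)) ▷ M.X ≫ pru M ≫ (tleftIso M).hom.hom = (λ_ M.X).hom := by
      rw [pru_tleftIso, one_sm]
    exact h.symm
  right_unitality M := by
    have h : M.X ◁ (MonObj.one (X := A)) ≫ pru' M ≫ (trightIso M).hom.hom = (ρ_ M.X).hom := by
      rw [pru_trightIso, BraidedCategory.braiding_naturality_right_assoc, one_sm,
        braiding_leftUnitor]
    exact h.symm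

noncomputable instance : (Mod.forget (D := D) A).LaxBraided where
  braided M N := prj_tbraid M N

end ModTensor

namespace ModTensor

open scoped MonoidalLeftAction MonObj

variable {D : Type u} [Category.{v} D] [MonoidalCategory D] {A : D} [MonObj A] [Preadditive D]
  [MonoidalPreadditive D]

/-- Transport of a property of morphisms of modules. -/
theorem hom_inj {M N : Mod D A} : Function.Injective (fun f : M ⟶ N => f.hom) :=
  fun _ _ h => Mod.hom_ext _ _ h

instance (M N : Mod D A) : Zero (M ⟶ N) := ⟨homMk 0 (by simp)⟩

instance (M N : Mod D A) : Add (M ⟶ N) :=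
  ⟨fun f g => homMk (f.hom + g.hom) (by
    rw [Preadditive.comp_add, sm_hom, sm_hom, MonoidalPreadditive.whiskerLeft_add,
      Preadditive.add_comp])⟩

instance (M N : Mod D A) : Neg (M ⟶ N) :=
  ⟨fun f => homMk (-f.hom) (by
    have h : A ◁ (-f.hom) = -(A ◁ f.hom) := (tensorLeft A).map_neg
    rw [Preadditive.comp_neg, sm_hom, h, Preadditive.neg_comp])⟩

instance (M N : Mod D A) : Sub (M ⟶ N) := ⟨fun f g => f + -g⟩

instance (M N : Mod D A) : AddCommGroup (M ⟶ N) where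
  add_assoc f g h := Mod.hom_ext _ _ (add_assoc f.hom g.hom h.hom)
  zero_add f := Mod.hom_ext _ _ (zero_add f.hom)
  add_zero f := Mod.hom_ext _ _ (add_zero f.hom)
  add_comm f g := Mod.hom_ext _ _ (add_comm f.hom g.hom)
  neg_add_cancel f := Mod.hom_ext _ _ (neg_add_cancel f.hom)
  nsmul := nsmulRec
  zsmul := zsmulRec

theorem add_hom {M N : Mod D A} (f g : M ⟶ N) : (f + g).hom = f.hom + g.hom := rfl

instance : Preadditive (Mod D A) where
  homGroup M N := inferInstance
  add_comp _ _ _ f g h := Mod.hom_ext _ _ (Preadditive.add_comp _ _ _ f.hom g.hom h.hom)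
  comp_add _ _ _ f g h := Mod.hom_ext _ _ (Preadditive.comp_add _ _ _ f.hom g.hom h.hom)

variable {𝕜 : Type w} [CommRing 𝕜] [Linear 𝕜 D] [MonoidalLinear 𝕜 D]

instance (M N : Mod D A) : SMul 𝕜 (M ⟶ N) :=
  ⟨fun r f => homMk (r • f.hom) (by
    rw [Linear.comp_smul, sm_hom, MonoidalLinear.whiskerLeft_smul, Linear.smul_comp])⟩

instance (M N : Mod D A) : Module 𝕜 (M ⟶ N) where
  one_smul f := Mod.hom_ext _ _ (one_smul 𝕜 f.hom)
  mul_smul r s f := Mod.hom_ext _ _ (mul_smul r s f.hom)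
  smul_zero r := Mod.hom_ext _ _ (smul_zero (A := M.X ⟶ N.X) r)
  smul_add r f g := Mod.hom_ext _ _ (smul_add r f.hom g.hom)
  add_smul r s f := Mod.hom_ext _ _ (add_smul r s f.hom)
  zero_smul f := Mod.hom_ext _ _ (zero_smul 𝕜 f.hom)

instance : Linear 𝕜 (Mod D A) where
  homModule M N := inferInstance
  smul_comp _ _ _ r f g := Mod.hom_ext _ _ (Linear.smul_comp _ _ _ r f.hom g.hom)
  comp_smul _ _ _ f r g := Mod.hom_ext _ _ (Linear.comp_smul _ _ _ f.hom r g.hom)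

end ModTensor

/-! ## Restriction along a tensor functor -/

namespace LinRep

variable {𝕜 : Type w} [CommRing 𝕜] {C : Type u₁} [Category.{max w u₁} C] [Preadditive C]
  [Linear 𝕜 C] {D : Type u₁} [Category.{max w u₁} D] [Preadditive D] [Linear 𝕜 D]

section

variable (F : C ⥤ D) [F.Additive] [F.Linear 𝕜]

/-- Restriction of linear functors along a linear functor. -/
def res : LinRep 𝕜 D ⥤ LinRep 𝕜 C where
  obj N := ⟨F ⋙ N.obj, by
    have := N.property.1
    have := N.property.2
    exact ⟨inferInstance, inferInstance⟩⟩
  map φ := ObjectProperty.homMk (F.whiskerLeft φ.hom)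

instance : (res (𝕜 := 𝕜) F).Additive where

instance : (res (𝕜 := 𝕜) F).Linear 𝕜 where

variable {F}

/-- An element of a restriction, as an element. -/
def dn {N : LinRep 𝕜 D} {c : C} (x : ((res F).obj N).El c) : N.El (F.obj c) := x

theorem dn_inj {N : LinRep 𝕜 D} {c : C} {x y : ((res F).obj N).El c} (h : dn x = dn y) : x = y := h

theorem dn_act {N : LinRep 𝕜 D} {c d : C} (f : c ⟶ d) (x : ((res F).obj N).El c) :
    dn (((res F).obj N).act f x) = N.act (F.map f) (dn x) := rfl

theorem dn_ap {N N' : LinRep 𝕜 D} (φ : N ⟶ N') {c : C} (x : ((res F).obj N).El c) :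
    dn (ap ((res F).map φ) c x) = ap φ (F.obj c) (dn x) := rfl

theorem dn_add {N : LinRep 𝕜 D} {c : C} (x y : ((res F).obj N).El c) : dn (x + y) = dn x + dn y :=
  rfl

theorem dn_smul {N : LinRep 𝕜 D} {c : C} (r : 𝕜) (x : ((res F).obj N).El c) :
    dn (r • x) = r • dn x := rfl

end

variable [MonoidalCategory C] [MonoidalPreadditive C] [MonoidalLinear 𝕜 C] [MonoidalCategory D]
  [MonoidalPreadditive D] [MonoidalLinear 𝕜 D] (F : C ⥤ D) [F.Additive] [F.Linear 𝕜]

section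

variable [F.LaxMonoidal]

/-- The unit of the lax structure of restriction: the functor itself, on morphisms. -/
def resUnit : (dayUnit : LinRep 𝕜 C) ⟶ (res F).obj dayUnit :=
  homMk' (fun c =>
    { toFun := fun x => (Functor.LaxMonoidal.ε F ≫ F.map (uel x) : 𝟙_ D ⟶ F.obj c)
      map_add' := fun x y => by
        rw [uel_add, F.map_add, Preadditive.comp_add]
        rfl
      map_smul' := fun r x => by
        rw [uel_smul, F.map_smul, Linear.comp_smul]
        rfl })
    (fun f x => by
      change Functor.LaxMonoidal.ε F ≫ F.map (uel x ≫ f) =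
        (Functor.LaxMonoidal.ε F ≫ F.map (uel x)) ≫ F.map f
      rw [F.map_comp, Category.assoc])

theorem uel_resUnit {c : C} (x : (dayUnit : LinRep 𝕜 C).El c) :
    uel (dn (ap (resUnit F) c x)) = Functor.LaxMonoidal.ε F ≫ F.map (uel x) := rfl

/-- The multiplication of the lax structure of restriction. -/
noncomputable def resMul (N N' : LinRep 𝕜 D) :
    day ((res F).obj N) ((res F).obj N') ⟶ (res F).obj (day N N') :=
  Bil.desc
    { φ := fun {u v} n n' => (day N N').act (Functor.LaxMonoidal.μ F u v) (tm (dn n) (dn n'))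
      add₂ := fun m m' n => by
        rw [dn_add, add_tm, map_add]
        rfl
      add₃ := fun m n n' => by
        rw [dn_add, tm_add, map_add]
        rfl
      smul₂ := fun r m n => by
        rw [dn_smul, smul_tm, map_smul]
        rfl
      smul₃ := fun r m n => by
        rw [dn_smul, tm_smul, map_smul]
        rfl
      natL := fun {u v u'} a m n => by
        rw [dn_act, tm_natL, act_act]
        refine Eq.trans ?_ (act_act (day N N') _ (F.map _) _).symm
        exact act_congr _ (Functor.LaxMonoidal.μ_natural_left F a v) _
      natR := fun {u v u'} a m n => by
        rw [dn_act, tm_natR, act_act]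
        refine Eq.trans ?_ (act_act (day N N') _ (F.map _) _).symm
        exact act_congr _ (Functor.LaxMonoidal.μ_natural_right F u a) _ }

theorem dn_mul (N N' : LinRep 𝕜 D) {u v : C} (n : ((res F).obj N).El u)
    (n' : ((res F).obj N').El v) :
    dn (ap (resMul F N N') (u ⊗ v) (tm n n')) =
      (day N N').act (Functor.LaxMonoidal.μ F u v) (tm (dn n) (dn n')) :=
  Bil.desc_tm _ _ _

/-- Restriction along a lax tensor functor is lax monoidal. -/
noncomputable instance : (res (𝕜 := 𝕜) F).LaxMonoidal where
  ε := resUnit F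
  μ N N' := resMul F N N'
  μ_natural_left {X Y} f Z := day_ext fun {u v} m n => by
    apply dn_inj
    change dn (ap (resMul F Y Z) _ (ap (dayHom ((res F).map f) (𝟙 _)) _ (tm m n))) =
      ap (dayHom f (𝟙 Z)) _ (dn (ap (resMul F X Z) _ (tm m n)))
    rw [dayHom_tm, ap_id, dn_mul, dn_mul, dn_ap, ap_act, dayHom_tm, ap_id]
  μ_natural_right {X Y} Z f := day_ext fun {u v} m n => by
    apply dn_inj
    change dn (ap (resMul F Z Y) _ (ap (dayHom (𝟙 _) ((res F).map f)) _ (tm m n))) =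
      ap (dayHom (𝟙 Z) f) _ (dn (ap (resMul F Z X) _ (tm m n)))
    rw [dayHom_tm, ap_id, dn_mul, dn_mul, dn_ap, ap_act, dayHom_tm, ap_id]
  associativity X Y Z := day_ext₃ fun {u v w} m n p => by
    apply dn_inj
    change ap (assocHom X Y Z) _ (dn (ap (resMul F (day X Y) Z) _
      (ap (dayHom (resMul F X Y) (𝟙 _)) _ (tm (tm m n) p)))) =
      dn (ap (resMul F X (day Y Z)) _ (ap (dayHom (𝟙 _) (resMul F Y Z)) _
        (ap (assocHom _ _ _) _ (tm (tm m n) p))))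
    rw [dayHom_tm, ap_id, dn_mul, dn_mul, assocHom_tm, ap_act (dayHom _ _), dayHom_tm, ap_id,
      ap_act (resMul _ _ _), dn_act, dn_mul, dn_mul, tm_natL, tm_natR, act_act, act_act, act_act,
      ap_act, assocHom_tm, act_act]
    refine act_congr _ ?_ _
    simp
  left_unitality X := day_ext fun {u v} s n => by
    apply dn_inj
    change dn (ap (leftHom _) _ (tm s n)) = ap (leftHom X) _ (dn (ap (resMul F dayUnit X) _
      (ap (dayHom (resUnit F) (𝟙 _)) _ (tm s n))))
    rw [leftHom_tm, dn_act, dayHom_tm, ap_id, dn_mul, ap_act, leftHom_tm, uel_resUnit, act_act]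
    refine act_congr _ ?_ _
    simp
  right_unitality X := day_ext fun {u v} n s => by
    apply dn_inj
    change dn (ap (rightHom _) _ (tm n s)) = ap (rightHom X) _ (dn (ap (resMul F X dayUnit) _
      (ap (dayHom (𝟙 _) (resUnit F)) _ (tm n s))))
    rw [rightHom_tm, dn_act, dayHom_tm, ap_id, dn_mul, ap_act, rightHom_tm, uel_resUnit, act_act]
    refine act_congr _ ?_ _
    simp

end

noncomputable instance [SymmetricCategory C] [SymmetricCategory D] [F.LaxBraided] :
    (res (𝕜 := 𝕜) F).LaxBraided where
  braided X Y := day_ext fun {u v} m n => by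
    apply dn_inj
    change ap (braidHom X Y) _ (dn (ap (resMul F X Y) _ (tm m n))) =
      dn (ap (resMul F Y X) _ (ap (braidHom _ _) _ (tm m n)))
    rw [dn_mul, ap_act, braidHom_tm, braidHom_tm, ap_act (resMul _ _ _), dn_act, dn_mul, act_act,
      act_act]
    exact act_congr _ (Functor.LaxBraided.braided v u).symm _

end LinRep

/-! ## The comparison functor of a lax symmetric monoidal functor -/

namespace Comparison

universe v₁ u₂ v₂

open scoped Obj MonoidalLeftAction

section

variable {B : Type u} [Category.{v} B] [MonoidalCategory B] {D : Type u₂} [Category.{v₂} D]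
  [MonoidalCategory D] (R : B ⥤ D) [R.LaxMonoidal]

/-- The monoid `R 𝟙`. -/
def unitMon : D := R.obj (𝟙_ B)

instance : MonObj (unitMon R) := inferInstanceAs (MonObj (R.obj (𝟙_ B)))

theorem one_eq : (MonObj.one : 𝟙_ D ⟶ unitMon R) = Functor.LaxMonoidal.ε R := by
  change Functor.LaxMonoidal.ε R ≫ R.map (𝟙 _) = _
  rw [R.map_id, Category.comp_id]

theorem mul_eq : (MonObj.mul : unitMon R ⊗ unitMon R ⟶ unitMon R) =
    Functor.LaxMonoidal.μ R (𝟙_ B) (𝟙_ B) ≫ R.map (λ_ (𝟙_ B)).hom := rfl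

/-- The action of `R 𝟙` on `R N`. -/
def action (N : B) : unitMon R ⊗ R.obj N ⟶ R.obj N :=
  Functor.LaxMonoidal.μ R (𝟙_ B) N ≫ R.map (λ_ N).hom

/-- The comparison functor of a lax monoidal functor `R`: an object `N` is sent to the module `R N`
over the monoid `R 𝟙`, with the action `R 𝟙 ⊗ R N ⟶ R (𝟙 ⊗ N) ≅ R N`. -/
def functor : B ⥤ CategoryTheory.Mod D (unitMon R) where
  obj N := ModTensor.mk (R.obj N) (action R N)
    (by
      rw [one_eq]
      exact (Functor.LaxMonoidal.left_unitality R N).symm)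
    (by
      have h : (Functor.LaxMonoidal.μ R (𝟙_ B) (𝟙_ B) ≫ R.map (λ_ (𝟙_ B)).hom) ▷ R.obj N ≫
          Functor.LaxMonoidal.μ R (𝟙_ B) N ≫ R.map (λ_ N).hom =
          (α_ _ _ _).hom ≫ R.obj (𝟙_ B) ◁ (Functor.LaxMonoidal.μ R (𝟙_ B) N ≫ R.map (λ_ N).hom) ≫
            Functor.LaxMonoidal.μ R (𝟙_ B) N ≫ R.map (λ_ N).hom := by
        rw [comp_whiskerRight_assoc, Functor.LaxMonoidal.μ_natural_left_assoc,
          MonoidalCategory.whiskerLeft_comp_assoc, Functor.LaxMonoidal.μ_natural_right_assoc,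
          ← Functor.LaxMonoidal.associativity_assoc, ← R.map_comp, ← R.map_comp, ← R.map_comp]
        simp
      exact h)
  map {N N'} f := ModTensor.homMk (R.map f) (by
    have h : (Functor.LaxMonoidal.μ R (𝟙_ B) N ≫ R.map (λ_ N).hom) ≫ R.map f =
        R.obj (𝟙_ B) ◁ R.map f ≫ Functor.LaxMonoidal.μ R (𝟙_ B) N' ≫ R.map (λ_ N').hom := by
      rw [Functor.LaxMonoidal.μ_natural_right_assoc, Category.assoc, ← R.map_comp, ← R.map_comp,
        leftUnitor_naturality]
    exact h)
  map_id N := Mod.hom_ext _ _ (R.map_id N)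
  map_comp f g := Mod.hom_ext _ _ (R.map_comp f g)

theorem functor_forget : functor R ⋙ Mod.forget (unitMon R) = R := rfl

end

section

variable {B : Type u} [Category.{v} B] [MonoidalCategory B] [SymmetricCategory B] {D : Type u₂}
  [Category.{v₂} D] [MonoidalCategory D] [SymmetricCategory D] (R : B ⥤ D) [R.LaxBraided]

instance : IsCommMonObj (unitMon R) where
  mul_comm := by
    have h := Functor.LaxBraided.braided (F := R) (𝟙_ B) (𝟙_ B)
    have h' : (β_ (R.obj (𝟙_ B)) (R.obj (𝟙_ B))).hom ≫ Functor.LaxMonoidal.μ R (𝟙_ B) (𝟙_ B) ≫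
        R.map (λ_ (𝟙_ B)).hom =
        Functor.LaxMonoidal.μ R (𝟙_ B) (𝟙_ B) ≫ R.map (λ_ (𝟙_ B)).hom := by
      rw [← reassoc_of% h, ← R.map_comp, braiding_leftUnitor, unitors_equal]
    exact h'

end

end Comparison

/-! ## Biset functors and global Mackey functors -/

section

variable (𝕜 : Type u) [CommRing 𝕜]

/-- Global Mackey functors: `𝕜`-linear functors on the category of spans of finite groupoids. -/
abbrev GlobalMackey := LinRep 𝕜 (SpanK 𝕜)

/-- Biset functors: `𝕜`-linear functors on the category of bisets of finite groupoids. -/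
abbrev BisetFunctor := LinRep 𝕜 (BisetK 𝕜)

/-- Restriction of biset functors to global Mackey functors, along realization. -/
noncomputable def restrict : BisetFunctor 𝕜 ⥤ GlobalMackey 𝕜 := LinRep.res (realizeK 𝕜)

noncomputable instance : (restrict 𝕜).LaxBraided :=
  inferInstanceAs (LinRep.res (𝕜 := 𝕜) (realizeK 𝕜)).LaxBraided

instance : (restrict 𝕜).Additive := inferInstanceAs (LinRep.res (𝕜 := 𝕜) (realizeK 𝕜)).Additive

instance : (restrict 𝕜).Linear 𝕜 := inferInstanceAs ((LinRep.res (𝕜 := 𝕜) (realizeK 𝕜)).Linear 𝕜)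

/-- The global Green functor `A`: the restriction of the Burnside biset functor, the unit of biset
functors. -/
noncomputable abbrev greenA : GlobalMackey 𝕜 := Comparison.unitMon (restrict 𝕜)

/-- Modules over `A` in global Mackey functors. -/
abbrev GreenMod := CategoryTheory.Mod (GlobalMackey 𝕜) (greenA 𝕜)

/-- The comparison functor from biset functors to modules over `A`. -/
noncomputable def bisetToMod : BisetFunctor 𝕜 ⥤ GreenMod 𝕜 := Comparison.functor (restrict 𝕜)

/-- The functor which forgets the action of `A`. -/
noncomputable def forgetMod : GreenMod 𝕜 ⥤ GlobalMackey 𝕜 := CategoryTheory.Mod.forget (greenA 𝕜)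

noncomputable instance : (forgetMod 𝕜).LaxBraided :=
  inferInstanceAs (CategoryTheory.Mod.forget (greenA 𝕜)).LaxBraided

instance : (forgetMod 𝕜).Additive where

instance : (forgetMod 𝕜).Linear 𝕜 where

variable {𝕜}

/-- The quotient homomorphism `G ⟶ G ⧸ N`, as a functor. -/
def quotFunctor (G : Type) [Group G] [Finite G] (N : Subgroup G) [N.Normal] :
    (FinGrpd.ofGroup G).carrier ⥤ (FinGrpd.ofGroup (G ⧸ N)).carrier :=
  SingleObj.mapHom G (G ⧸ N) (QuotientGroup.mk' N)

/-- Inflation, the value at the span `G ⧸ N ← G = G`. -/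
noncomputable def inflation (G : Type) [Group G] [Finite G] (N : Subgroup G) [N.Normal] :
    (Lin.of (SpanCat.of (FinGrpd.ofGroup (G ⧸ N))) : SpanK 𝕜) ⟶
      Lin.of (SpanCat.of (FinGrpd.ofGroup G)) :=
  Lin.incl 𝕜 (SpanCat.mk (GSpan.pull (quotFunctor G N)))

/-- Deflation, the value at the span `G = G → G ⧸ N`. -/
noncomputable def deflation (G : Type) [Group G] [Finite G] (N : Subgroup G) [N.Normal] :
    (Lin.of (SpanCat.of (FinGrpd.ofGroup G)) : SpanK 𝕜) ⟶
      Lin.of (SpanCat.of (FinGrpd.ofGroup (G ⧸ N))) :=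
  Lin.incl 𝕜 (SpanCat.mk (GSpan.push (quotFunctor G N)))

variable (𝕜) in
/-- The property `def ∘ inf = id` of a global Mackey functor, for all normal subgroups of finite
groups. -/
def deflative : ObjectProperty (GlobalMackey 𝕜) := fun M =>
  ∀ (G : Type) [Group G] [Finite G] (N : Subgroup G) [N.Normal],
    M.obj.map (inflation G N) ≫ M.obj.map (deflation G N) = 𝟙 _

end

/-!
Call an endo-span `G ← A → G` with two equal legs `a` the loop on `a`. The condition defining the
deflative functors says that the loop on the quotient homomorphism `G ⟶ G ⧸ N` acts as the identity.
Since a full and essentially surjective functor of finite groupoids is, component by component, such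
a quotient homomorphism up to equivalence, a deflative functor sends the loop on it to the identity
(`deflative.loop_act`).

Realization of spans by bisets is full, since a biset is realized by the span of its groupoid of
elements (`GBiset.real_span`). The apex of a span `S` maps to the groupoid of elements of its
realization by a full and essentially surjective functor (`GSpan.toElts`), so that `S` is the span
of elements of its realization with a loop inserted in the middle. Hence a deflative functor takes
the same value at two spans with the same realization (`deflative.sp_eq`), and descends to a biset
functor (`deflative.descIso`). As conversely realization sends these loops to identities,
restriction is fully faithful with the deflative functors as essential image (`restrict_essImage`).

Frobenius reciprocity for spans (`GSpan.frobenius`) moves a loop acting on `m ⊗ n` to the factor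
`n`, so the deflative functors form a tensor ideal (`deflative.tensor_right`). In particular
`F* N ⊗ F* N'` is the restriction of some biset functor. The latter has the universal property of
`N ⊗ N'`, because a family of bilinear maps which is natural for spans is natural for bisets, by
fullness; so the lax structure of restriction is invertible.

Fullness also makes the unit `𝟙 ⟶ A` of the Green functor surjective. Therefore a morphism between
`A`-modules is automatically equivariant (`sm_natural`), and forgetting the action is fully
faithful; an `A`-module is a retract of its tensor product with `A`, so it is deflative. This
gives the equivalence of biset functors with `A`-modules. The tensorator of restriction factors through the
projection to the tensor product over `A`, which is an epimorphism, so both factors are invertible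
(`Comparison.isIso_prj`, `Comparison.isIso_tensorator`). Finally `M ⟶ A ⊗ M` is the reflection into
the deflative functors (`bijective_unit_comp`).
-/

/-! ### Loops: spans with equal legs -/

namespace FinGrpd

/-- The full subgroupoid of a finite groupoid on the objects with a given property. -/
def full (A : FinGrpd) (p : ObjectProperty A.carrier) : FinGrpd where
  carrier := p.FullSubcategory
  grpd :=
    { inv := fun f => ObjectProperty.homMk (Groupoid.inv f.hom)
      inv_comp := fun f => ObjectProperty.hom_ext _ (Groupoid.inv_comp f.hom)
      comp_inv := fun f => ObjectProperty.hom_ext _ (Groupoid.comp_inv f.hom) }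
  finObj := Finite.of_injective (fun x => x.obj) (fun _ _ h => ObjectProperty.FullSubcategory.ext h)
  finHom _ _ := Finite.of_injective (fun f => f.hom) (fun _ _ h => ObjectProperty.hom_ext _ h)

end FinGrpd

namespace GSpan

variable {H G K U V : FinGrpd}

/-- The endo-span `G ← A → G` whose two legs are the same functor. -/
def loop {A G : FinGrpd} (a : A.carrier ⥤ G.carrier) : GSpan G G := ⟨A, a, a⟩

/-- The natural isomorphism of an iso-comma square. -/
noncomputable def commaIso {A B C : Type} [Groupoid.{0} A] [Groupoid.{0} B] [Groupoid.{0} C]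
    (a : A ⥤ C) (b : B ⥤ C) : Comma.fst a b ⋙ a ≅ Comma.snd a b ⋙ b :=
  NatIso.ofComponents (fun X => asIso X.hom) (fun f => f.w)

theorem pull_comp (a : G.carrier ⥤ H.carrier) (T : GSpan G K) :
    Rel (comp (pull a) T) ⟨T.apex, T.l ⋙ a, T.r⟩ :=
  rel_mk (Comma.snd (𝟭 G.carrier) T.l) (snd_faithful CategoryTheory.Equivalence.refl _)
    (snd_full CategoryTheory.Equivalence.refl _) (snd_essSurj CategoryTheory.Equivalence.refl _)
    (Functor.isoWhiskerRight (commaIso (𝟭 G.carrier) T.l).symm a) (Iso.refl _)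

theorem comp_loop {A : FinGrpd} (S : GSpan H G) (q : A.carrier ⥤ G.carrier) :
    Rel (comp S (loop q)) ⟨FinGrpd.isoComma S.r q, Comma.fst S.r q ⋙ S.l, Comma.fst S.r q ⋙ S.r⟩ :=
  rel_mk (𝟭 (Comma S.r q)) id_faithful id_full (inferInstance : (𝟭 (Comma S.r q)).EssSurj)
    (Iso.refl _) (commaIso S.r q)

theorem loop_congr {A B : FinGrpd} {a : A.carrier ⥤ G.carrier} {b : B.carrier ⥤ G.carrier}
    (f : A.carrier ⥤ B.carrier) (hf : f.IsEquivalence) (α : f ⋙ b ≅ a) : Rel (loop a) (loop b) :=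
  ⟨f, hf, ⟨α⟩, ⟨α⟩⟩

/-- A loop is the sum of the loops on two disjoint parts of its apex. -/
theorem loop_split {A : FinGrpd} (a : A.carrier ⥤ G.carrier) {p q r : ObjectProperty A.carrier}
    (hq : q ≤ p) (hr : r ≤ p) (hp : ∀ x, p x → q x ∨ r x)
    (h : ∀ x y, q x → r y → (x ⟶ y) → False) :
    Rel (add (loop (A := A.full q) (q.ι ⋙ a)) (loop (A := A.full r) (r.ι ⋙ a)))
      (loop (A := A.full p) (p.ι ⋙ a)) := by
  refine rel_mk ((ObjectProperty.ιOfLE hq).sum' (ObjectProperty.ιOfLE hr))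
    (sum_faithful (ObjectProperty.faithful_ιOfLE hq) (ObjectProperty.faithful_ιOfLE hr))
    (sum_full (ObjectProperty.full_ιOfLE hq) (ObjectProperty.full_ιOfLE hr) ?_ ?_)
    (sum_essSurj ?_) (sumIso (Iso.refl _) (Iso.refl _)) (sumIso (Iso.refl _) (Iso.refl _))
  · exact fun x y f => h x.obj y.obj x.property y.property f.hom
  · exact fun x y f => h x.obj y.obj x.property y.property (inv f.hom)
  · intro x
    rcases hp _ x.property with hx | hx
    · exact Or.inl ⟨⟨_, hx⟩, ⟨Iso.refl _⟩⟩
    · exact Or.inr ⟨⟨_, hx⟩, ⟨Iso.refl _⟩⟩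

theorem loop_full_top {A : FinGrpd} (a : A.carrier ⥤ G.carrier) {p : ObjectProperty A.carrier}
    (hp : ∀ x, p x) : Rel (loop (A := A.full p) (p.ι ⋙ a)) (loop a) := by
  have : p.ι.EssSurj := ⟨fun x => ⟨⟨x, hp x⟩, ⟨Iso.refl _⟩⟩⟩
  have h : p.ι.IsEquivalence := { }
  exact loop_congr (A := A.full p) p.ι h (Iso.refl _)

/-- The loop on a connected full subgroupoid, through a functor from a group. -/
theorem loop_connected {A : FinGrpd} (a : A.carrier ⥤ G.carrier) {p : ObjectProperty A.carrier}
    {x : A.carrier} (hx : p x) (h : ∀ y, p y → Nonempty (x ≅ y)) {B : Type} [Group B] [Finite B]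
    (f : B →* End x) (hf : Function.Bijective f) :
    Rel (loop (A := FinGrpd.ofGroup B) (SingleObj.functor f ⋙ a))
      (loop (A := A.full p) (p.ι ⋙ a)) := by
  let k : SingleObj B ⥤ p.FullSubcategory := p.lift (SingleObj.functor f) (fun _ => hx)
  have : k.Faithful := ⟨fun h => hf.1 (congrArg (fun t => t.hom) h)⟩
  have : k.Full := ⟨fun g => by
    obtain ⟨b, hb⟩ := hf.2 g.hom
    exact ⟨b, ObjectProperty.hom_ext _ hb⟩⟩
  have : k.EssSurj := ⟨fun y => by
    obtain ⟨i⟩ := h y.obj y.property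
    exact ⟨SingleObj.star B, ⟨ObjectProperty.isoMk _ i⟩⟩⟩
  have h : k.IsEquivalence := { }
  exact loop_congr (A := FinGrpd.ofGroup B) (B := A.full p) k h (Iso.refl _)

/-- Frobenius reciprocity: inserting a loop at the apex of a span out of a product amounts to
inserting it in the second factor. -/
theorem frobenius {S S' : FinGrpd} (l : S.carrier ⥤ (U.prod V).carrier) (r : S.carrier ⥤ G.carrier)
    (p : S'.carrier ⥤ S.carrier) :
    Rel ⟨S', p ⋙ l, p ⋙ r⟩ (comp
      (tens (pull (l ⋙ CategoryTheory.Prod.fst U.carrier V.carrier))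
        (comp (pull (l ⋙ CategoryTheory.Prod.snd U.carrier V.carrier)) (loop p)))
      ⟨S, Functor.diag S.carrier, r⟩) := by
  refine Rel.trans ?_ (comp_congr (tens_congr (Rel.refl _) (pull_comp _ _)) (Rel.refl _)).symm
  let F : S'.carrier ⥤ Comma ((𝟭 S.carrier).prod p) (Functor.diag S.carrier) :=
    { obj := fun x => ⟨(p.obj x, x), p.obj x, 𝟙 (p.obj x, p.obj x)⟩
      map := fun {x y} f => ⟨(p.map f, f), p.map f, by
        change (p.map f, p.map f) ≫ 𝟙 (p.obj y, p.obj y) = 𝟙 (p.obj x, p.obj x) ≫ _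
        rw [Category.comp_id, Category.id_comp]
        rfl⟩ }
  -- An object of the iso-comma groupoid is a triple `(s, x, s₀)` with `s ≅ s₀ ≅ p x`, hence is
  -- determined by `x` up to isomorphism.
  refine rel_mk F ⟨?_⟩ ⟨?_⟩ ⟨?_⟩ (Iso.refl _) (Iso.refl _)
  · intro x y f g h
    exact congrArg (fun t => t.left.2) h
  · intro x y f
    refine ⟨f.left.2, ?_⟩
    have h : (f.left.1, p.map f.left.2) ≫ 𝟙 (p.obj y, p.obj y) =
      𝟙 (p.obj x, p.obj x) ≫ (f.right, f.right) := f.w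
    replace h := (Category.comp_id _).symm.trans (h.trans (Category.id_comp _))
    have h₁ := congrArg Prod.fst h
    have h₂ := congrArg Prod.snd h
    exact Comma.hom_ext _ _ (Prod.ext (h₂.trans h₁.symm) rfl) h₂
  · rintro ⟨⟨s, x⟩, s₀, γ⟩
    let γ₁ : s ≅ s₀ := (Groupoid.isoEquivHom _ _).symm γ.1
    let γ₂ : p.obj x ≅ s₀ := (Groupoid.isoEquivHom _ _).symm γ.2
    refine ⟨x, ⟨Comma.isoMk (L₁ := (𝟭 S.carrier).prod p) (R₁ := Functor.diag S.carrier)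
      (X := ⟨(p.obj x, x), p.obj x, 𝟙 (p.obj x, p.obj x)⟩) (Y := ⟨(s, x), s₀, γ⟩)
      ((γ₂ ≪≫ γ₁.symm).prod (Iso.refl x)) γ₂ ?_⟩⟩
    refine Prod.ext ?_ ?_
    · change (γ₂.hom ≫ γ₁.inv) ≫ γ₁.hom = 𝟙 (p.obj x) ≫ γ₂.hom
      exact (Category.assoc _ _ _).trans ((congrArg (fun t => γ₂.hom ≫ t) γ₁.inv_hom_id).trans
        ((Category.comp_id _).trans (Category.id_comp _).symm))
    · exact congrArg (fun t => t ≫ γ₂.hom) (p.map_id x)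

end GSpan

namespace SpanCat

open GSpan

variable {H G K : FinGrpd}

theorem mk_eq_pull_push (S : GSpan H G) : mk S = mk (pull S.l) ≫ mk (push S.r) :=
  mk_eq (comp_push (pull S.l) S.r).symm

theorem loop_eq {A : FinGrpd} (a : A.carrier ⥤ G.carrier) :
    mk (loop a) = mk (pull a) ≫ mk (push a) :=
  mk_eq_pull_push _

/-- Precomposing both legs of a span with `p` inserts a loop on `p` at the apex. -/
theorem insert_loop {S S' : FinGrpd} (p : S'.carrier ⥤ S.carrier) (l : S.carrier ⥤ H.carrier)
    (r : S.carrier ⥤ G.carrier) :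
    mk ⟨S', p ⋙ l, p ⋙ r⟩ = mk (pull l) ≫ mk (loop p) ≫ mk (push r) := by
  refine (mk_eq (Rel.trans ?_ (comp_congr (Rel.refl _) (comp_push (loop p) r).symm)))
  exact (pull_comp l ⟨S', p, p ⋙ r⟩).symm

theorem loop_comp {A B : FinGrpd} (q : A.carrier ⥤ B.carrier) (k : B.carrier ⥤ G.carrier) :
    mk (loop (q ⋙ k)) = mk (pull k) ≫ mk (loop q) ≫ mk (push k) :=
  insert_loop q k k

theorem loop_empty {A : FinGrpd} (a : A.carrier ⥤ G.carrier) (h : A.carrier → False) :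
    mk (loop a) = 0 := mk_eq (rel_zero _ h)

end SpanCat

/-! ### Deflative functors do not see full and essentially surjective functors -/

namespace deflative

open GSpan LinRep

variable {𝕜 : Type u} [CommRing 𝕜] {M : GlobalMackey 𝕜}

/-- The action of an unlinearized span. -/
noncomputable def sp (M : GlobalMackey 𝕜) {H G : FinGrpd}
    (f : SpanCat.of H ⟶ SpanCat.of G) :
    M.El (Lin.of (SpanCat.of H)) →ₗ[𝕜] M.El (Lin.of (SpanCat.of G)) := M.act (Lin.incl 𝕜 f)

theorem sp_comp {H G K : FinGrpd} (f : SpanCat.of H ⟶ SpanCat.of G)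
    (g : SpanCat.of G ⟶ SpanCat.of K) (x) : sp M (f ≫ g) x = sp M g (sp M f x) := by
  unfold sp
  rw [Lin.incl_comp, act_act]

theorem sp_add {H G : FinGrpd} (f g : SpanCat.of H ⟶ SpanCat.of G) (x) :
    sp M (f + g) x = sp M f x + sp M g x := by
  unfold sp
  rw [Lin.incl_add, act_add]

theorem sp_id {H : FinGrpd} (x) : sp M (𝟙 (SpanCat.of H)) x = x := M.act_id x

theorem sp_zero {H G : FinGrpd} (x) : sp M (0 : SpanCat.of H ⟶ SpanCat.of G) x = 0 := by
  have := sp_add (M := M) (0 : SpanCat.of H ⟶ SpanCat.of G) 0 x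
  rw [add_zero] at this
  exact left_eq_add.1 this

theorem loop_act_quot (hM : deflative 𝕜 M) (G : Type) [Group G] [Finite G] (N : Subgroup G)
    [N.Normal] (x) : sp M (SpanCat.mk (loop (quotFunctor G N))) x = x := by
  rw [SpanCat.loop_eq, sp_comp]
  exact congrArg (fun t => t.hom x) (hM G N)

variable {S T : FinGrpd} (e : S.carrier ⥤ T.carrier)

/-- A deflative functor does not distinguish the loop on the inclusion of a connected component of
`T` from the loop on the restriction of a full functor to the preimage of this component: this
restriction amounts to a surjective homomorphism of finite groups, that is, to a quotient. -/
theorem loop_act_connected [e.Full] (hM : deflative 𝕜 M) (s : S.carrier)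
    {q : ObjectProperty T.carrier} (hq : ∀ t, q t ↔ Nonempty (e.obj s ≅ t)) (x) :
    sp M (SpanCat.mk (loop (A := S.full (q.inverseImage e)) ((q.inverseImage e).ι ⋙ e))) x =
      sp M (SpanCat.mk (loop (A := T.full q) q.ι)) x := by
  have hs : q (e.obj s) := (hq _).2 ⟨Iso.refl _⟩
  have : Finite (End s) := inferInstanceAs (Finite (s ⟶ s))
  let φ : End s →* End (e.obj s) := e.mapEnd s
  have hφ : Function.Surjective φ := fun g => ⟨e.preimage g, e.map_preimage g⟩
  have h₁ := SpanCat.mk_eq (loop_connected e (p := q.inverseImage e) hs (fun y hy => by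
    obtain ⟨i⟩ := (hq _).1 hy
    exact ⟨asIso (e.preimage i.hom)⟩) (MonoidHom.id (End s)) Function.bijective_id)
  -- The component of `T` is the quotient of `End s` by the kernel of `φ`.
  have h₂ := SpanCat.mk_eq (loop_connected (𝟭 T.carrier) (p := q) hs (fun y hy => (hq y).1 hy)
    (QuotientGroup.kerLift φ) ⟨QuotientGroup.kerLift_injective φ, fun g => by
      obtain ⟨f, rfl⟩ := hφ g
      exact ⟨f, rfl⟩⟩)
  have h₃ := SpanCat.loop_comp (A := FinGrpd.ofGroup (End s))
    (B := FinGrpd.ofGroup (End s ⧸ φ.ker)) (quotFunctor (End s) φ.ker)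
    (SingleObj.functor (QuotientGroup.kerLift φ))
  have h₄ := SpanCat.loop_eq (A := FinGrpd.ofGroup (End s ⧸ φ.ker))
    (SingleObj.functor (QuotientGroup.kerLift φ))
  change sp M _ x = sp M (SpanCat.mk (loop (A := T.full q) (q.ι ⋙ 𝟭 T.carrier))) x
  rw [← h₁, ← h₂]
  refine (congrArg (fun t => sp M t x) h₃).trans
    (Eq.trans ?_ (congrArg (fun t => sp M t x) h₄).symm)
  rw [sp_comp, sp_comp, loop_act_quot hM, sp_comp]

/-- Over any part of the target closed under isomorphisms, the loop on a full and essentially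
surjective functor acts as the loop on the inclusion. -/
theorem loop_act_part [e.Full] [e.EssSurj] (hM : deflative 𝕜 M) (n : ℕ) :
    ∀ (p : ObjectProperty T.carrier), (∀ t t', p t → (t ⟶ t') → p t') → {t | p t}.ncard = n →
    ∀ x, sp M (SpanCat.mk (loop (A := S.full (p.inverseImage e)) ((p.inverseImage e).ι ⋙ e))) x =
      sp M (SpanCat.mk (loop (A := T.full p) p.ι)) x := by
  induction n using Nat.strong_induction_on with
  | _ n ih =>
    intro p hp hn x
    by_cases h : ∃ t, p t
    · obtain ⟨t, ht⟩ := h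
      -- Split off the isomorphism class of `e s`; the rest has fewer objects.
      let s := e.objPreimage t
      have hs : p (e.obj s) := hp _ _ ht (e.objObjPreimageIso t).inv
      let q : ObjectProperty T.carrier := fun t => Nonempty (e.obj s ≅ t)
      let r : ObjectProperty T.carrier := fun t => p t ∧ ¬ q t
      have hq : ∀ t, q t → p t := fun t ⟨i⟩ => hp _ _ hs i.hom
      have hd : ∀ t t', q t → r t' → (t ⟶ t') → False :=
        fun t t' ⟨i⟩ h f => h.2 ⟨i ≪≫ asIso f⟩
      have hr : ∀ t t', r t → (t ⟶ t') → r t' :=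
        fun t t' h f => ⟨hp _ _ h.1 f, fun h' => hd _ _ h' h (inv f)⟩
      have hc : {t | r t}.ncard < n := by
        rw [← hn]
        refine Set.ncard_lt_ncard ⟨fun t h => h.1, fun h => (h hs).2 ⟨Iso.refl _⟩⟩ (Set.toFinite _)
      have h₁ := SpanCat.mk_eq (loop_split e (p := p.inverseImage e) (q := q.inverseImage e)
        (r := r.inverseImage e) (fun t h => hq _ h) (fun t h => h.1)
        (fun t h => (em (q (e.obj t))).imp id (fun h' => ⟨h, h'⟩))
        (fun t t' h h' f => hd _ _ h h' (e.map f)))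
      have h₂ := SpanCat.mk_eq (loop_split (𝟭 T.carrier) (p := p) (q := q) (r := r)
        (fun t h => hq _ h) (fun t h => h.1) (fun t h => (em (q t)).imp id (fun h' => ⟨h, h'⟩)) hd)
      change sp M _ x = sp M (SpanCat.mk (loop (A := T.full p) (p.ι ⋙ 𝟭 T.carrier))) x
      rw [← h₁, ← h₂, SpanCat.mk_add, SpanCat.mk_add, sp_add, sp_add,
        loop_act_connected e hM s (q := q) (fun _ => Iff.rfl), ih _ hc r hr rfl]
      rfl
    · have h₁ : SpanCat.mk (loop (A := T.full p) p.ι) = 0 :=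
        SpanCat.loop_empty _ (fun t : p.FullSubcategory => h ⟨_, t.property⟩)
      have h₂ : SpanCat.mk (loop (A := S.full (p.inverseImage e)) ((p.inverseImage e).ι ⋙ e)) = 0 :=
        SpanCat.loop_empty _
          (fun t : (p.inverseImage e).FullSubcategory => h ⟨e.obj t.obj, t.property⟩)
      rw [h₁, h₂]

/-- A deflative functor sends the loop on a full and essentially surjective functor to the
identity. -/
theorem loop_act [e.Full] [e.EssSurj] (hM : deflative 𝕜 M) (x) :
    sp M (SpanCat.mk (loop e)) x = x := by
  have h := loop_act_part e hM _ (⊤ : ObjectProperty T.carrier) (fun _ _ _ _ => trivial) rfl x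
  have h₁ := SpanCat.mk_eq (loop_full_top e
    (p := (⊤ : ObjectProperty T.carrier).inverseImage e) (fun _ => trivial))
  have h₂ := SpanCat.mk_eq (loop_full_top (𝟭 T.carrier) (p := (⊤ : ObjectProperty T.carrier))
    (fun _ => trivial))
  rw [h₁] at h
  exact h.trans ((congrArg (fun t => sp M t x) h₂).trans (sp_id x))

end deflative

/-! ### The span of elements of a biset -/

namespace GBiset

variable {H G K : FinGrpd}

/-- The objects of the groupoid of elements of a biset `U`: the triples `(h, g, x)` with
`x ∈ U(h, g)`. -/
@[ext]
structure Elt (U : GBiset H G) where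
  src : H.carrier
  tgt : G.carrier
  val : U.obj src tgt

/-- A morphism of elements: a pair of morphisms which is compatible with the two elements. As `U` is
contravariant in its first variable, the compatibility compares the two elements in
`U(h, g')`. -/
@[ext]
structure EltHom (U : GBiset H G) (a b : Elt U) where
  left : a.src ⟶ b.src
  right : a.tgt ⟶ b.tgt
  w : U.map (𝟙 _) right a.val = U.map left (𝟙 _) b.val

noncomputable instance (U : GBiset H G) : Groupoid.{0} (Elt U) where
  Hom a b := EltHom U a b
  id a := ⟨𝟙 _, 𝟙 _, rfl⟩
  comp {a b c} f g := ⟨f.left ≫ g.left, f.right ≫ g.right, by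
    have h₁ := congrArg (U.map (𝟙 _) g.right) f.w
    have h₂ := congrArg (U.map f.left (𝟙 _)) g.w
    simp only [map_map, Category.comp_id, Category.id_comp] at h₁ h₂
    exact h₁.trans h₂⟩
  id_comp f := EltHom.ext (Category.id_comp _) (Category.id_comp _)
  comp_id f := EltHom.ext (Category.comp_id _) (Category.comp_id _)
  assoc f g h := EltHom.ext (Category.assoc _ _ _) (Category.assoc _ _ _)
  inv {a b} f := ⟨inv f.left, inv f.right, by
    have h := congrArg (U.map (inv f.left) (inv f.right)) f.w
    simp only [map_map, Category.comp_id, Category.id_comp, IsIso.hom_inv_id,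
      IsIso.inv_hom_id] at h
    exact h.symm⟩
  inv_comp f := EltHom.ext (IsIso.inv_hom_id _) (IsIso.inv_hom_id _)
  comp_inv f := EltHom.ext (IsIso.hom_inv_id _) (IsIso.hom_inv_id _)

/-- The groupoid of elements of a biset. -/
noncomputable def elts (U : GBiset H G) : FinGrpd where
  carrier := Elt U
  finObj := Finite.of_injective (β := Σ (h : H.carrier) (g : G.carrier), U.obj h g)
    (fun a => ⟨a.src, a.tgt, a.val⟩) (by
      rintro ⟨h, g, x⟩ ⟨h', g', x'⟩ e
      cases e
      rfl)
  finHom a b := Finite.of_injective (β := (a.src ⟶ b.src) × (a.tgt ⟶ b.tgt))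
    (fun (f : EltHom U a b) => (f.left, f.right))
    (fun _ _ e => EltHom.ext (congrArg Prod.fst e) (congrArg Prod.snd e))

/-- The span of a biset, whose apex is the groupoid of elements. -/
noncomputable def span (U : GBiset H G) : GSpan H G where
  apex := U.elts
  l :=
    { obj := fun a => a.src
      map := fun {a b} (f : EltHom U a b) => f.left
      map_id := fun _ => rfl
      map_comp := fun _ _ => rfl }
  r :=
    { obj := fun a => a.tgt
      map := fun {a b} (f : EltHom U a b) => f.right
      map_id := fun _ => rfl
      map_comp := fun _ _ => rfl }

theorem span_congr {U V : GBiset H G} : Rel U V → GSpan.Rel U.span V.span := by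
  rintro ⟨φ, hφ, hn⟩
  let F : Elt U ⥤ Elt V :=
    { obj := fun a => ⟨a.src, a.tgt, φ _ _ a.val⟩
      map := fun f => ⟨f.left, f.right, by rw [← hn, ← hn, f.w]⟩ }
  refine GSpan.rel_mk F ⟨?_⟩ ⟨?_⟩ ⟨?_⟩ (Iso.refl _) (Iso.refl _)
  · intro a b f g h
    exact EltHom.ext (congrArg (fun t : EltHom V _ _ => t.left) h)
      (congrArg (fun t : EltHom V _ _ => t.right) h)
  · intro a b f
    exact ⟨⟨f.left, f.right, (hφ _ _).1 (by rw [hn, hn]; exact f.w)⟩, rfl⟩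
  · rintro ⟨h, g, x⟩
    obtain ⟨y, rfl⟩ := (hφ _ _).2 x
    exact ⟨⟨h, g, y⟩, ⟨Iso.refl _⟩⟩

/-- Every biset is realized by its span of elements. -/
theorem real_span (U : GBiset H G) : Rel (GSpan.real U.span) U := by
  refine rel_mk (fun k g => lift (pull U.span.l) (push U.span.r)
      (fun (a : Elt U) (y : k ⟶ a.src) (z : a.tgt ⟶ g) => U.map y z a.val) ?_)
    (fun k g x => cls (pull U.span.l) (push U.span.r) (⟨k, g, x⟩ : Elt U) (𝟙 k) (𝟙 g)) ?_ ?_ ?_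
  · intro (a : Elt U) (b : Elt U) (η : EltHom U a b) (y : k ⟶ a.src) (z : b.tgt ⟶ g)
    change U.map (𝟙 k ≫ y ≫ η.left) z b.val = U.map y (η.right ≫ z ≫ 𝟙 g) a.val
    have h := congrArg (U.map y z) η.w
    simp only [map_map, Category.comp_id, Category.id_comp] at h ⊢
    exact h.symm
  · intro k g a
    induction a using cls_ind with | hp a y z
    change Elt U at a
    change k ⟶ a.src at y
    change a.tgt ⟶ g at z
    change cls (pull U.span.l) (push U.span.r) (⟨k, g, U.map y z a.val⟩ : Elt U) (𝟙 k) (𝟙 g) = _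
    let η : EltHom U (⟨k, g, U.map y z a.val⟩ : Elt U) a := ⟨y, inv z, by simp [map_map]⟩
    have h := cls_eq (pull U.span.l) (push U.span.r) (k := k) (g := g)
      (h := (⟨k, g, U.map y z a.val⟩ : Elt U)) (h' := a) η (𝟙 k) z
    have h₁ : (pull U.span.l).map (𝟙 k) (h := k) (g := (⟨k, g, U.map y z a.val⟩ : Elt U))
        (g' := a) η (𝟙 k) = y := by
      change 𝟙 k ≫ 𝟙 k ≫ y = y
      simp
    have h₂ : (push U.span.r).map (h' := (⟨k, g, U.map y z a.val⟩ : Elt U)) (h := a) η (𝟙 g) z =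
        𝟙 g := by
      change inv z ≫ z ≫ 𝟙 g = 𝟙 g
      simp
    rw [h₁, h₂] at h
    exact h.symm
  · intro k g x
    exact U.map_id x
  · intro k k' g g' β α a
    induction a using cls_ind with | hp a y z
    change Elt U at a
    change k ⟶ a.src at y
    change a.tgt ⟶ g at z
    change U.map (β ≫ y ≫ 𝟙 _) (𝟙 _ ≫ z ≫ α) a.val = U.map β α (U.map y z a.val)
    rw [map_map]
    simp

/-- Pulling back and pushing forward along a full and essentially surjective functor is the
identity. -/
theorem pull_push_of_full (f : H.carrier ⥤ G.carrier) [f.Full] [f.EssSurj] :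
    Rel (comp (pull f) (push f)) (push (𝟭 G.carrier)) := by
  refine ⟨fun g g' => lift (pull f) (push f) (fun h y x => y ≫ x) ?_, ?_, ?_⟩
  · intro h h' η (y : g ⟶ f.obj h) (x : f.obj h' ⟶ g')
    change (𝟙 g ≫ y ≫ f.map η) ≫ x = y ≫ f.map η ≫ x ≫ 𝟙 g'
    simp
  · intro g g'
    constructor
    · intro a b
      induction a using cls_ind with | hp h y x
      induction b using cls_ind with | hp h' y' x'
      intro e
      change g ⟶ f.obj h at y
      change g ⟶ f.obj h' at y'
      change f.obj h ⟶ g' at x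
      change f.obj h' ⟶ g' at x'
      replace e : y ≫ x = y' ≫ x' := e
      have := cls_eq (pull f) (push f) (f.preimage (inv y ≫ y')) y x'
      have h₁ : (pull f).map (𝟙 g) (f.preimage (inv y ≫ y')) y = y' := by
        change 𝟙 g ≫ y ≫ f.map _ = y'
        simp
      have h₂ : (push f).map (f.preimage (inv y ≫ y')) (𝟙 g') x' = x := by
        change f.map _ ≫ x' ≫ 𝟙 g' = x
        simp [← e]
      rw [h₁, h₂] at this
      exact this.symm
    · intro (x : g ⟶ g')
      exact ⟨cls (pull f) (push f) (f.objPreimage g) (f.objObjPreimageIso g).inv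
        ((f.objObjPreimageIso g).hom ≫ x), (f.objObjPreimageIso g).inv_hom_id_assoc x⟩
  · intro k k' g g' β α a
    induction a using cls_ind with | hp h y x
    change k ⟶ f.obj h at y
    change f.obj h ⟶ g at x
    change (β ≫ y ≫ f.map (𝟙 _)) ≫ (f.map (𝟙 _) ≫ x ≫ α) = β ≫ (y ≫ x) ≫ α
    simp

end GBiset

namespace GSpan

open GBiset

variable {H G : FinGrpd}

/-- The canonical functor from the apex of a span to the elements of its realization, sending `s` to
the class of the pair of identities at `s`. -/
noncomputable def toElts (S : GSpan H G) : S.apex.carrier ⥤ S.real.elts.carrier where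
  obj s :=
    (⟨S.l.obj s, S.r.obj s, cls (GBiset.pull S.l) (GBiset.push S.r) s (𝟙 _) (𝟙 _)⟩ : Elt S.real)
  map {s s'} f := (⟨S.l.map f, S.r.map f, by
    have h := cls_eq (GBiset.pull S.l) (GBiset.push S.r) f (𝟙 (S.l.obj s)) (𝟙 (S.r.obj s'))
    refine Eq.trans ?_ (h.symm.trans ?_)
    · refine congrArg₂ (cls (GBiset.pull S.l) (GBiset.push S.r) s) ?_ ?_
      · change 𝟙 _ ≫ 𝟙 _ ≫ S.l.map (𝟙 _) = 𝟙 _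
        simp
      · change S.r.map (𝟙 _) ≫ 𝟙 _ ≫ S.r.map f = S.r.map f ≫ 𝟙 _ ≫ 𝟙 _
        simp
    · refine congrArg₂ (cls (GBiset.pull S.l) (GBiset.push S.r) s') ?_ ?_
      · change 𝟙 _ ≫ 𝟙 _ ≫ S.l.map f = S.l.map f ≫ 𝟙 _ ≫ S.l.map (𝟙 _)
        simp
      · change 𝟙 _ = S.r.map (𝟙 _) ≫ 𝟙 _ ≫ 𝟙 _
        simp⟩ : EltHom S.real _ _)
  map_id s := EltHom.ext (S.l.map_id s) (S.r.map_id s)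
  map_comp f g := EltHom.ext (S.l.map_comp f g) (S.r.map_comp f g)

theorem toElts_full (S : GSpan H G) {s s' : S.apex.carrier}
    (f : EltHom S.real (S.toElts.obj s) (S.toElts.obj s')) : ∃ η, S.toElts.map η = f := by
  obtain ⟨β, α, w⟩ := f
  change S.l.obj s ⟶ S.l.obj s' at β
  change S.r.obj s ⟶ S.r.obj s' at α
  obtain ⟨η, h₁, h₂⟩ := cls_exact (GBiset.pull S.l) (GBiset.push S.r) w
  change s ⟶ s' at η
  replace h₁ : 𝟙 _ ≫ (𝟙 _ ≫ 𝟙 _ ≫ S.l.map (𝟙 s)) ≫ S.l.map η =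
    β ≫ 𝟙 (S.l.obj s') ≫ S.l.map (𝟙 s') := h₁
  replace h₂ : S.r.map η ≫ (S.r.map (𝟙 s') ≫ 𝟙 _ ≫ 𝟙 _) ≫ 𝟙 _ =
    S.r.map (𝟙 s) ≫ 𝟙 (S.r.obj s) ≫ α := h₂
  simp only [CategoryTheory.Functor.map_id, Category.comp_id, Category.id_comp] at h₁ h₂
  exact ⟨η, EltHom.ext h₁ h₂⟩

theorem toElts_essSurj (S : GSpan H G) {h : H.carrier} {g : G.carrier} (s : S.apex.carrier)
    (y : h ⟶ S.l.obj s) (z : S.r.obj s ⟶ g) :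
    Nonempty (EltHom S.real (S.toElts.obj s)
      ⟨h, g, cls (GBiset.pull S.l) (GBiset.push S.r) s y z⟩) := by
  let y' : S.l.obj s ⟶ h := inv y
  refine ⟨⟨y', z, congrArg₂ (cls (GBiset.pull S.l) (GBiset.push S.r) s) ?_ ?_⟩⟩
  · change 𝟙 _ ≫ 𝟙 _ ≫ S.l.map (𝟙 _) = inv y ≫ y ≫ S.l.map (𝟙 _)
    simp
  · change S.r.map (𝟙 _) ≫ 𝟙 _ ≫ z = S.r.map (𝟙 _) ≫ z ≫ 𝟙 _
    simp

instance (S : GSpan H G) : S.toElts.Full where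
  map_surjective f := S.toElts_full f

instance (S : GSpan H G) : S.toElts.EssSurj where
  mem_essImage := by
    rintro ⟨h, g, x⟩
    induction x using cls_ind with | hp s y z
    obtain ⟨f⟩ := S.toElts_essSurj s y z
    exact ⟨s, ⟨(Groupoid.isoEquivHom _ _).symm f⟩⟩

end GSpan

/-! ### Realization is full, and its kernel is killed by deflative functors -/

instance : realize.Full where
  map_surjective {X Y} f := by
    induction f using BisetCat.ind with | h U
    exact ⟨SpanCat.mk U.span, BisetCat.mk_eq U.real_span⟩

/-- Realization kills the loop on a full and essentially surjective functor. -/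
theorem realize_loop {A G : FinGrpd} (e : A.carrier ⥤ G.carrier) [e.Full] [e.EssSurj] :
    realize.map (SpanCat.mk (GSpan.loop e)) = 𝟙 (BisetCat.of G) :=
  BisetCat.mk_eq (GBiset.pull_push_of_full e)

instance (𝕜 : Type u) [CommRing 𝕜] : (realizeK 𝕜).Full where
  map_surjective {X Y} f := by
    induction f using Lin.ind with
    | hi f =>
      obtain ⟨g, rfl⟩ := realize.map_surjective f
      exact ⟨Lin.incl 𝕜 g, realizeK_incl 𝕜 g⟩
    | ha f g hf hg =>
      obtain ⟨f', rfl⟩ := hf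
      obtain ⟨g', rfl⟩ := hg
      exact ⟨f' + g', Functor.map_add _⟩
    | hs r f hf =>
      obtain ⟨f', rfl⟩ := hf
      exact ⟨r • f', Functor.map_smul _ _ _⟩

namespace deflative

open LinRep

variable {𝕜 : Type u} [CommRing 𝕜] {M : GlobalMackey 𝕜}

/-- A deflative functor takes the same value at a span and at the span of elements of its
realization, which is obtained by removing the loop on `S.toElts`. -/
theorem sp_span_real (hM : deflative 𝕜 M) {H G : FinGrpd} (S : GSpan H G) (x) :
    sp M (SpanCat.mk S) x = sp M (SpanCat.mk S.real.span) x := by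
  have h : SpanCat.mk S = _ := SpanCat.insert_loop S.toElts S.real.span.l S.real.span.r
  rw [h, sp_comp, sp_comp, loop_act _ hM, ← sp_comp]
  exact congrArg (fun t => sp M t x) (SpanCat.mk_eq_pull_push S.real.span).symm

/-- A deflative functor takes the same value at two spans with isomorphic realizations. -/
theorem sp_eq (hM : deflative 𝕜 M) {H G : FinGrpd} {f g : SpanCat.of H ⟶ SpanCat.of G}
    (h : realize.map f = realize.map g) (x) : sp M f x = sp M g x := by
  induction f using SpanCat.ind with | h S
  induction g using SpanCat.ind with | h T
  rw [sp_span_real hM S, sp_span_real hM T]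
  exact congrArg (fun t => sp M t x) (SpanCat.mk_eq (GBiset.span_congr (BisetCat.mk_exact h)))

/-! ### Deflative functors are restrictions of biset functors -/

/-- A span which realizes a given biset. -/
noncomputable def spanOf {H G : FinGrpd} (f : BisetCat.of H ⟶ BisetCat.of G) :
    SpanCat.of H ⟶ SpanCat.of G := realize.preimage f

theorem realize_spanOf {H G : FinGrpd} (f : BisetCat.of H ⟶ BisetCat.of G) :
    realize.map (spanOf f) = f := realize.map_preimage f

/-- The action of unlinearized bisets on a deflative functor. -/
noncomputable def biact (hM : deflative 𝕜 M) (X Y : BisetCat) :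
    (X ⟶ Y) →+ (M.El (Lin.of (SpanCat.of X.grpd)) →ₗ[𝕜] M.El (Lin.of (SpanCat.of Y.grpd))) where
  toFun f := sp M (spanOf f)
  map_zero' := LinearMap.ext fun x =>
    (sp_eq hM ((realize_spanOf _).trans (realize_zero _ _).symm) x).trans (sp_zero x)
  map_add' f g := LinearMap.ext fun x => by
    refine (sp_eq hM ((realize_spanOf _).trans ?_) x).trans (sp_add (spanOf f) (spanOf g) x)
    refine Eq.trans ?_ (realize_add _ _).symm
    exact congrArg₂ (fun a b => a + b) (realize_spanOf f).symm (realize_spanOf g).symm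

/-- The action of morphisms of bisets on a deflative functor. -/
noncomputable def descAct (hM : deflative 𝕜 M) {X Y : BisetK 𝕜} (f : X ⟶ Y) :
    M.El (Lin.of (SpanCat.of X.base.grpd)) →ₗ[𝕜] M.El (Lin.of (SpanCat.of Y.base.grpd)) :=
  LinMod.lift (𝕜 := 𝕜) (biact hM X.base Y.base) f

theorem descAct_add (hM : deflative 𝕜 M) {X Y : BisetK 𝕜} (f g : X ⟶ Y) :
    descAct hM (f + g) = descAct hM f + descAct hM g :=
  map_add (LinMod.lift (𝕜 := 𝕜) (biact hM X.base Y.base)) f g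

theorem descAct_smul (hM : deflative 𝕜 M) {X Y : BisetK 𝕜} (r : 𝕜) (f : X ⟶ Y) :
    descAct hM (r • f) = r • descAct hM f :=
  map_smul (LinMod.lift (𝕜 := 𝕜) (biact hM X.base Y.base)) r f

theorem descAct_map (hM : deflative 𝕜 M) {H G : FinGrpd}
    (f : (Lin.of (SpanCat.of H) : SpanK 𝕜) ⟶ Lin.of (SpanCat.of G))
    (x : M.El (Lin.of (SpanCat.of H))) :
    descAct hM ((realizeK 𝕜).map f) x = M.act f x := by
  induction f using Lin.ind with
  | hi f =>
    refine (LinearMap.congr_fun (congrArg (fun t => descAct hM t) (realizeK_incl 𝕜 f)) x).trans ?_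
    refine (LinearMap.congr_fun
      (LinMod.lift_inc (𝕜 := 𝕜) (biact hM (BisetCat.of H) (BisetCat.of G)) _) x).trans ?_
    exact sp_eq hM (realize_spanOf _) x
  | ha f g hf hg =>
    refine (LinearMap.congr_fun (congrArg (fun t => descAct hM t)
      ((realizeK 𝕜).map_add (f := f) (g := g))) x).trans ?_
    refine (LinearMap.congr_fun
      (descAct_add hM ((realizeK 𝕜).map f) ((realizeK 𝕜).map g)) x).trans ?_
    exact (congrArg₂ (fun a b => a + b) hf hg).trans (M.act_add f g x).symm
  | hs r f hf =>
    refine (LinearMap.congr_fun (congrArg (fun t => descAct hM t)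
      ((realizeK 𝕜).map_smul r f)) x).trans ?_
    refine (LinearMap.congr_fun (descAct_smul hM r ((realizeK 𝕜).map f)) x).trans ?_
    exact (congrArg (fun a => r • a) hf).trans (M.act_smul r f x).symm

/-- The biset functor of a deflative global Mackey functor. -/
noncomputable def desc (hM : deflative 𝕜 M) : BisetFunctor 𝕜 :=
  ofData (fun X : BisetK 𝕜 => M.El (Lin.of (SpanCat.of X.base.grpd))) (fun f => descAct hM f)
    (fun X x => by
      have h := descAct_map hM (𝟙 (Lin.of (SpanCat.of X.base.grpd))) x
      rw [CategoryTheory.Functor.map_id, act_id] at h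
      exact h)
    (fun {X Y Z} f g x => by
      obtain ⟨f', rfl⟩ := (realizeK 𝕜).map_surjective
        (X := Lin.of (SpanCat.of X.base.grpd)) (Y := Lin.of (SpanCat.of Y.base.grpd)) f
      obtain ⟨g', rfl⟩ := (realizeK 𝕜).map_surjective
        (X := Lin.of (SpanCat.of Y.base.grpd)) (Y := Lin.of (SpanCat.of Z.base.grpd)) g
      have h := descAct_map hM (f' ≫ g') x
      rw [CategoryTheory.Functor.map_comp, ← act_act, ← descAct_map hM, ← descAct_map hM] at h
      exact h)
    (fun f g x => by rw [descAct_add]; rfl)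
    (fun r f x => by rw [descAct_smul]; rfl)

/-- A deflative functor is the restriction of its biset functor; the components are identities. -/
noncomputable def descIso (hM : deflative 𝕜 M) : (restrict 𝕜).obj (desc hM) ≅ M where
  hom := homMk' (fun _ => LinearMap.id) (fun f x => descAct_map hM f x)
  inv := homMk' (fun _ => LinearMap.id) (fun f x => (descAct_map hM f x).symm)
  hom_inv_id := rfl
  inv_hom_id := rfl

end deflative

section

open LinRep

variable {𝕜 : Type u} [CommRing 𝕜]

theorem quotFunctor_full (G : Type) [Group G] [Finite G] (N : Subgroup G) [N.Normal] :
    (quotFunctor G N).Full where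
  map_surjective g := QuotientGroup.mk'_surjective N g

theorem quotFunctor_essSurj (G : Type) [Group G] [Finite G] (N : Subgroup G) [N.Normal] :
    (quotFunctor G N).EssSurj where
  mem_essImage _ := ⟨SingleObj.star G, ⟨Iso.refl _⟩⟩

theorem inflation_deflation (G : Type) [Group G] [Finite G] (N : Subgroup G) [N.Normal] :
    inflation (𝕜 := 𝕜) G N ≫ deflation G N =
      Lin.incl 𝕜 (SpanCat.mk (GSpan.loop (quotFunctor G N))) := by
  rw [SpanCat.loop_eq, Lin.incl_comp]
  rfl

theorem deflative_iff (M : GlobalMackey 𝕜) : deflative 𝕜 M ↔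
    ∀ (G : Type) [Group G] [Finite G] (N : Subgroup G) [N.Normal] (x),
      deflative.sp M (SpanCat.mk (GSpan.loop (quotFunctor G N))) x = x := by
  refine ⟨fun h G _ _ N _ x => h.loop_act_quot G N x, fun h G _ _ N _ => ?_⟩
  rw [← Functor.map_comp, inflation_deflation]
  exact ModuleCat.hom_ext (LinearMap.ext fun x => h G N x)

theorem deflative_restrict (N : BisetFunctor 𝕜) : deflative 𝕜 ((restrict 𝕜).obj N) := by
  rw [deflative_iff]
  intro G _ _ H _ x
  have := quotFunctor_full G H
  have := quotFunctor_essSurj G H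
  refine (act_congr N ((realizeK_incl 𝕜 _).trans
    (congrArg (Lin.incl 𝕜) (realize_loop (quotFunctor G H)))) x).trans ?_
  exact N.act_id x

theorem deflative_of_retract {M N : GlobalMackey 𝕜} (i : M ⟶ N) (p : N ⟶ M) (h : i ≫ p = 𝟙 M)
    (hN : deflative 𝕜 N) : deflative 𝕜 M := by
  rw [deflative_iff] at hN ⊢
  intro G _ _ H _ x
  have hip : ∀ {c} (y : M.El c), ap p c (ap i c y) = y := fun {c} y => by
    rw [← ap_comp, h, ap_id]
  have := congrArg (ap p _) (hN G H (ap i _ x))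
  rw [hip] at this
  refine Eq.trans ?_ this
  exact (hip _).symm.trans (congrArg (ap p _) (ap_act i _ x))

theorem deflative_of_iso {M N : GlobalMackey 𝕜} (e : M ≅ N) (hN : deflative 𝕜 N) :
    deflative 𝕜 M := deflative_of_retract e.hom e.inv e.hom_inv_id hN

theorem restrict_essImage : (restrict 𝕜).essImage = deflative 𝕜 := by
  ext M
  exact ⟨fun ⟨N, ⟨e⟩⟩ => deflative_of_iso e.symm (deflative_restrict N),
    fun h => ⟨_, ⟨h.descIso⟩⟩⟩

instance : (restrict 𝕜).Faithful where
  map_injective h := hom_ext' fun X x =>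
    congrArg (fun t => ap t (Lin.of (SpanCat.of X.base.grpd) : SpanK 𝕜) x) h

instance : (restrict 𝕜).Full where
  map_surjective {N N'} φ := ⟨homMk' (fun X => ap φ (Lin.of (SpanCat.of X.base.grpd) : SpanK 𝕜))
    (fun {X Y} f x => by
      obtain ⟨f', rfl⟩ := (realizeK 𝕜).map_surjective
        (X := Lin.of (SpanCat.of X.base.grpd)) (Y := Lin.of (SpanCat.of Y.base.grpd)) f
      exact ap_act φ f' x), rfl⟩

end

/-! ### Deflative functors form a tensor ideal -/

section

variable {A B C : Type} [Groupoid.{0} A] [Groupoid.{0} B] [Groupoid.{0} C]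

theorem comma_fst_full (a : A ⥤ C) (b : B ⥤ C) [b.Full] : (Comma.fst a b).Full where
  map_surjective {X Y} f := ⟨⟨f, b.preimage (inv X.hom ≫ a.map f ≫ Y.hom), by simp⟩, rfl⟩

theorem comma_fst_essSurj (a : A ⥤ C) (b : B ⥤ C) [b.EssSurj] : (Comma.fst a b).EssSurj where
  mem_essImage x := ⟨⟨x, b.objPreimage (a.obj x), (b.objObjPreimageIso (a.obj x)).inv⟩,
    ⟨Iso.refl _⟩⟩

end

namespace deflative

open LinRep

variable {𝕜 : Type u} [CommRing 𝕜] {M N : GlobalMackey 𝕜}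

/-- The class of a span out of a product, as a morphism out of a tensor product. -/
noncomputable def tensorSpan {U V G : FinGrpd} (T : GSpan (U.prod V) G) :
    (Lin.of (SpanCat.of U) : SpanK 𝕜) ⊗ (Lin.of (SpanCat.of V) : SpanK 𝕜) ⟶
      Lin.of (SpanCat.of G) :=
  Lin.incl 𝕜 (SpanCat.mk T)

theorem tensorSpan_frobenius {U V G S S' : FinGrpd} (l : S.carrier ⥤ (U.prod V).carrier)
    (r : S.carrier ⥤ G.carrier) (p : S'.carrier ⥤ S.carrier) :
    tensorSpan (𝕜 := 𝕜) ⟨S', p ⋙ l, p ⋙ r⟩ =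
      (Lin.incl 𝕜 (SpanCat.mk (GSpan.pull (l ⋙ CategoryTheory.Prod.fst U.carrier V.carrier))) ⊗ₘ
        Lin.incl 𝕜 (SpanCat.mk (GSpan.pull (l ⋙ CategoryTheory.Prod.snd U.carrier V.carrier)) ≫
          SpanCat.mk (GSpan.loop p))) ≫ tensorSpan ⟨S, Functor.diag S.carrier, r⟩ := by
  have h : SpanCat.mk ⟨S', p ⋙ l, p ⋙ r⟩ =
      (SpanCat.mk (GSpan.pull (l ⋙ CategoryTheory.Prod.fst U.carrier V.carrier)) ⊗ₘ
        (SpanCat.mk (GSpan.pull (l ⋙ CategoryTheory.Prod.snd U.carrier V.carrier)) ≫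
          SpanCat.mk (GSpan.loop p))) ≫ SpanCat.mk ⟨S, Functor.diag S.carrier, r⟩ :=
    SpanCat.mk_eq (GSpan.frobenius l r p)
  rw [← Lin.incl_tensor]
  exact (congrArg (Lin.incl 𝕜) h).trans (Lin.incl_comp _ _)

theorem act_frobenius {U V G S S' : FinGrpd} (l : S.carrier ⥤ (U.prod V).carrier)
    (r : S.carrier ⥤ G.carrier) (p : S'.carrier ⥤ S.carrier)
    (m : M.El (Lin.of (SpanCat.of U))) (n : N.El (Lin.of (SpanCat.of V))) :
    (day M N).act (tensorSpan ⟨S', p ⋙ l, p ⋙ r⟩) (tm m n) =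
      (day M N).act (tensorSpan ⟨S, Functor.diag S.carrier, r⟩)
        (tm (sp M (SpanCat.mk (GSpan.pull (l ⋙ CategoryTheory.Prod.fst U.carrier V.carrier))) m)
          (sp N (SpanCat.mk (GSpan.loop p))
            (sp N (SpanCat.mk (GSpan.pull (l ⋙ CategoryTheory.Prod.snd U.carrier V.carrier))) n)))
    := by
  rw [tensorSpan_frobenius, ← act_act, ← tm_nat, ← sp_comp]
  rfl

theorem tensorSpan_comp_loop {U V G A : FinGrpd} (T : GSpan (U.prod V) G)
    (q : A.carrier ⥤ G.carrier) :
    tensorSpan (𝕜 := 𝕜) T ≫ Lin.incl 𝕜 (SpanCat.mk (GSpan.loop q)) =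
      tensorSpan ⟨FinGrpd.isoComma T.r q, Comma.fst T.r q ⋙ T.l, Comma.fst T.r q ⋙ T.r⟩ :=
  (Lin.incl_comp _ _).symm.trans (congrArg (Lin.incl 𝕜) (SpanCat.mk_eq (GSpan.comp_loop T q)))

/-- Loops on full and essentially surjective functors fix the elements `m ⊗ n` of the tensor product
with a deflative functor: by Frobenius reciprocity they can be moved to `n`. -/
theorem loop_tensorSpan (hN : deflative 𝕜 N) {U V G A : FinGrpd} (T : GSpan (U.prod V) G)
    (q : A.carrier ⥤ G.carrier) [q.Full] [q.EssSurj]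
    (m : M.El (Lin.of (SpanCat.of U))) (n : N.El (Lin.of (SpanCat.of V))) :
    (day M N).act (Lin.incl 𝕜 (SpanCat.mk (GSpan.loop q)))
      ((day M N).act (tensorSpan T) (tm m n)) = (day M N).act (tensorSpan T) (tm m n) := by
  have h₁ := comma_fst_full T.r q
  have h₂ := comma_fst_essSurj T.r q
  rw [act_act, tensorSpan_comp_loop]
  refine (act_frobenius T.l T.r (S' := FinGrpd.isoComma T.r q) (Comma.fst T.r q) m n).trans ?_
  refine Eq.trans ?_ (act_frobenius T.l T.r (𝟭 _) m n).symm
  refine congrArg (fun t => (day M N).act _ (tm _ t)) ?_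
  exact (@loop_act _ _ _ (FinGrpd.isoComma T.r q) _ (Comma.fst T.r q) h₁ h₂ hN _).trans
    (loop_act (𝟭 _) hN _).symm

/-- The tensor product of any functor with a deflative one is deflative. -/
theorem day_right (M : GlobalMackey 𝕜) (hN : deflative 𝕜 N) : deflative 𝕜 (day M N) := by
  rw [deflative_iff]
  intro G _ _ H _ x
  have hq := quotFunctor_full G H
  have hq' := quotFunctor_essSurj G H
  induction x using day_ind with
  | ha x y hx hy => rw [map_add, hx, hy]
  | @hp u v f m n =>
    induction f using Lin.ind with
    | hi f =>
      induction f using SpanCat.ind with | h T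
      exact hN.loop_tensorSpan (U := u.base.grpd) (V := v.base.grpd) T (quotFunctor G H) m n
    | ha f g hf hg => rw [act_add, map_add, hf, hg]
    | hs r f hf => rw [act_smul, map_smul, hf]

theorem tensor_right (M : GlobalMackey 𝕜) (hN : deflative 𝕜 N) : deflative 𝕜 (M ⊗ N) :=
  day_right M hN

theorem tensor_left (hM : deflative 𝕜 M) (N : GlobalMackey 𝕜) : deflative 𝕜 (M ⊗ N) :=
  deflative_of_iso (β_ M N) (tensor_right N hM)

end deflative

/-! ### Restriction preserves tensor products -/

section

open LinRep

variable {𝕜 : Type u} [CommRing 𝕜]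

/-- An object of the category of bisets, as an object of the category of spans. -/
def up (X : BisetK 𝕜) : SpanK 𝕜 := Lin.of (SpanCat.of X.base.grpd)

variable {N N' P : BisetFunctor 𝕜} {u v u' v' : BisetK 𝕜}

/-- The element `n ⊗ n'` of the tensor product of two restrictions. -/
noncomputable def upTm (n : N.El u) (n' : N'.El v) :
    (day ((restrict 𝕜).obj N) ((restrict 𝕜).obj N')).El (up u ⊗ up v) :=
  tm (M := (restrict 𝕜).obj N) (N := (restrict 𝕜).obj N') (u := up u) (v := up v) n n'

theorem add_upTm (m n : N.El u) (n' : N'.El v) : upTm (m + n) n' = upTm m n' + upTm n n' :=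
  add_tm (M := (restrict 𝕜).obj N) (N := (restrict 𝕜).obj N') (u := up u) (v := up v) m n n'

theorem upTm_add (n : N.El u) (m' n' : N'.El v) : upTm n (m' + n') = upTm n m' + upTm n n' :=
  tm_add (M := (restrict 𝕜).obj N) (N := (restrict 𝕜).obj N') (u := up u) (v := up v) n m' n'

theorem smul_upTm (r : 𝕜) (n : N.El u) (n' : N'.El v) : upTm (r • n) n' = r • upTm n n' :=
  smul_tm (M := (restrict 𝕜).obj N) (N := (restrict 𝕜).obj N') (u := up u) (v := up v) r n n'

theorem upTm_smul (r : 𝕜) (n : N.El u) (n' : N'.El v) : upTm n (r • n') = r • upTm n n' :=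
  tm_smul (M := (restrict 𝕜).obj N) (N := (restrict 𝕜).obj N') (u := up u) (v := up v) r n n'

theorem upTm_natL (a : up u ⟶ up u') (n : N.El u) (n' : N'.El v) :
    upTm (N.act ((realizeK 𝕜).map a) n) n' = (day _ _).act (a ▷ up v) (upTm n n') :=
  tm_natL (M := (restrict 𝕜).obj N) (N := (restrict 𝕜).obj N') (v := up v) a n n'

theorem upTm_natR (b : up v ⟶ up v') (n : N.El u) (n' : N'.El v) :
    upTm n (N'.act ((realizeK 𝕜).map b) n') = (day _ _).act (up u ◁ b) (upTm n n') :=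
  tm_natR (M := (restrict 𝕜).obj N) (N := (restrict 𝕜).obj N') (u := up u) b n n'

theorem realizeK_whiskerRight (a : up u ⟶ up u') (v : BisetK 𝕜) :
    (realizeK 𝕜).map (a ▷ up v) = ((realizeK 𝕜).map a : u ⟶ u') ▷ v :=
  (Category.id_comp _).symm.trans
    ((Functor.LaxMonoidal.μ_natural_left (realizeK 𝕜) a (up v)).symm.trans (Category.comp_id _))

theorem realizeK_whiskerLeft (u : BisetK 𝕜) (b : up v ⟶ up v') :
    (realizeK 𝕜).map (up u ◁ b) = u ◁ ((realizeK 𝕜).map b : v ⟶ v') :=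
  (Category.id_comp _).symm.trans
    ((Functor.LaxMonoidal.μ_natural_right (realizeK 𝕜) (up u) b).symm.trans (Category.comp_id _))

/-- The value of a map out of the tensor product of two restrictions. -/
noncomputable def upVal (θ : day ((restrict 𝕜).obj N) ((restrict 𝕜).obj N') ⟶ (restrict 𝕜).obj P) :
    (day ((restrict 𝕜).obj N) ((restrict 𝕜).obj N')).El (up u ⊗ up v) →ₗ[𝕜] P.El (u ⊗ v) :=
  ap θ (up u ⊗ up v)

/-- A map out of the tensor product of two restrictions is a bilinear family which is natural for
bisets too, as realization is full. -/
noncomputable def bilOfRestrict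
    (θ : day ((restrict 𝕜).obj N) ((restrict 𝕜).obj N') ⟶ (restrict 𝕜).obj P) : Bil N N' P where
  φ {u v} n n' := upVal θ (upTm n n')
  add₂ m m' n := by rw [add_upTm, map_add]
  add₃ m n n' := by rw [upTm_add, map_add]
  smul₂ r m n := by rw [smul_upTm, map_smul]
  smul₃ r m n := by rw [upTm_smul, map_smul]
  natL {u v u'} a m n := by
    obtain ⟨a', rfl⟩ := (realizeK 𝕜).map_surjective (X := up u) (Y := up u') a
    refine (congrArg (upVal θ) (upTm_natL a' m n)).trans ?_
    refine (ap_act θ (a' ▷ up v) (upTm m n)).trans ?_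
    exact act_congr P (realizeK_whiskerRight a' v) _
  natR {u v v'} b m n := by
    obtain ⟨b', rfl⟩ := (realizeK 𝕜).map_surjective (X := up v) (Y := up v') b
    refine (congrArg (upVal θ) (upTm_natR b' m n)).trans ?_
    refine (ap_act θ (up u ◁ b') (upTm m n)).trans ?_
    exact act_congr P (realizeK_whiskerLeft u b') _

theorem dn_resMul {u v : SpanK 𝕜} (n : ((restrict 𝕜).obj N).El u)
    (n' : ((restrict 𝕜).obj N').El v) :
    dn (F := realizeK 𝕜) (ap (resMul (realizeK 𝕜) N N') (u ⊗ v) (tm n n')) =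
      tm (M := N) (N := N') (dn n) (dn n') :=
  (dn_mul (realizeK 𝕜) N N' n n').trans ((day N N').act_id _)

/-- Maps out of a tensor product of restrictions, to a restriction, factor through the tensor
product of biset functors. -/
theorem resMul_bilOfRestrict
    (θ : day ((restrict 𝕜).obj N) ((restrict 𝕜).obj N') ⟶ (restrict 𝕜).obj P) :
    resMul (realizeK 𝕜) N N' ≫ (restrict 𝕜).map (bilOfRestrict θ).desc = θ :=
  day_ext fun {u v} n n' => by
    refine (congrArg (ap (bilOfRestrict θ).desc _) (dn_resMul n n')).trans ?_
    exact Bil.desc_tm (bilOfRestrict θ) (u := (realizeK 𝕜).obj u) (v := (realizeK 𝕜).obj v) n n'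

theorem restrict_map_ext {ψ ψ' : day N N' ⟶ P}
    (h : resMul (realizeK 𝕜) N N' ≫ (restrict 𝕜).map ψ =
      resMul (realizeK 𝕜) N N' ≫ (restrict 𝕜).map ψ') : ψ = ψ' :=
  day_ext fun {u v} n n' => by
    have h' := congrArg (fun t => ap t (up u ⊗ up v)
      (tm (M := (restrict 𝕜).obj N) (N := (restrict 𝕜).obj N') (u := up u) (v := up v) n n')) h
    have hm := dn_resMul (N := N) (N' := N') (u := up u) (v := up v) n n'
    exact (congrArg (ap ψ _) hm).symm.trans (Eq.trans h' (congrArg (ap ψ' _) hm))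

end

/-- A map `m : X ⟶ R Y` to a value of a full functor `R` is invertible if some map `Y ⟶ P` turns it
into an isomorphism `X ≅ R P` and if `m` detects the equality of endomorphisms of `Y`. -/
theorem isIso_of_full {B D : Type*} [Category* B] [Category* D] (R : B ⥤ D) [R.Full] {X : D}
    {Y P : B} (m : X ⟶ R.obj Y) (e : R.obj P ≅ X) (b : Y ⟶ P) (h₁ : m ≫ R.map b = e.inv)
    (h : ∀ ψ ψ' : Y ⟶ Y, m ≫ R.map ψ = m ≫ R.map ψ' → ψ = ψ') : IsIso m := by
  obtain ⟨χ, hχ⟩ := R.map_surjective (e.hom ≫ m)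
  have h₂ : b ≫ χ = 𝟙 _ := h _ _ (by
    rw [Functor.map_comp, hχ, reassoc_of% h₁, e.inv_hom_id_assoc, CategoryTheory.Functor.map_id,
      Category.comp_id])
  refine ⟨R.map b ≫ e.hom, ?_, ?_⟩
  · rw [reassoc_of% h₁, e.inv_hom_id]
  · rw [Category.assoc, ← hχ, ← Functor.map_comp, h₂, CategoryTheory.Functor.map_id]

section

open LinRep

variable {𝕜 : Type u} [CommRing 𝕜]

/-- Restriction preserves tensor products: as `F* N ⊗ F* N'` is deflative, it is the restriction of
some biset functor, which has the universal property of `N ⊗ N'`. -/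
instance (N N' : BisetFunctor 𝕜) : IsIso (Functor.LaxMonoidal.μ (restrict 𝕜) N N') :=
  isIso_of_full (restrict 𝕜) (Functor.LaxMonoidal.μ (restrict 𝕜) N N')
    ((deflative_restrict N').day_right ((restrict 𝕜).obj N)).descIso
    (bilOfRestrict ((deflative_restrict N').day_right ((restrict 𝕜).obj N)).descIso.inv).desc
    (resMul_bilOfRestrict _) (fun _ _ h => restrict_map_ext h)

/-! ### The unit of the Green functor -/

/-- As realization is full, the unit of the Green functor is surjective. -/
theorem one_surjective (u : SpanK 𝕜) :
    Function.Surjective (ap (MonObj.one (X := greenA 𝕜)) u) := by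
  intro a
  obtain ⟨b, hb⟩ := (realizeK 𝕜).map_surjective (X := 𝟙_ (SpanK 𝕜)) (Y := u)
    (uel (dn (F := realizeK 𝕜) a))
  refine ⟨b, (congrArg (fun t => ap t u b) (Comparison.one_eq (restrict 𝕜))).trans ?_⟩
  exact (Category.id_comp _).trans hb

/-- The unit `M ⟶ A ⊗ M` is an epimorphism, as the unit of `A` is surjective. -/
instance (M : GlobalMackey 𝕜) : Epi (MonObj.one (X := greenA 𝕜) ▷ M) where
  left_cancellation {P} φ ψ h := day_ext fun {u v} a m => by
    obtain ⟨b, rfl⟩ := one_surjective u a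
    have hb : ap (MonObj.one (X := greenA 𝕜) ▷ M) (u ⊗ v) (tm b m) =
        tm (ap (MonObj.one (X := greenA 𝕜)) u b) m := dayHom_tm _ _ _ _
    have h' := congrArg (fun t => ap t (u ⊗ v) (tm b m)) h
    rw [← hb]
    exact h'

end

/-! ### The tensor structure of the comparison functor -/

namespace Comparison

universe v₁ u₂ v₂

open ModTensor
open scoped MonoidalLeftAction

variable {B : Type u} [Category.{v} B] [MonoidalCategory B] [SymmetricCategory B] {D : Type u₂}
  [Category.{v₂} D] [MonoidalCategory D] [SymmetricCategory D] (R : B ⥤ D) [R.LaxBraided]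

/-- The tensorator of `R`, as a morphism between the objects underlying the modules. -/
def mu (N N' : B) :
    ((functor R).obj N).X ⊗ ((functor R).obj N').X ⟶ ((functor R).obj (N ⊗ N')).X :=
  Functor.LaxMonoidal.μ R N N'

theorem mu_natural_left {N N' : B} (f : N ⟶ N') (K : B) :
    ((functor R).map f).hom ▷ ((functor R).obj K).X ≫ mu R N' K =
      mu R N K ≫ ((functor R).map (f ▷ K)).hom :=
  Functor.LaxMonoidal.μ_natural_left R f K

theorem mu_natural_right {N N' : B} (K : B) (f : N ⟶ N') :
    ((functor R).obj K).X ◁ ((functor R).map f).hom ≫ mu R K N' =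
      mu R K N ≫ ((functor R).map (K ◁ f)).hom :=
  Functor.LaxMonoidal.μ_natural_right R K f

theorem mu_assoc (X Y Z : B) :
    mu R X Y ▷ ((functor R).obj Z).X ≫ mu R (X ⊗ Y) Z ≫ ((functor R).map (α_ X Y Z).hom).hom =
      (α_ _ _ _).hom ≫ ((functor R).obj X).X ◁ mu R Y Z ≫ mu R X (Y ⊗ Z) :=
  Functor.LaxMonoidal.associativity R X Y Z

theorem mu_braid (N N' : B) :
    mu R N N' ≫ ((functor R).map (β_ N N').hom).hom = (β_ _ _).hom ≫ mu R N' N :=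
  Functor.LaxBraided.braided N N'

theorem sm_functor (N : B) :
    sm ((functor R).obj N) = mu R (𝟙_ B) N ≫ ((functor R).map (λ_ N).hom).hom := rfl

theorem aL_mu (N N' : B) :
    aL ((functor R).obj N) ((functor R).obj N').X ≫ mu R N N' =
      unitMon R ◁ mu R N N' ≫ sm ((functor R).obj (N ⊗ N')) := by
  have h : mu R (𝟙_ B) N ▷ ((functor R).obj N').X ≫ mu R (𝟙_ B ⊗ N) N' ≫
      ((functor R).map (α_ (𝟙_ B) N N').hom).hom =
      (α_ (unitMon R) _ _).hom ≫ unitMon R ◁ mu R N N' ≫ mu R (𝟙_ B) (N ⊗ N') :=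
    mu_assoc R (𝟙_ B) N N'
  have h' : ((functor R).map (α_ (𝟙_ B) N N').hom).hom ≫ ((functor R).map (λ_ (N ⊗ N')).hom).hom =
      ((functor R).map ((λ_ N).hom ▷ N')).hom := by
    rw [← Mod.comp_hom', ← Functor.map_comp, leftUnitor_tensor_hom, Iso.hom_inv_id_assoc]
  have e := congrArg (fun t => t ≫ ((functor R).map (λ_ (N ⊗ N')).hom).hom) h
  simp only [Category.assoc, h'] at e
  rw [← mu_natural_left, ← comp_whiskerRight_assoc] at e
  have e' : (sm ((functor R).obj N)) ▷ ((functor R).obj N').X ≫ mu R N N' =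
      (α_ (unitMon R) _ _).hom ≫ unitMon R ◁ mu R N N' ≫ sm ((functor R).obj (N ⊗ N')) :=
    e.trans ((Category.assoc _ _ _).trans (congrArg (fun t => _ ≫ t) (Category.assoc _ _ _)))
  rw [aL, Category.assoc, e', Iso.inv_hom_id_assoc]

theorem aR_mu (N N' : B) :
    aR ((functor R).obj N).X ((functor R).obj N') ≫ mu R N N' =
      unitMon R ◁ mu R N N' ≫ sm ((functor R).obj (N ⊗ N')) := by
  have h : mu R N N' = (β_ _ _).hom ≫ mu R N' N ≫ ((functor R).map (β_ N' N).hom).hom := by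
    rw [mu_braid, SymmetricCategory.symmetry_assoc]
  rw [h, reassoc_of% aR_braid, reassoc_of% aL_mu R N' N, sm_hom]
  simp only [MonoidalCategory.whiskerLeft_comp, Category.assoc]

variable [HasCoequalizers D]
  [∀ X : D, PreservesColimitsOfShape WalkingParallelPair (tensorLeft X)]

/-- The tensorator of the comparison functor, induced by that of `R`. -/
noncomputable def tensorator (N N' : B) :
    (functor R).obj N ⊗ (functor R).obj N' ⟶ (functor R).obj (N ⊗ N') :=
  tdesc (mu R N N') (aL_mu R N N') (aR_mu R N N')

theorem prj_tensorator (N N' : B) :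
    prj ((functor R).obj N) ((functor R).obj N') ≫ (tensorator R N N').hom = mu R N N' :=
  prj_tdesc _ _ _

/-- The unit comparison of the comparison functor, which is the identity of `R 𝟙`. -/
noncomputable def unitIso : 𝟙_ (CategoryTheory.Mod D (unitMon R)) ≅ (functor R).obj (𝟙_ B) :=
  isoMk (M := unit (unitMon R)) (N := (functor R).obj (𝟙_ B)) (Iso.refl (unitMon R)) (by
    have h : MonObj.mul (X := unitMon R) ≫ 𝟙 (unitMon R) =
      unitMon R ◁ 𝟙 (unitMon R) ≫ MonObj.mul (X := unitMon R) := by simp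
    exact h)

noncomputable instance : (functor R).LaxMonoidal where
  ε := (unitIso R).hom
  μ := tensorator R
  μ_natural_left {N N'} f K := tens_ext (by
    have e : prj ((functor R).obj N) ((functor R).obj K) ≫
        (tmap ((functor R).map f) (𝟙 ((functor R).obj K))).hom ≫ (tensorator R N' K).hom =
        prj ((functor R).obj N) ((functor R).obj K) ≫ (tensorator R N K).hom ≫
          ((functor R).map (f ▷ K)).hom := by
      rw [reassoc_of% prj_tmap, reassoc_of% prj_tensorator R N K, prj_tensorator,
        ← mu_natural_left, Mod.id_hom', tensorHom_id]
    exact e)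
  μ_natural_right {N N'} K f := tens_ext (by
    have e : prj ((functor R).obj K) ((functor R).obj N) ≫
        (tmap (𝟙 ((functor R).obj K)) ((functor R).map f)).hom ≫ (tensorator R K N').hom =
        prj ((functor R).obj K) ((functor R).obj N) ≫ (tensorator R K N).hom ≫
          ((functor R).map (K ◁ f)).hom := by
      rw [reassoc_of% prj_tmap, reassoc_of% prj_tensorator R K N, prj_tensorator,
        ← mu_natural_right, Mod.id_hom', id_tensorHom]
    exact e)
  associativity X Y Z := tens_ext₃ (by
    have h₁ : prj (tens ((functor R).obj X) ((functor R).obj Y)) ((functor R).obj Z) ≫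
        (tmap (tensorator R X Y) (𝟙 ((functor R).obj Z))).hom =
        (tensorator R X Y).hom ▷ ((functor R).obj Z).X ≫
          prj ((functor R).obj (X ⊗ Y)) ((functor R).obj Z) := by
      rw [← tensorHom_id, ← Mod.id_hom']
      exact prj_tmap _ _
    have h₂ : prj ((functor R).obj X) (tens ((functor R).obj Y) ((functor R).obj Z)) ≫
        (tmap (𝟙 ((functor R).obj X)) (tensorator R Y Z)).hom =
        ((functor R).obj X).X ◁ (tensorator R Y Z).hom ≫
          prj ((functor R).obj X) ((functor R).obj (Y ⊗ Z)) := by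
      rw [← id_tensorHom, ← Mod.id_hom']
      exact prj_tmap _ _
    have h₃ : prj ((functor R).obj X) ((functor R).obj Y) ▷ ((functor R).obj Z).X ≫
        (tensorator R X Y).hom ▷ ((functor R).obj Z).X = mu R X Y ▷ ((functor R).obj Z).X := by
      rw [← prj_tensorator]
      exact (comp_whiskerRight _ _ _).symm
    have h₄ : ((functor R).obj X).X ◁ prj ((functor R).obj Y) ((functor R).obj Z) ≫
        ((functor R).obj X).X ◁ (tensorator R Y Z).hom = ((functor R).obj X).X ◁ mu R Y Z := by
      rw [← prj_tensorator]
      exact (MonoidalCategory.whiskerLeft_comp _ _ _).symm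
    have h₅ := prj_tassoc ((functor R).obj X) ((functor R).obj Y) ((functor R).obj Z)
    have e : prj ((functor R).obj X) ((functor R).obj Y) ▷ ((functor R).obj Z).X ≫
        prj (tens ((functor R).obj X) ((functor R).obj Y)) ((functor R).obj Z) ≫
          (tmap (tensorator R X Y) (𝟙 ((functor R).obj Z))).hom ≫
            (tensorator R (X ⊗ Y) Z).hom ≫ ((functor R).map (α_ X Y Z).hom).hom =
        prj ((functor R).obj X) ((functor R).obj Y) ▷ ((functor R).obj Z).X ≫
        prj (tens ((functor R).obj X) ((functor R).obj Y)) ((functor R).obj Z) ≫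
          (tassoc ((functor R).obj X) ((functor R).obj Y) ((functor R).obj Z)).hom ≫
            (tmap (𝟙 ((functor R).obj X)) (tensorator R Y Z)).hom ≫
              (tensorator R X (Y ⊗ Z)).hom := by
      rw [reassoc_of% h₁, reassoc_of% h₃, reassoc_of% prj_tensorator R (X ⊗ Y) Z,
        reassoc_of% h₅, reassoc_of% h₂, reassoc_of% h₄, prj_tensorator R X (Y ⊗ Z)]
      exact mu_assoc R X Y Z
    exact e)
  left_unitality X := tens_ext (by
    have h : prj (unit (unitMon R)) ((functor R).obj X) ≫
        (tmap (unitIso R).hom (𝟙 ((functor R).obj X))).hom =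
        prj ((functor R).obj (𝟙_ B)) ((functor R).obj X) :=
      (prj_tmap _ _).trans ((congrArg (fun t => t ≫ _)
        (id_tensorHom_id (R.obj (𝟙_ B)) (R.obj X))).trans (Category.id_comp _))
    have e : pru ((functor R).obj X) ≫ (tleftIso ((functor R).obj X)).hom.hom =
        prj (unit (unitMon R)) ((functor R).obj X) ≫
        (tmap (unitIso R).hom (𝟙 ((functor R).obj X))).hom ≫ (tensorator R (𝟙_ B) X).hom ≫
          ((functor R).map (λ_ X).hom).hom := by
      have h' : prj ((functor R).obj (𝟙_ B)) ((functor R).obj X) ≫ (tensorator R (𝟙_ B) X).hom ≫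
          ((functor R).map (λ_ X).hom).hom = sm ((functor R).obj X) := by
        rw [reassoc_of% prj_tensorator R (𝟙_ B) X, sm_functor]
      exact (pru_tleftIso _).trans (h'.symm.trans
        ((congrArg (fun t => t ≫ (tensorator R (𝟙_ B) X).hom ≫
          ((functor R).map (λ_ X).hom).hom) h.symm).trans (Category.assoc _ _ _)))
    exact e)
  right_unitality X := tens_ext (by
    have h : prj ((functor R).obj X) (unit (unitMon R)) ≫
        (tmap (𝟙 ((functor R).obj X)) (unitIso R).hom).hom =
        prj ((functor R).obj X) ((functor R).obj (𝟙_ B)) :=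
      (prj_tmap _ _).trans ((congrArg (fun t => t ≫ _)
        (id_tensorHom_id (R.obj X) (R.obj (𝟙_ B)))).trans (Category.id_comp _))
    have h' : (β_ ((functor R).obj X).X (unitMon R)).hom ≫ sm ((functor R).obj X) =
        mu R X (𝟙_ B) ≫ ((functor R).map (ρ_ X).hom).hom := by
      rw [← braiding_leftUnitor, Functor.map_comp, Mod.comp_hom', reassoc_of% mu_braid]
      rfl
    have e : pru' ((functor R).obj X) ≫ (trightIso ((functor R).obj X)).hom.hom =
        prj ((functor R).obj X) (unit (unitMon R)) ≫
        (tmap (𝟙 ((functor R).obj X)) (unitIso R).hom).hom ≫ (tensorator R X (𝟙_ B)).hom ≫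
          ((functor R).map (ρ_ X).hom).hom := by
      have h'' : prj ((functor R).obj X) ((functor R).obj (𝟙_ B)) ≫ (tensorator R X (𝟙_ B)).hom ≫
          ((functor R).map (ρ_ X).hom).hom = mu R X (𝟙_ B) ≫ ((functor R).map (ρ_ X).hom).hom := by
        rw [reassoc_of% prj_tensorator R X (𝟙_ B)]
      exact (pru_trightIso _).trans (h'.trans (h''.symm.trans
        ((congrArg (fun t => t ≫ (tensorator R X (𝟙_ B)).hom ≫
          ((functor R).map (ρ_ X).hom).hom) h.symm).trans (Category.assoc _ _ _))))
    exact e)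

noncomputable instance : (functor R).LaxBraided where
  braided N N' := tens_ext (by
    have e : prj ((functor R).obj N) ((functor R).obj N') ≫ (tensorator R N N').hom ≫
        ((functor R).map (β_ N N').hom).hom =
        prj ((functor R).obj N) ((functor R).obj N') ≫
        (tbraid ((functor R).obj N) ((functor R).obj N')).hom ≫ (tensorator R N' N).hom := by
      rw [reassoc_of% prj_tbraid, reassoc_of% prj_tensorator R N N', prj_tensorator R N' N]
      exact mu_braid R N N'
    exact e)

instance : IsIso (Functor.LaxMonoidal.ε (functor R)) := (unitIso R).isIso_hom

/-- If the tensorator of `R` is invertible, then so is the projection to the tensor product over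
`R 𝟙`, which is an epimorphism through which it factors. -/
theorem isIso_prj (N N' : B) (h : IsIso (mu R N N')) :
    IsIso (prj ((functor R).obj N) ((functor R).obj N')) := by
  have h' : prj ((functor R).obj N) ((functor R).obj N') ≫ (tensorator R N N').hom ≫
      inv (mu R N N') = 𝟙 _ := by
    rw [reassoc_of% prj_tensorator R N N', IsIso.hom_inv_id]
  have : IsSplitMono (prj ((functor R).obj N) ((functor R).obj N')) := ⟨⟨_, h'⟩⟩
  exact isIso_of_epi_of_isSplitMono _

theorem isIso_tensorator (N N' : B) (h : IsIso (mu R N N')) :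
    IsIso (tensorator R N N').hom := by
  have := isIso_prj R N N' h
  have : IsIso (prj ((functor R).obj N) ((functor R).obj N') ≫ (tensorator R N N').hom) := by
    rwa [prj_tensorator]
  exact IsIso.of_isIso_comp_left (prj ((functor R).obj N) ((functor R).obj N')) _

end Comparison

/-! ### Modules over the Green functor are deflative functors -/

section

variable (𝕜 : Type u) [CommRing 𝕜]

instance : (forgetMod 𝕜).Faithful where
  map_injective h := Mod.hom_ext _ _ h

/-- Equivariance is automatic: it can be checked after composition with the unit of `A`, which is
surjective. -/
theorem sm_natural {X Y : GreenMod 𝕜} (f : X.X ⟶ Y.X) :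
    ModTensor.sm X ≫ f = greenA 𝕜 ◁ f ≫ ModTensor.sm Y := by
  rw [← cancel_epi (MonObj.one (X := greenA 𝕜) ▷ X.X), ← whisker_exchange_assoc,
    ← Category.assoc, ModTensor.one_sm, ModTensor.one_sm, leftUnitor_naturality]

instance : (forgetMod 𝕜).Full where
  map_surjective f := ⟨ModTensor.homMk f (sm_natural 𝕜 f), rfl⟩

/-- The functor underlying a module over `A` is a retract of its tensor product with `A`, which is
itself a restriction. -/
theorem deflative_forgetMod (X : GreenMod 𝕜) : deflative 𝕜 ((forgetMod 𝕜).obj X) := by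
  have hA : deflative 𝕜 (greenA 𝕜) := deflative_restrict (𝟙_ (BisetFunctor 𝕜))
  refine deflative_of_retract ((λ_ X.X).inv ≫ MonObj.one (X := greenA 𝕜) ▷ X.X) (ModTensor.sm X)
    ?_ (deflative.tensor_left hA X.X)
  have h : MonObj.one (X := greenA 𝕜) ▷ X.X ≫ ModTensor.sm X = (λ_ X.X).hom := ModTensor.one_sm X
  exact (Category.assoc _ _ _).trans ((congrArg (fun t => _ ≫ t) h).trans (Iso.inv_hom_id _))

theorem forgetMod_essImage : (forgetMod 𝕜).essImage = deflative 𝕜 := by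
  ext M
  exact ⟨fun ⟨X, ⟨e⟩⟩ => deflative_of_iso e.symm (deflative_forgetMod 𝕜 X),
    fun hM => ⟨(bisetToMod 𝕜).obj (deflative.desc hM), ⟨deflative.descIso hM⟩⟩⟩

theorem bisetToMod_forgetMod : bisetToMod 𝕜 ⋙ forgetMod 𝕜 = restrict 𝕜 := rfl

instance : (bisetToMod 𝕜).Faithful :=
  have : (bisetToMod 𝕜 ⋙ forgetMod 𝕜).Faithful := inferInstanceAs (restrict 𝕜).Faithful
  Functor.Faithful.of_comp (bisetToMod 𝕜) (forgetMod 𝕜)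

instance : (bisetToMod 𝕜).Full :=
  have : (bisetToMod 𝕜 ⋙ forgetMod 𝕜).Full := inferInstanceAs (restrict 𝕜).Full
  Functor.Full.of_comp_faithful (bisetToMod 𝕜) (forgetMod 𝕜)

instance : (bisetToMod 𝕜).EssSurj where
  mem_essImage X :=
    ⟨deflative.desc (deflative_forgetMod 𝕜 X),
      ⟨(forgetMod 𝕜).preimageIso (deflative.descIso (deflative_forgetMod 𝕜 X))⟩⟩

instance : (bisetToMod 𝕜).IsEquivalence where

instance : (bisetToMod 𝕜).Additive where
  map_add {_ _ f g} := Mod.hom_ext _ _ ((restrict 𝕜).map_add (f := f) (g := g))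

instance : (bisetToMod 𝕜).Linear 𝕜 where
  map_smul f r := Mod.hom_ext _ _ (Functor.Linear.map_smul (F := restrict 𝕜) f r)

/-! ### The tensor structures -/

/-- The lax symmetric monoidal structure of the comparison functor. -/
noncomputable abbrev bisetToModLax : (bisetToMod 𝕜).LaxBraided :=
  inferInstanceAs (Comparison.functor (restrict 𝕜)).LaxBraided

theorem isIso_bisetToMod_mu (N N' : BisetFunctor 𝕜) :
    letI := bisetToModLax 𝕜
    IsIso (Functor.LaxMonoidal.μ (bisetToMod 𝕜) N N') := by
  let := bisetToModLax 𝕜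
  have h : IsIso ((forgetMod 𝕜).map (Functor.LaxMonoidal.μ (bisetToMod 𝕜) N N')) :=
    Comparison.isIso_tensorator (restrict 𝕜) N N'
      (inferInstanceAs (IsIso (Functor.LaxMonoidal.μ (restrict 𝕜) N N')))
  exact isIso_of_fully_faithful (forgetMod 𝕜) _

/-- The strong symmetric monoidal structure of the comparison functor. -/
noncomputable abbrev bisetToModBraided : (bisetToMod 𝕜).Braided :=
  letI := bisetToModLax 𝕜
  haveI := isIso_bisetToMod_mu 𝕜
  haveI : IsIso (Functor.LaxMonoidal.ε (bisetToMod 𝕜)) :=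
    inferInstanceAs (IsIso (Functor.LaxMonoidal.ε (Comparison.functor (restrict 𝕜))))
  { Functor.Monoidal.ofLaxMonoidal (bisetToMod 𝕜) with
    braided := Functor.LaxBraided.braided (F := bisetToMod 𝕜) }

theorem epsilon_comp :
    letI := bisetToModBraided 𝕜
    Functor.LaxMonoidal.ε (forgetMod 𝕜) ≫
      (forgetMod 𝕜).map (Functor.LaxMonoidal.ε (bisetToMod 𝕜)) =
      Functor.LaxMonoidal.ε (restrict 𝕜) :=
  (Category.comp_id (MonObj.one (X := greenA 𝕜))).trans (Comparison.one_eq (restrict 𝕜))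

theorem mu_comp (N N' : BisetFunctor 𝕜) :
    letI := bisetToModBraided 𝕜
    Functor.LaxMonoidal.μ (forgetMod 𝕜) ((bisetToMod 𝕜).obj N) ((bisetToMod 𝕜).obj N') ≫
      (forgetMod 𝕜).map (Functor.LaxMonoidal.μ (bisetToMod 𝕜) N N') =
      Functor.LaxMonoidal.μ (restrict 𝕜) N N' :=
  Comparison.prj_tensorator (restrict 𝕜) N N'

/-- Up to isomorphism all modules come from biset functors, for which the projection to the tensor
product over `A` is a factor of the tensorator of restriction. -/
theorem isIso_forgetMod_mu (X Y : GreenMod 𝕜) :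
    IsIso (Functor.LaxMonoidal.μ (forgetMod 𝕜) X Y) := by
  let e := (bisetToMod 𝕜).objObjPreimageIso X
  let e' := (bisetToMod 𝕜).objObjPreimageIso Y
  have h : IsIso (Functor.LaxMonoidal.μ (forgetMod 𝕜)
      ((bisetToMod 𝕜).obj ((bisetToMod 𝕜).objPreimage X))
      ((bisetToMod 𝕜).obj ((bisetToMod 𝕜).objPreimage Y))) :=
    Comparison.isIso_prj (restrict 𝕜) _ _
      (inferInstanceAs (IsIso (Functor.LaxMonoidal.μ (restrict 𝕜) _ _)))
  have h' : Functor.LaxMonoidal.μ (forgetMod 𝕜) X Y =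
      ((forgetMod 𝕜).map e.inv ⊗ₘ (forgetMod 𝕜).map e'.inv) ≫
        Functor.LaxMonoidal.μ (forgetMod 𝕜) _ _ ≫ (forgetMod 𝕜).map (e.hom ⊗ₘ e'.hom) := by
    rw [← Functor.LaxMonoidal.μ_natural, tensorHom_comp_tensorHom_assoc, ← Functor.map_comp,
      ← Functor.map_comp]
    simp
  rw [h']
  infer_instance

/-! ### The reflection -/

/-- The reflection of a global Mackey functor `M` into the deflative ones is `A ⊗ M`; a morphism to
a deflative functor extends along `M ⟶ A ⊗ M` by the action of `A`, uniquely since the unit of `A`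
is surjective. -/
theorem bijective_unit_comp (M : GlobalMackey 𝕜) {N : GlobalMackey 𝕜} (hN : deflative 𝕜 N) :
    Function.Bijective (fun g : greenA 𝕜 ⊗ M ⟶ N =>
      ((λ_ M).inv ≫ MonObj.one (X := greenA 𝕜) ▷ M) ≫ g) := by
  refine ⟨fun g g' h => (cancel_epi _).1 h, fun f => ?_⟩
  let X := (bisetToMod 𝕜).obj (deflative.desc hN)
  let e : X.X ≅ N := deflative.descIso hN
  refine ⟨greenA 𝕜 ◁ (f ≫ e.inv) ≫ ModTensor.sm X ≫ e.hom, ?_⟩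
  have h : MonObj.one (X := greenA 𝕜) ▷ X.X ≫ ModTensor.sm X = (λ_ X.X).hom := ModTensor.one_sm X
  change ((λ_ M).inv ≫ _) ≫ _ = f
  rw [Category.assoc, ← whisker_exchange_assoc, reassoc_of% h]
  simp

/-- Extension of morphisms along the reflection. -/
noncomputable def reflectionEquiv (M : GlobalMackey 𝕜) (N : (deflative 𝕜).FullSubcategory) :
    ((⟨greenA 𝕜 ⊗ M, deflative.tensor_left (deflative_restrict (𝟙_ (BisetFunctor 𝕜))) M⟩ :
      (deflative 𝕜).FullSubcategory) ⟶ N) ≃ (M ⟶ (deflative 𝕜).ι.obj N) :=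
  (deflative 𝕜).fullyFaithfulι.homEquiv.trans
    (Equiv.ofBijective _ (bijective_unit_comp 𝕜 M N.property))

noncomputable instance : Reflective (deflative 𝕜).ι where
  L := Adjunction.leftAdjointOfEquiv (reflectionEquiv 𝕜)
    (fun _ _ _ g h => (Category.assoc _ h.hom g.hom).symm)
  adj := Adjunction.adjunctionOfEquivLeft (reflectionEquiv 𝕜)
    (fun _ _ _ g h => (Category.assoc _ h.hom g.hom).symm)

end

theorem corollary1p6 (𝕜 : Type u) [CommRing 𝕜] :
    (∃ _ : (bisetToMod 𝕜).Braided,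
      (bisetToMod 𝕜).IsEquivalence ∧ (bisetToMod 𝕜).Additive ∧ (bisetToMod 𝕜).Linear 𝕜 ∧
      bisetToMod 𝕜 ⋙ forgetMod 𝕜 = restrict 𝕜 ∧
      Functor.LaxMonoidal.ε (forgetMod 𝕜) ≫
        (forgetMod 𝕜).map (Functor.LaxMonoidal.ε (bisetToMod 𝕜)) =
        Functor.LaxMonoidal.ε (restrict 𝕜) ∧
      ∀ N N' : BisetFunctor 𝕜,
        Functor.LaxMonoidal.μ (forgetMod 𝕜) ((bisetToMod 𝕜).obj N) ((bisetToMod 𝕜).obj N') ≫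
          (forgetMod 𝕜).map (Functor.LaxMonoidal.μ (bisetToMod 𝕜) N N') =
          Functor.LaxMonoidal.μ (restrict 𝕜) N N') ∧
    (restrict 𝕜).Full ∧ (restrict 𝕜).Faithful ∧ (restrict 𝕜).essImage = deflative 𝕜 ∧
    (∀ N N' : BisetFunctor 𝕜, IsIso (Functor.LaxMonoidal.μ (restrict 𝕜) N N')) ∧
    (forgetMod 𝕜).Full ∧ (forgetMod 𝕜).Faithful ∧ (forgetMod 𝕜).essImage = deflative 𝕜 ∧
    (∀ X Y : GreenMod 𝕜, IsIso (Functor.LaxMonoidal.μ (forgetMod 𝕜) X Y)) ∧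
    Nonempty (Reflective (deflative 𝕜).ι) ∧
    ∀ M N : GlobalMackey 𝕜, deflative 𝕜 N → deflative 𝕜 (M ⊗ N) := by
  exact ⟨⟨bisetToModBraided 𝕜, inferInstance, inferInstance, inferInstance, bisetToMod_forgetMod 𝕜,
      epsilon_comp 𝕜, mu_comp 𝕜⟩, inferInstance, inferInstance, restrict_essImage,
    fun _ _ => inferInstance, inferInstance, inferInstance, forgetMod_essImage 𝕜,
    isIso_forgetMod_mu 𝕜, ⟨inferInstance⟩, fun M _ hN => deflative.tensor_right M hN⟩
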